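/- **Setting.** Fix $\sigma_f,\sigma_\epsilon>0$, $r,a,b>0$, $\delta\in(0,1)$, $d\ge 1$. Let $D\subset[0,r]^d$ be compact and convex and let $K(x,x')=k(\|x-x'\|_2/l)$ with $l>0$, $k(0)=\sigma_f^2$. Let $f$ be a sample on $D$ of a Gaussian process with mean zero and covariance $K$, with almost surely differentiable paths satisfying $$\Pr\Big\{\sup_{x\in D}|\partial f/\partial x_j|>L\Big\}\le a\,e^{-(L/b)^2}\qquad(L>0,\ j=1,\dots,d).$$ Put $\beta_t=2\log\frac{2t^2\pi^2}{3\delta}+2d\log\big(t^2dbr\sqrt{\log(4da/\delta)}\big)$ (in degenerate cases read $\sqrt u=0$ for $u<0$ and $\log 0=0$). For $t\ge1$ let $0=R_0<\dots<R_{M_t}$, $M_t\ge 1$, be breakpoints with $R_{M_t}\ge\|x-x'\|_2/l$ for all $x,x'\in D$, let $\tilde k_t$ be the piecewise linear interpolant of $k$ at them, $\tilde K(x,x')=\tilde k_t(\|x-x'\|_2/l)$, and let $\epsilon_{M_t}\ge\sup_{[0,R_{M_t}]}|k-\tilde k_t|$. *PK-MIQP* queries, in round $t$, a point $x_t\in D$,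 chosen by a measurable rule from the data $X=(x_1,\dots,x_{t-1})$, $\mathbf y=(y_1,\dots,y_{t-1})$, and observes $y_t=f(x_t)+\xi_t$ with $\xi_t\sim\mathcal N(0,\sigma_\epsilon^2)$ independent of each other and of $f$. Almost surely, $x_t$ is for every $t$ the $x$-part of an optimal solution of $$\min_{x\in D}\ \tilde\mu-\beta_t^{1/2}\tilde\sigma\quad\text{s.t.}\quad \tilde\mu=\tilde K_{xX}(\tilde K_{XX}+\sigma_\epsilon^2I)^{-1}\mathbf y,\quad \tilde\sigma^2\le \tilde k_t(0)-\tilde K_{xX}(\tilde K_{XX}+\sigma_\epsilon^2I)^{-1}\tilde K_{Xx},$$ $$r_i^2=\|x-x_i\|_2^2/l^2,\quad r_i=\sum_{j=0}^{M_t}w_i^jR_j,\quad \tilde K_{xx_i}=\sum_{j=0}^{M_t}w_i^jk(R_j),\quad \sum_{j=0}^{M_t}w_i^j=1,\quad w_i^j\ge0,$$ $$\sum_{j=1}^{M_t}\lambda_i^j=1,\quad \lambda_i^j\in\{0,1\},\quad w_i^0\le\lambda_i^1,\quad w_i^j\le\lambda_i^j+\lambda_i^{j+1}\ (1\le j<M_t),\quad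 w_i^{M_t}\le\lambda_i^{M_t}\qquad(1\le i\le t-1).$$ Let $x^*$ minimize $f$ on $D$, $R_T=\sum_{t=1}^T(f(x_t)-f(x^*))$, and let $\gamma_T=\sup_{X\in D^T}\tfrac12\log\det(I+\sigma_\epsilon^{-2}K_{XX})$ be the maximal information gain. **Lemma.** Suppose $\epsilon_{M_t}\le c\,t^{-(4+\eta)}$ for all $t\ge1$, with constants $c,\eta>0$. Then there are positive constants - $C_\sigma$, depending only on $\sigma_f,\sigma_\epsilon$, - $C$ and $q\in\mathbb N$, depending only on $\sigma_f,\sigma_\epsilon,r,a,b,\delta,c,\eta$ (not on $d$), - $C_\mu$, depending only on $\sigma_f,\sigma_\epsilon,r,a,b,\delta,c,\eta,d$, such that, with $C_1=\dfrac{8\sigma_f^2}{\log(1+\sigma_f^2\sigma_\epsilon^{-2})}$ and $C_2(T)=\sum_{t=1}^T\big(\tfrac1{t^2}+2C_\mu t^2\epsilon_{M_t}+4C_\sigma\beta_t^{1/2}t\,\epsilon_{M_t}^{1/2}\big)$, with probability at least $1-\delta$ the following two bounds hold for all $T\ge1$: $$R_T\le\sqrt{C_1T\beta_T\gamma_T}+C_2(T),\qquad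 R_T\le C\sqrt{dT\gamma_T}\,\big(1+\log(dT)\big)^q .$$ (The second bound is $R_T=O^*(\sqrt{dT\gamma_T})$, where $O^*$ hides logarithmic factors.) -/

import Mathlib

open MeasureTheory ProbabilityTheory
open scoped BigOperators

noncomputable section

namespace PKMIQP

/-- Points of `ℝᵈ` with the Euclidean norm. -/
abbrev Pt (d : ℕ) := EuclideanSpace ℝ (Fin d)

/-! ### Kernels -/

/-- The isotropic kernel `K(x, x') = k(‖x - x'‖₂ / l)` with radial profile `k` and
lengthscale `l`. -/
def isoKernel {d : ℕ} (k : ℝ → ℝ) (l : ℝ) (x x' : Pt d) : ℝ := k (‖x - x'‖ / l)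

/-- The matrix `K_XX` of a kernel at the points `X`. -/
def gram {d N : ℕ} (K : Pt d → Pt d → ℝ) (X : Fin N → Pt d) : Matrix (Fin N) (Fin N) ℝ :=
  Matrix.of fun i j => K (X i) (X j)

/-- `R 0 < R 1 < ⋯ < R M` are admissible breakpoints for the distances that occur in `D`:
they start at `0` and reach at least the largest scaled distance. There are `M ≥ 1` linear
pieces. -/
structure IsBreakpoints {d : ℕ} (D : Set (Pt d)) (l : ℝ) (M : ℕ) (R : ℕ → ℝ) : Prop where
  one_le : 1 ≤ M
  zero : R 0 = 0
  lt : ∀ j < M, R j < R (j + 1)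
  cover : ∀ x ∈ D, ∀ x' ∈ D, ‖x - x'‖ / l ≤ R M

/-- The continuous function which agrees with `k` at `R 0, …, R M`, is affine on each
`[R j, R (j+1)]`, and is constant to the left of `R 0` and to the right of `R M`. -/
def pwl (k : ℝ → ℝ) (M : ℕ) (R : ℕ → ℝ) (ρ : ℝ) : ℝ :=
  k (R 0) + ∑ j ∈ Finset.range M,
    (k (R (j + 1)) - k (R j)) * max 0 (min 1 ((ρ - R j) / (R (j + 1) - R j)))

/-! ### The mixed-integer quadratic program for the approximated LCB -/

/-- The mixed-integer encoding of `κ = k̃(ρ)`, with continuous weights `w 0, …, w M` and binary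
segment selectors `lam 1, …, lam M`. -/
structure PLEncoding (k : ℝ → ℝ) (M : ℕ) (R : ℕ → ℝ) (ρ κ : ℝ) (w lam : ℕ → ℝ) : Prop where
  arg_eq : ρ = ∑ j ∈ Finset.range (M + 1), w j * R j
  val_eq : κ = ∑ j ∈ Finset.range (M + 1), w j * k (R j)
  weight_sum : ∑ j ∈ Finset.range (M + 1), w j = 1
  weight_nonneg : ∀ j ≤ M, 0 ≤ w j
  sel_sum : ∑ j ∈ Finset.Icc 1 M, lam j = 1
  sel_binary : ∀ j ∈ Finset.Icc 1 M, lam j = 0 ∨ lam j = 1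
  weight_first : w 0 ≤ lam 1
  weight_mid : ∀ j, 1 ≤ j → j < M → w j ≤ lam j + lam (j + 1)
  weight_last : w M ≤ lam M

/-- The decision variables of the program when `N` data points are available. -/
structure Vars (d N : ℕ) where
  /-- the candidate point `x` -/
  point : Pt d
  /-- the approximated posterior mean at `x` -/
  mean : ℝ
  /-- the approximated posterior standard deviation at `x` -/
  sd : ℝ
  /-- the scaled distances from `x` to the data points -/
  dist : Fin N → ℝ
  /-- the approximated kernel values `k̃` at these distances -/
  ker : Fin N → ℝ
  /-- interpolation weights -/
  weight : Fin N → ℕ → ℝ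
  /-- segment selectors -/
  sel : Fin N → ℕ → ℝ

/-- The approximated data matrix `K̃_XX + σε² I`. -/
def approxGram {d N : ℕ} (k : ℝ → ℝ) (l σε : ℝ) (M : ℕ) (R : ℕ → ℝ) (X : Fin N → Pt d) :
    Matrix (Fin N) (Fin N) ℝ :=
  gram (isoKernel (pwl k M R) l) X + σε ^ 2 • (1 : Matrix (Fin N) (Fin N) ℝ)

/-- The constraints of the program with feasible region `D` and data `data i = (x_i, y_i)`. -/
structure IsFeasible {d N : ℕ} (D : Set (Pt d)) (k : ℝ → ℝ) (l σε : ℝ) (M : ℕ) (R : ℕ → ℝ)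
    (data : Fin N → Pt d × ℝ) (z : Vars d N) : Prop where
  point_mem : z.point ∈ D
  mean_eq : z.mean = z.ker ⬝ᵥ
    Matrix.mulVec (approxGram k l σε M R fun i => (data i).1)⁻¹ (fun i => (data i).2)
  var_le : z.sd ^ 2 ≤ pwl k M R 0 - z.ker ⬝ᵥ
    Matrix.mulVec (approxGram k l σε M R fun i => (data i).1)⁻¹ z.ker
  dist_eq : ∀ i, z.dist i ^ 2 = ‖z.point - (data i).1‖ ^ 2 / l ^ 2
  ker_eq : ∀ i, PLEncoding k M R (z.dist i) (z.ker i) (z.weight i) (z.sel i)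

/-- The approximated lower confidence bound `μ̃ - β^{1/2} σ̃`. -/
def objective {d N : ℕ} (β : ℝ) (z : Vars d N) : ℝ := z.mean - √β * z.sd

/-- `z` is a global optimum of the program. -/
def IsOptimal {d N : ℕ} (D : Set (Pt d)) (k : ℝ → ℝ) (l σε : ℝ) (M : ℕ) (R : ℕ → ℝ) (β : ℝ)
    (data : Fin N → Pt d × ℝ) (z : Vars d N) : Prop :=
  IsFeasible D k l σε M R data z ∧
    ∀ z', IsFeasible D k l σε M R data z' → objective β z ≤ objective β z'

/-! ### The Bayesian optimization loop -/

/-- `f` is, on `D`, a centered Gaussian process with covariance `K`. -/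
structure IsCenteredGP {d : ℕ} {Ω : Type*} [MeasurableSpace Ω] (P : Measure Ω) (D : Set (Pt d))
    (K : Pt d → Pt d → ℝ) (f : Ω → Pt d → ℝ) : Prop where
  measurable : ∀ x ∈ D, Measurable fun ω => f ω x
  gaussian : IsGaussianProcess (fun (x : D) ω => f ω x) P
  mean_zero : ∀ x ∈ D, ∫ ω, f ω x ∂P = 0
  covariance : ∀ x ∈ D, ∀ x' ∈ D, cov[fun ω => f ω x, fun ω => f ω x'; P] = K x x'

/-- The sample paths of `f` are differentiable on `D`, and the partial derivatives satisfy
`P {sup_{x ∈ D} |∂f/∂x_j| > L} ≤ a exp (-(L/b)²)`. -/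
structure HasDerivTail {d : ℕ} {Ω : Type*} [MeasurableSpace Ω] (P : Measure Ω) (D : Set (Pt d))
    (a b : ℝ) (f : Ω → Pt d → ℝ) : Prop where
  differentiable : ∀ᵐ ω ∂P, DifferentiableOn ℝ (f ω) D
  tail : ∀ (j : Fin d) (L : ℝ), 0 < L →
    P {ω | ∃ x ∈ D, L < |fderivWithin ℝ (f ω) D x (EuclideanSpace.single j 1)|}
      ≤ ENNReal.ofReal (a * Real.exp (-(L / b) ^ 2))

/-- `ξ 1, ξ 2, …` is independent `N(0, σε²)` noise which is independent of `f` on `D`. -/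
structure IsNoise {d : ℕ} {Ω : Type*} [MeasurableSpace Ω] (P : Measure Ω) (D : Set (Pt d))
    (σε : ℝ) (f : Ω → Pt d → ℝ) (ξ : ℕ → Ω → ℝ) : Prop where
  measurable : ∀ t, Measurable (ξ t)
  law : ∀ t, P.map (ξ t) = gaussianReal 0 (Real.toNNReal (σε ^ 2))
  indep : iIndepFun ξ P
  indep_fun : IndepFun (fun ω (x : D) => f ω x) (fun ω t => ξ t ω) P

/-- The data `(x_1, y_1), …, (x_{t-1}, y_{t-1})` available in round `t`. -/
def history {d : ℕ} {Ω : Type*} (x : ℕ → Ω → Pt d) (y : ℕ → Ω → ℝ) (t : ℕ) (ω : Ω) :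
    Fin (t - 1) → Pt d × ℝ :=
  fun i => (x (i + 1) ω, y (i + 1) ω)

/-- `x 1, x 2, …` are the points queried, and `y 1, y 2, …` the values observed, when in every
round `t ≥ 1` the point `x t` is an optimal solution of the program built from the data of the
previous rounds, with breakpoints `R t 0, …, R t (M t)` and exploration parameter `β t`. The point
is selected by a measurable rule that sees these data only. -/
structure IsRun {d : ℕ} {Ω : Type*} [MeasurableSpace Ω] (P : Measure Ω) (D : Set (Pt d))
    (k : ℝ → ℝ) (l σε : ℝ) (M : ℕ → ℕ) (R : ℕ → ℕ → ℝ) (β : ℕ → ℝ)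
    (f : Ω → Pt d → ℝ) (ξ : ℕ → Ω → ℝ) (x : ℕ → Ω → Pt d) (y : ℕ → Ω → ℝ) : Prop where
  obs : ∀ t ≥ 1, ∀ ω, y t ω = f ω (x t ω) + ξ t ω
  rule : ∀ t ≥ 1, ∃ A : (Fin (t - 1) → Pt d × ℝ) → Pt d, Measurable A ∧
    ∀ ω, x t ω = A (history x y t ω)
  optimal : ∀ᵐ ω ∂P, ∀ t ≥ 1, ∃ z : Vars d (t - 1),
    IsOptimal D k l σε (M t) (R t) (β t) (history x y t ω) z ∧ z.point = x t ω

/-! ### The quantities in the regret bound -/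

/-- The exploration parameter `β_t`. -/
def beta (d : ℕ) (r a b δ : ℝ) (t : ℕ) : ℝ :=
  2 * Real.log (2 * (t : ℝ) ^ 2 * Real.pi ^ 2 / (3 * δ)) +
    2 * d * Real.log ((t : ℝ) ^ 2 * d * b * r * √(Real.log (4 * d * a / δ)))

/-- The information gain `½ log det (I + σε⁻² K_XX)` about the process from noisy observations at
the points `X`. -/
def infoGain {d T : ℕ} (K : Pt d → Pt d → ℝ) (σε : ℝ) (X : Fin T → Pt d) : ℝ :=
  1 / 2 * Real.log (1 + (σε ^ 2)⁻¹ • gram K X).det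

/-- The maximal information gain `γ_T` after `T` rounds; a point may be observed repeatedly. -/
def maxInfoGain {d : ℕ} (D : Set (Pt d)) (K : Pt d → Pt d → ℝ) (σε : ℝ) (T : ℕ) : ℝ :=
  ⨆ X : Fin T → D, infoGain K σε fun i => (X i : Pt d)

/-- The cumulative regret `R_T = ∑_{t=1}^T (f(x_t) - f(x*))` on the outcome `ω`. -/
def cumRegret {d : ℕ} {Ω : Type*} (f : Ω → Pt d → ℝ) (x : ℕ → Ω → Pt d) (xstar : Ω → Pt d)
    (T : ℕ) (ω : Ω) : ℝ :=
  ∑ t ∈ Finset.Icc 1 T, (f ω (x t ω) - f ω (xstar ω))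

/-- `C₁`. -/
def constC1 (σf σε : ℝ) : ℝ := 8 * σf ^ 2 / Real.log (1 + σf ^ 2 / σε ^ 2)

/-- `C₂ = ∑_{t=1}^T (1/t² + 2 C_μ t² ε_t + 4 C_σ β_t^{1/2} t ε_t^{1/2})`. -/
def constC2 (Cμ Cσ : ℝ) (β eps : ℕ → ℝ) (T : ℕ) : ℝ :=
  ∑ t ∈ Finset.Icc 1 T, (1 / (t : ℝ) ^ 2 + 2 * Cμ * (t : ℝ) ^ 2 * eps t
    + 4 * Cσ * √(β t) * t * √(eps t))

end PKMIQP

end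

noncomputable section

namespace PKMIQP

/-! ### Linear algebra -/

section LinearAlgebra

variable {n : Type*} [Fintype n]

/-- The Euclidean norm of a tuple. -/
def l2norm (v : n → ℝ) : ℝ := √(v ⬝ᵥ v)

lemma dotProduct_self_nonneg' (v : n → ℝ) : 0 ≤ v ⬝ᵥ v :=
  Finset.sum_nonneg fun i _ => mul_self_nonneg (v i)

lemma l2norm_nonneg (v : n → ℝ) : 0 ≤ l2norm v := Real.sqrt_nonneg _

lemma l2norm_sq (v : n → ℝ) : l2norm v ^ 2 = v ⬝ᵥ v := Real.sq_sqrt (dotProduct_self_nonneg' v)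

lemma abs_dotProduct_le (v w : n → ℝ) : |v ⬝ᵥ w| ≤ l2norm v * l2norm w := by
  have h := Finset.sum_mul_sq_le_sq_mul_sq Finset.univ v w
  rw [l2norm, l2norm, ← Real.sqrt_mul (dotProduct_self_nonneg' v), ← Real.sqrt_sq_eq_abs]
  apply Real.sqrt_le_sqrt
  simpa [dotProduct, sq] using h

lemma l2norm_add_le (v w : n → ℝ) : l2norm (v + w) ≤ l2norm v + l2norm w := by
  apply le_of_sq_le_sq _ (add_nonneg (l2norm_nonneg v) (l2norm_nonneg w))
  have h := (abs_le.1 (abs_dotProduct_le v w)).2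
  have h1 : (v + w) ⬝ᵥ (v + w) = v ⬝ᵥ v + 2 * (v ⬝ᵥ w) + w ⬝ᵥ w := by
    rw [add_dotProduct, dotProduct_add, dotProduct_add, dotProduct_comm w v]; ring
  rw [l2norm_sq, h1, ← l2norm_sq, ← l2norm_sq]
  nlinarith
  
lemma l2norm_neg (v : n → ℝ) : l2norm (-v) = l2norm v := by simp [l2norm]

lemma l2norm_sub_le (v w : n → ℝ) : l2norm (v - w) ≤ l2norm v + l2norm w := by
  rw [sub_eq_add_neg, ← l2norm_neg w]; exact l2norm_add_le _ _

lemma l2norm_le_of_abs_le {v : n → ℝ} {ε : ℝ} (hε : 0 ≤ ε) (h : ∀ i, |v i| ≤ ε) :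
    l2norm v ≤ √(Fintype.card n) * ε := by
  rw [l2norm, ← Real.sqrt_sq hε, ← Real.sqrt_mul (Nat.cast_nonneg _)]
  apply Real.sqrt_le_sqrt
  calc v ⬝ᵥ v ≤ ∑ _i : n, ε ^ 2 := by
        refine Finset.sum_le_sum fun i _ => ?_
        nlinarith [abs_le.1 (h i), abs_nonneg (v i), sq_abs (v i), h i]
    _ = _ := by simp

lemma l2norm_mulVec_le {E : Matrix n n ℝ} {ε : ℝ} (hε : 0 ≤ ε) (h : ∀ i j, |E i j| ≤ ε)
    (v : n → ℝ) : l2norm (E.mulVec v) ≤ Fintype.card n * ε * l2norm v := by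
  have h1 : ∀ i, |E.mulVec v i| ≤ √(Fintype.card n) * ε * l2norm v := fun i =>
    (abs_dotProduct_le _ _).trans <|
      mul_le_mul_of_nonneg_right (l2norm_le_of_abs_le hε (h i)) (l2norm_nonneg v)
  refine (l2norm_le_of_abs_le (by have := l2norm_nonneg v; positivity) h1).trans (le_of_eq ?_)
  have := Real.mul_self_sqrt (Nat.cast_nonneg (α := ℝ) (Fintype.card n))
  linear_combination (ε * l2norm v) * this

/-- The quadratic form of `A` is bounded below by `m`. -/
def Coercive (A : Matrix n n ℝ) (m : ℝ) : Prop := ∀ v : n → ℝ, m * (v ⬝ᵥ v) ≤ v ⬝ᵥ A.mulVec v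

section
variable [DecidableEq n]

lemma Coercive.isUnit_det {A : Matrix n n ℝ} {m : ℝ} (hm : 0 < m) (hA : Coercive A m) :
    IsUnit A.det := by
  rw [isUnit_iff_ne_zero]
  intro h0
  obtain ⟨v, hv, hAv⟩ := Matrix.exists_mulVec_eq_zero_iff.2 h0
  have h := hA v
  rw [hAv, dotProduct_zero] at h
  have h2 := dotProduct_self_nonneg' v
  have h3 : v ⬝ᵥ v = 0 := by nlinarith
  exact hv (dotProduct_self_eq_zero.1 h3)

lemma Coercive.mulVec_inv {A : Matrix n n ℝ} {m : ℝ} (hm : 0 < m) (hA : Coercive A m)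
    (w : n → ℝ) : A.mulVec (A⁻¹.mulVec w) = w := by
  rw [Matrix.mulVec_mulVec, Matrix.mul_nonsing_inv _ (hA.isUnit_det hm), Matrix.one_mulVec]

end

lemma Coercive.l2norm_le {A : Matrix n n ℝ} {m : ℝ} (hA : Coercive A m)
    (v : n → ℝ) : m * l2norm v ≤ l2norm (A.mulVec v) := by
  rcases (l2norm_nonneg v).eq_or_lt with h0 | h0
  · rw [← h0, mul_zero]; exact l2norm_nonneg _
  · have h := (hA v).trans ((abs_le.1 (abs_dotProduct_le v (A.mulVec v))).2)
    rw [← l2norm_sq] at h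
    have : (m * l2norm v) * l2norm v ≤ l2norm (A.mulVec v) * l2norm v := by nlinarith
    exact le_of_mul_le_mul_right this h0

lemma dotProduct_mulVec_symm {A : Matrix n n ℝ} (hA : A.IsSymm) (v w : n → ℝ) :
    v ⬝ᵥ A.mulVec w = w ⬝ᵥ A.mulVec v := by
  rw [Matrix.dotProduct_mulVec, dotProduct_comm, ← Matrix.mulVec_transpose, hA.eq]

variable [DecidableEq n]

lemma isSymm_inv {A : Matrix n n ℝ} (hA : A.IsSymm) : A⁻¹.IsSymm := by
  rw [Matrix.IsSymm, Matrix.transpose_nonsing_inv, hA.eq]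

/-- Perturbing the matrix and the right-hand side of a coercive linear system by at most `ε` in
each entry. -/
lemma perturbation {A A' : Matrix n n ℝ} {k k' : n → ℝ} {m ε s : ℝ} (hm : 0 < m) (hε : 0 ≤ ε)
    (hAs : A.IsSymm) (hA : Coercive A m) (hAA : ∀ i j, |A' i j - A i j| ≤ ε)
    (hkk : ∀ i, |k' i - k i| ≤ ε)
    (hsmall : Fintype.card n * ε ≤ m / 2) (hu : l2norm (A⁻¹.mulVec k) ≤ s) (hs : 0 ≤ s) :
    IsUnit A'.det ∧
    l2norm (A'⁻¹.mulVec k' - A⁻¹.mulVec k) ≤ 2 / m * (1 + s) * (Fintype.card n * ε) ∧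
    |k' ⬝ᵥ A'⁻¹.mulVec k' - k ⬝ᵥ A⁻¹.mulVec k|
      ≤ ((1 + 2 * s) + s + s * (1 + 2 * s)) * (Fintype.card n * ε) := by
  set N : ℝ := (Fintype.card n : ℝ) with hN
  have hN0 : 0 ≤ N := Nat.cast_nonneg _
  have hsqrtN : √N ≤ N := by
    rcases Nat.eq_zero_or_pos (Fintype.card n) with h | h
    · simp [hN, h]
    · have : (1:ℝ) ≤ N := by rw [hN]; exact_mod_cast h
      rw [Real.sqrt_le_left hN0]; nlinarith
  have hE : ∀ v, l2norm ((A' - A).mulVec v) ≤ N * ε * l2norm v :=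
    l2norm_mulVec_le hε (by simpa using hAA)
  have hA' : Coercive A' (m / 2) := by
    intro v
    have h1 : v ⬝ᵥ A'.mulVec v = v ⬝ᵥ A.mulVec v + v ⬝ᵥ (A' - A).mulVec v := by
      rw [Matrix.sub_mulVec, dotProduct_sub]; ring
    have h2 := (abs_le.1 ((abs_dotProduct_le v ((A' - A).mulVec v)).trans
      (mul_le_mul_of_nonneg_left (hE v) (l2norm_nonneg v)))).1
    have h3 := hA v
    have h4 : l2norm v * (N * ε * l2norm v) = N * ε * (v ⬝ᵥ v) := by rw [← l2norm_sq]; ring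
    have h5 := mul_le_mul_of_nonneg_right hsmall (dotProduct_self_nonneg' v)
    rw [h4] at h2
    rw [h1]
    linarith
  have hm2 : 0 < m / 2 := by linarith
  set u := A⁻¹.mulVec k with hu_def
  set u' := A'⁻¹.mulVec k' with hu'_def
  set e := k' - k with he
  have hAu : A.mulVec u = k := hA.mulVec_inv hm k
  have hAu' : A'.mulVec u' = k' := hA'.mulVec_inv hm2 k'
  have hen : l2norm e ≤ N * ε :=
    (l2norm_le_of_abs_le hε (by simpa [he] using hkk)).trans
      (mul_le_mul_of_nonneg_right hsqrtN hε)
  have hNε : 0 ≤ N * ε := mul_nonneg hN0 hε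
  have hdiff : A'.mulVec (u' - u) = e - (A' - A).mulVec u := by
    rw [Matrix.mulVec_sub, hAu', Matrix.sub_mulVec, hAu, he]; abel
  have hd1 : l2norm (u' - u) ≤ 2 / m * (1 + s) * (N * ε) := by
    have h1 := hA'.l2norm_le (u' - u)
    rw [hdiff] at h1
    have h2 : l2norm (e - (A' - A).mulVec u) ≤ N * ε + N * ε * s :=
      (l2norm_sub_le _ _).trans (add_le_add hen ((hE u).trans
        (mul_le_mul_of_nonneg_left hu hNε)))
    have h3 : l2norm (u' - u) = 2 / m * (m / 2 * l2norm (u' - u)) := by field_simp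
    rw [h3]
    calc 2 / m * (m / 2 * l2norm (u' - u)) ≤ 2 / m * (N * ε + N * ε * s) :=
          mul_le_mul_of_nonneg_left (h1.trans h2) (by positivity)
      _ = _ := by ring
  have hu'n : l2norm u' ≤ 1 + 2 * s := by
    have h1 : l2norm u' ≤ l2norm (u' - u) + l2norm u := by
      simpa using l2norm_add_le (u' - u) u
    have h2 : 2 / m * (1 + s) * (N * ε) ≤ 2 / m * (1 + s) * (m / 2) :=
      mul_le_mul_of_nonneg_left hsmall (by positivity)
    have h3 : 2 / m * (1 + s) * (m / 2) = 1 + s := by field_simp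
    linarith
  refine ⟨hA'.isUnit_det hm2, hd1, ?_⟩
  have key : k' ⬝ᵥ u' - k ⬝ᵥ u = e ⬝ᵥ u' + u ⬝ᵥ e - u ⬝ᵥ (A' - A).mulVec u' := by
    have h1 : k ⬝ᵥ u' = u ⬝ᵥ k' - u ⬝ᵥ (A' - A).mulVec u' := by
      rw [Matrix.sub_mulVec, hAu', dotProduct_sub, dotProduct_mulVec_symm hAs u u', hAu,
        dotProduct_comm u' k]
      ring
    rw [he, sub_dotProduct, dotProduct_sub, h1, dotProduct_comm k u]
    ring
  rw [key]
  have t1 : |e ⬝ᵥ u'| ≤ N * ε * (1 + 2 * s) :=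
    (abs_dotProduct_le _ _).trans (mul_le_mul hen hu'n (l2norm_nonneg _) hNε)
  have t2 : |u ⬝ᵥ e| ≤ s * (N * ε) :=
    (abs_dotProduct_le _ _).trans (mul_le_mul hu hen (l2norm_nonneg _) hs)
  have t3 : |u ⬝ᵥ (A' - A).mulVec u'| ≤ s * (N * ε * (1 + 2 * s)) :=
    (abs_dotProduct_le _ _).trans (mul_le_mul hu ((hE u').trans
      (mul_le_mul_of_nonneg_left hu'n hNε)) (l2norm_nonneg _) hs)
  rw [abs_le] at *
  constructor <;> nlinarith

end LinearAlgebra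

/-! ### The posterior of a Gaussian process -/

section Posterior

variable {d N : ℕ}

/-- The kernel values between `z` and the points `X`. -/
def kvec (K : Pt d → Pt d → ℝ) (X : Fin N → Pt d) (z : Pt d) : Fin N → ℝ := fun i => K z (X i)

/-- The covariance matrix of noisy observations at the points `X`. -/
def noisyGram (K : Pt d → Pt d → ℝ) (σε : ℝ) (X : Fin N → Pt d) : Matrix (Fin N) (Fin N) ℝ :=
  gram K X + σε ^ 2 • (1 : Matrix (Fin N) (Fin N) ℝ)

/-- The weights of the observations in the posterior mean at `z`. -/
def gainVec (K : Pt d → Pt d → ℝ) (σε : ℝ) (X : Fin N → Pt d) (z : Pt d) : Fin N → ℝ :=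
  (noisyGram K σε X)⁻¹.mulVec (kvec K X z)

/-- The posterior mean at `z` given the data `(X, y)`. -/
def postMean (K : Pt d → Pt d → ℝ) (σε : ℝ) (X : Fin N → Pt d) (y : Fin N → ℝ) (z : Pt d) : ℝ :=
  kvec K X z ⬝ᵥ (noisyGram K σε X)⁻¹.mulVec y

/-- The posterior variance at `z` given observations at the points `X`. -/
def postVar (K : Pt d → Pt d → ℝ) (σε : ℝ) (X : Fin N → Pt d) (z : Pt d) : ℝ :=
  K z z - kvec K X z ⬝ᵥ gainVec K σε X z

/-- `K` is symmetric and positive semidefinite on `D`. -/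
structure IsPosKernel (D : Set (Pt d)) (K : Pt d → Pt d → ℝ) : Prop where
  symm : ∀ x ∈ D, ∀ x' ∈ D, K x x' = K x' x
  nonneg : ∀ (N : ℕ) (X : Fin N → Pt d), (∀ i, X i ∈ D) →
    ∀ v : Fin N → ℝ, 0 ≤ v ⬝ᵥ (gram K X).mulVec v

variable {D : Set (Pt d)} {K : Pt d → Pt d → ℝ} {σε σf : ℝ} {X : Fin N → Pt d} {z : Pt d}

lemma IsPosKernel.gram_isSymm (hK : IsPosKernel D K) (hX : ∀ i, X i ∈ D) :
    (gram K X).IsSymm := by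
  ext i j; exact hK.symm _ (hX _) _ (hX _)

lemma IsPosKernel.noisyGram_isSymm (hK : IsPosKernel D K) (hX : ∀ i, X i ∈ D) :
    (noisyGram K σε X).IsSymm := by
  refine (hK.gram_isSymm hX).add ?_
  simp [Matrix.IsSymm]

lemma IsPosKernel.coercive (hK : IsPosKernel D K) (hX : ∀ i, X i ∈ D) :
    Coercive (noisyGram K σε X) (σε ^ 2) := by
  intro v
  rw [noisyGram, Matrix.add_mulVec, dotProduct_add, Matrix.smul_mulVec, Matrix.one_mulVec,
    dotProduct_smul, smul_eq_mul]
  linarith [hK.nonneg N X hX v]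

lemma IsPosKernel.noisyGram_mulVec_gainVec (hK : IsPosKernel D K) (hσε : 0 < σε)
    (hX : ∀ i, X i ∈ D) : (noisyGram K σε X).mulVec (gainVec K σε X z) = kvec K X z :=
  (hK.coercive hX).mulVec_inv (by positivity) _

lemma IsPosKernel.postMean_eq (hK : IsPosKernel D K) (hX : ∀ i, X i ∈ D) (y : Fin N → ℝ) :
    postMean K σε X y z = gainVec K σε X z ⬝ᵥ y := by
  rw [postMean, dotProduct_mulVec_symm (isSymm_inv (hK.noisyGram_isSymm hX)), dotProduct_comm,
    gainVec]

/-- The quadratic form of the joint covariance at `z` and `X`. -/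
lemma IsPosKernel.quad_cons (hK : IsPosKernel D K) (hX : ∀ i, X i ∈ D) (hz : z ∈ D)
    (c : ℝ) (v : Fin N → ℝ) :
    (Fin.cons c v : Fin (N + 1) → ℝ) ⬝ᵥ
      (gram K (Fin.cons z X : Fin (N + 1) → Pt d)).mulVec (Fin.cons c v) =
      c ^ 2 * K z z + 2 * c * (kvec K X z ⬝ᵥ v) + v ⬝ᵥ (gram K X).mulVec v := by
  have hs : ∀ j, K (X j) z = K z (X j) := fun j => hK.symm _ (hX j) _ hz
  simp only [dotProduct, Matrix.mulVec, gram, Matrix.of_apply, Fin.sum_univ_succ, Fin.cons_zero,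
    Fin.cons_succ, hs, kvec, mul_add, Finset.sum_add_distrib]
  have h1 : ∑ x, v x * (K z (X x) * c) = c * ∑ x, K z (X x) * v x := by
    rw [Finset.mul_sum]; exact Finset.sum_congr rfl fun _ _ => by ring
  rw [h1]; ring

lemma IsPosKernel.quad_nonneg (hK : IsPosKernel D K) (hX : ∀ i, X i ∈ D) (hz : z ∈ D)
    (c : ℝ) (v : Fin N → ℝ) :
    0 ≤ c ^ 2 * K z z + 2 * c * (kvec K X z ⬝ᵥ v) + v ⬝ᵥ (gram K X).mulVec v := by
  rw [← hK.quad_cons hX hz]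
  exact hK.nonneg (N + 1) _ (by
    intro i; refine Fin.cases ?_ (fun j => ?_) i <;> simp [hz, hX]) _

lemma IsPosKernel.gram_gainVec (hK : IsPosKernel D K) (hσε : 0 < σε) (hX : ∀ i, X i ∈ D) :
    (gram K X).mulVec (gainVec K σε X z) = kvec K X z - σε ^ 2 • gainVec K σε X z := by
  rw [← hK.noisyGram_mulVec_gainVec hσε hX (z := z), noisyGram, Matrix.add_mulVec,
    Matrix.smul_mulVec, Matrix.one_mulVec]
  simp

lemma IsPosKernel.gainVec_sq_le (hK : IsPosKernel D K) (hσε : 0 < σε) (hX : ∀ i, X i ∈ D)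
    (hz : z ∈ D) :
    σε ^ 2 * (gainVec K σε X z ⬝ᵥ gainVec K σε X z) ≤ postVar K σε X z := by
  have h := hK.quad_nonneg hX hz (-1) (gainVec K σε X z)
  rw [hK.gram_gainVec hσε hX, dotProduct_sub, dotProduct_smul, smul_eq_mul,
    dotProduct_comm (gainVec K σε X z) (kvec K X z)] at h
  rw [postVar]; linarith

lemma IsPosKernel.postVar_nonneg (hK : IsPosKernel D K) (hσε : 0 < σε) (hX : ∀ i, X i ∈ D)
    (hz : z ∈ D) : 0 ≤ postVar K σε X z :=
  le_trans (mul_nonneg (sq_nonneg _) (dotProduct_self_nonneg' _)) (hK.gainVec_sq_le hσε hX hz)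

lemma IsPosKernel.postVar_le (hK : IsPosKernel D K) (hσε : 0 < σε) (hX : ∀ i, X i ∈ D) :
    postVar K σε X z ≤ K z z := by
  have h := hK.coercive (σε := σε) hX (gainVec K σε X z)
  rw [hK.noisyGram_mulVec_gainVec hσε hX, dotProduct_comm _ (kvec K X z)] at h
  have h2 := dotProduct_self_nonneg' (gainVec K σε X z)
  rw [postVar]; nlinarith [sq_nonneg σε]

lemma IsPosKernel.abs_le (hK : IsPosKernel D K) (hdiag : ∀ x ∈ D, K x x = σf ^ 2) {x x' : Pt d}
    (hx : x ∈ D) (hx' : x' ∈ D) : |K x x'| ≤ σf ^ 2 := by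
  have h1 := hK.quad_nonneg (N := 1) (X := fun _ => x') (z := x) (fun _ => hx') hx 1 (fun _ => 1)
  have h2 := hK.quad_nonneg (N := 1) (X := fun _ => x') (z := x) (fun _ => hx') hx 1 (fun _ => -1)
  simp [gram, kvec, dotProduct, Matrix.mulVec, hdiag x hx, hdiag x' hx'] at h1 h2
  rw [_root_.abs_le]; constructor <;> linarith

lemma IsPosKernel.l2norm_gainVec_le (hK : IsPosKernel D K) (hσε : 0 < σε) (hσf : 0 < σf)
    (hdiag : ∀ x ∈ D, K x x = σf ^ 2)
    (hX : ∀ i, X i ∈ D) (hz : z ∈ D) : l2norm (gainVec K σε X z) ≤ σf / σε := by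
  have h := (hK.gainVec_sq_le hσε hX hz).trans (hK.postVar_le hσε hX)
  rw [hdiag z hz, ← l2norm_sq] at h
  rw [le_div_iff₀ hσε]
  apply le_of_sq_le_sq _ hσf.le
  nlinarith

/-- The posterior variance after `N` observations is at least of order `1 / N`. -/
lemma IsPosKernel.postVar_lower (hK : IsPosKernel D K) (hσε : 0 < σε)
    (hdiag : ∀ x ∈ D, K x x = σf ^ 2) (hX : ∀ i, X i ∈ D) (hz : z ∈ D) :
    σf ^ 2 / 2 ≤ postVar K σε X z ∨ σε ^ 2 ≤ 4 * N * postVar K σε X z := by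
  set u := gainVec K σε X z with hu
  have h1 := hK.gainVec_sq_le hσε hX hz
  have h2 : l2norm (kvec K X z) ≤ √N * σf ^ 2 := by
    have := l2norm_le_of_abs_le (v := kvec K X z) (sq_nonneg σf)
      (fun i => hK.abs_le hdiag hz (hX i))
    rwa [Fintype.card_fin] at this
  have h3 := (_root_.abs_le.1 ((abs_dotProduct_le (kvec K X z) u).trans
    (mul_le_mul_of_nonneg_right h2 (l2norm_nonneg u)))).2
  have hp : postVar K σε X z = σf ^ 2 - kvec K X z ⬝ᵥ u := by rw [postVar, hdiag z hz]
  rcases le_total (√N * l2norm u) (1 / 2) with h | h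
  · left
    have := mul_le_mul_of_nonneg_right h (sq_nonneg σf)
    rw [hp]; nlinarith
  · right
    rw [← hu, ← l2norm_sq] at h1
    have h4 : (1 / 2 : ℝ) ^ 2 ≤ (√N * l2norm u) ^ 2 := pow_le_pow_left₀ (by norm_num) h 2
    rw [mul_pow, Real.sq_sqrt (Nat.cast_nonneg N)] at h4
    have h5 : (N : ℝ) * (σε ^ 2 * l2norm u ^ 2) ≤ N * postVar K σε X z :=
      mul_le_mul_of_nonneg_left h1 (Nat.cast_nonneg N)
    nlinarith [sq_nonneg σε]

lemma IsPosKernel.postVar_pos (hK : IsPosKernel D K) (hσε : 0 < σε) (hσf : 0 < σf)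
    (hdiag : ∀ x ∈ D, K x x = σf ^ 2) (hX : ∀ i, X i ∈ D) (hz : z ∈ D) :
    0 < postVar K σε X z := by
  rcases hK.postVar_lower hσε hdiag hX hz with h | h
  · have : 0 < σf ^ 2 / 2 := by positivity
    linarith
  · by_contra h0
    have : 0 < σε ^ 2 := by positivity
    have h1 := mul_nonneg (Nat.cast_nonneg (α := ℝ) N) (sub_nonneg.2 (not_lt.1 h0))
    nlinarith

/-- The determinant after adding one observation. -/
lemma IsPosKernel.det_noisyGram_snoc (hK : IsPosKernel D K) (hσε : 0 < σε) (hX : ∀ i, X i ∈ D)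
    (hz : z ∈ D) :
    (noisyGram K σε (Fin.snoc X z : Fin (N + 1) → Pt d)).det
      = (noisyGram K σε X).det * (σε ^ 2 + postVar K σε X z) := by
  have hunit := (hK.coercive (σε := σε) hX).isUnit_det (by positivity)
  have : Invertible (noisyGram K σε X) := Matrix.invertibleOfIsUnitDet _ hunit
  have e : noisyGram K σε (Fin.snoc X z : Fin (N + 1) → Pt d) =
      Matrix.reindex finSumFinEquiv finSumFinEquiv (Matrix.fromBlocks (noisyGram K σε X)
        (Matrix.of fun i (_ : Fin 1) => K z (X i)) (Matrix.of fun (_ : Fin 1) j => K z (X j))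
        (Matrix.of fun (_ _ : Fin 1) => K z z + σε ^ 2)) := by
    ext i j
    refine Fin.lastCases ?_ (fun i => ?_) i <;> refine Fin.lastCases ?_ (fun j => ?_) j
    · simp [noisyGram, gram, finSumFinEquiv_symm_last]
    · simp [noisyGram, gram, finSumFinEquiv_symm_last, finSumFinEquiv_symm_apply_castSucc,
        (Fin.castSucc_lt_last j).ne']
    · simp [noisyGram, gram, finSumFinEquiv_symm_last, finSumFinEquiv_symm_apply_castSucc,
        (Fin.castSucc_lt_last i).ne, hK.symm _ (hX i) _ hz]
    · simp [noisyGram, gram, finSumFinEquiv_symm_apply_castSucc, Matrix.one_apply]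
  rw [e, Matrix.det_reindex_self, Matrix.det_fromBlocks₁₁,
    Matrix.invOf_eq_nonsing_inv]
  congr 1
  have : ((Matrix.of fun (_ : Fin 1) j => K z (X j)) * (noisyGram K σε X)⁻¹ *
      (Matrix.of fun i (_ : Fin 1) => K z (X i)) : Matrix (Fin 1) (Fin 1) ℝ) default default
      = kvec K X z ⬝ᵥ gainVec K σε X z := by
    rw [Matrix.mul_assoc]
    rfl
  rw [Matrix.det_unique, Matrix.sub_apply, this, postVar]
  simp; ring

end Posterior

/-! ### Gaussian change of measure -/

section GaussianShift

variable {E : Type*} [NormedAddCommGroup E] [NormedSpace ℝ E] [MeasurableSpace E] [BorelSpace E]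
  [SecondCountableTopology E] [CompleteSpace E]

lemma measure_ext_of_mgf {μ ν : Measure E} [IsFiniteMeasure μ] [IsProbabilityMeasure ν]
    (hpos : ∀ (L : StrongDual ℝ E) t, 0 < mgf L ν t)
    (h : ∀ (L : StrongDual ℝ E), mgf L μ = mgf L ν) : μ = ν := by
  refine Measure.ext_of_charFunDual (funext fun L => ?_)
  have huniv : integrableExpSet L ν = Set.univ := by
    ext t
    simp only [Set.mem_univ, iff_true]
    exact mgf_pos_iff.1 (hpos L t)
  have h1 := eqOn_complexMGF_of_mgf (h L).symm (x := Complex.I) (by simp [huniv])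
  rw [charFunDual_apply, charFunDual_apply]
  simp only [complexMGF] at h1
  simpa [mul_comm] using h1.symm

/-- The Cameron–Martin formula for a vector `G` and a variable `V`, which are centered and jointly
Gaussian; `b` is their covariance, `v` is the variance of `V`, and `q` is the quadratic form of the
covariance matrix of `G`. -/
lemma lintegral_exp_mul_eq_shift {Ω n : Type*} [MeasurableSpace Ω] [Fintype n] [DecidableEq n]
    {P : Measure Ω} [IsProbabilityMeasure P] {G : Ω → n → ℝ} {V : Ω → ℝ} (hG : Measurable G)
    (hV : Measurable V) {b : n → ℝ} {v : ℝ} {q : (n → ℝ) → ℝ}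
    (h0 : ∀ w, ∫ ω, Real.exp (w ⬝ᵥ G ω) ∂P = Real.exp (q w / 2))
    (h1 : ∀ w, ∫ ω, Real.exp (V ω + w ⬝ᵥ G ω) ∂P = Real.exp ((v + 2 * (w ⬝ᵥ b) + q w) / 2))
    {H : (n → ℝ) → ENNReal} (hH : Measurable H) :
    ∫⁻ ω, ENNReal.ofReal (Real.exp (V ω)) * H (G ω) ∂P
      = ENNReal.ofReal (Real.exp (v / 2)) * ∫⁻ ω, H (G ω + b) ∂P := by
  set ρ : Ω → ENNReal := fun ω => ENNReal.ofReal (Real.exp (V ω - v / 2)) with hρ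
  have hρm : Measurable ρ := by fun_prop
  have hint : ∀ w, Integrable (fun ω => Real.exp (V ω + w ⬝ᵥ G ω)) P := fun w => by
    by_contra hc
    have := integral_undef hc
    rw [h1] at this
    exact (Real.exp_pos _).ne' this
  have hq0 : q 0 = 0 := by
    have := h0 0
    simp only [zero_dotProduct, Real.exp_zero, integral_const, probReal_univ, smul_eq_mul,
      mul_one] at this
    have := Real.exp_eq_one_iff _ |>.1 this.symm
    linarith
  have hfin : IsFiniteMeasure ((P.withDensity ρ).map G) := by
    have : IsFiniteMeasure (P.withDensity ρ) := by
      refine isFiniteMeasure_withDensity_ofReal ?_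
      have h2 := ((hint 0).const_mul (Real.exp (-(v / 2)))).2
      refine h2.congr' (Filter.Eventually.of_forall fun ω => ?_)
      simp [← Real.exp_add, sub_eq_add_neg, add_comm]
    infer_instance
  have hprob : IsProbabilityMeasure (P.map fun ω => G ω + b) :=
    Measure.isProbabilityMeasure_map (by fun_prop)
  have hL : ∀ (L : StrongDual ℝ (n → ℝ)) (t : ℝ), ∃ w : n → ℝ, ∀ g, t * L g = w ⬝ᵥ g := by
    intro L t
    refine ⟨fun i => t * L (Pi.single i 1), fun g => ?_⟩
    conv_lhs => rw [show g = ∑ i, g i • (Pi.single i (1:ℝ) : n → ℝ) from by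
      ext j; simp [Finset.sum_apply, Pi.single_apply]]
    rw [map_sum, Finset.mul_sum]
    exact Finset.sum_congr rfl fun i _ => by rw [map_smul, smul_eq_mul]; ring
  choose W hW using hL
  have hm2 : ∀ (L : StrongDual ℝ (n → ℝ)) t, mgf L (P.map fun ω => G ω + b) t
      = Real.exp (W L t ⬝ᵥ b + q (W L t) / 2) := by
    intro L t
    rw [mgf, integral_map (by fun_prop) (by fun_prop)]
    simp_rw [hW, dotProduct_add, Real.exp_add, integral_mul_const, h0]
    ring
  have key : (P.withDensity ρ).map G = P.map fun ω => G ω + b := by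
    refine measure_ext_of_mgf (fun L t => by rw [hm2]; exact Real.exp_pos _)
      (fun L => funext fun t => ?_)
    rw [hm2, mgf, integral_map (by fun_prop) (by fun_prop),
      integral_withDensity_eq_integral_toReal_smul hρm (by simp [hρ])]
    simp_rw [hW]
    set w : n → ℝ := W L t
    have : ∀ ω, (ρ ω).toReal • Real.exp (w ⬝ᵥ G ω)
        = Real.exp (-(v / 2)) * Real.exp (V ω + w ⬝ᵥ G ω) := fun ω => by
      rw [hρ, ENNReal.toReal_ofReal (Real.exp_pos _).le, smul_eq_mul, ← Real.exp_add,
        ← Real.exp_add]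
      ring_nf
    simp_rw [this, integral_const_mul, h1, ← Real.exp_add]
    ring_nf
  have h2 : ∫⁻ g, H g ∂((P.withDensity ρ).map G) = ∫⁻ ω, H (G ω + b) ∂P := by
    rw [key, lintegral_map hH (by fun_prop)]
  rw [lintegral_map hH hG, lintegral_withDensity_eq_lintegral_mul _ hρm (by fun_prop)] at h2
  rw [← h2, ← lintegral_const_mul _ (by fun_prop)]
  refine lintegral_congr fun ω => ?_
  rw [Pi.mul_apply, hρ, ← mul_assoc, ← ENNReal.ofReal_mul (Real.exp_pos _).le, ← Real.exp_add]
  ring_nf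

end GaussianShift

/-! ### The posterior for a fixed design -/

section FixedDesign

variable {d N : ℕ} {Ω : Type*} [MeasurableSpace Ω] {P : Measure Ω}
  {D : Set (Pt d)} {K : Pt d → Pt d → ℝ} {f : Ω → Pt d → ℝ} {X : Fin N → Pt d} {z : Pt d}
  {σε σf : ℝ}

lemma IsCenteredGP.hasGaussianLaw_dotProduct (hf : IsCenteredGP P D K f) (hX : ∀ i, X i ∈ D)
    (v : Fin N → ℝ) : HasGaussianLaw (fun ω => v ⬝ᵥ fun i => f ω (X i)) P := by
  have h := (hf.gaussian.comp_right fun i : Fin N => (⟨X i, hX i⟩ : D)).hasGaussianLaw Finset.univ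
  refine (h.map_fun (∑ i : Fin N, v i • ContinuousLinearMap.proj (R := ℝ)
    (φ := fun _ : (Finset.univ : Finset (Fin N)) => ℝ) ⟨i, Finset.mem_univ i⟩)).congr
    (Filter.Eventually.of_forall fun ω => ?_)
  simp [dotProduct]

lemma IsCenteredGP.memLp_two (hf : IsCenteredGP P D K f) (hz : z ∈ D) :
    MemLp (fun ω => f ω z) 2 P :=
  (hf.gaussian.hasGaussianLaw_eval ⟨z, hz⟩).memLp_two

lemma IsCenteredGP.neg (hf : IsCenteredGP P D K f) : IsCenteredGP P D K (fun ω x => -f ω x) where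
  measurable x hx := (hf.measurable x hx).neg
  gaussian := by
    have := hf.gaussian.smul (fun _ => (-1 : ℝ))
    refine this.congr fun t => Filter.Eventually.of_forall fun ω => by simp
  mean_zero x hx := by rw [integral_neg, hf.mean_zero x hx, neg_zero]
  covariance x hx x' hx' := by
    rw [← hf.covariance x hx x' hx', covariance_fun_neg_left, covariance_fun_neg_right, neg_neg]

variable [IsProbabilityMeasure P]

lemma IsCenteredGP.variance_dotProduct (hf : IsCenteredGP P D K f) (hX : ∀ i, X i ∈ D)
    (v : Fin N → ℝ) :
    Var[fun ω => v ⬝ᵥ fun i => f ω (X i); P] = v ⬝ᵥ (gram K X).mulVec v := by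
  simp only [dotProduct, Matrix.mulVec, gram, Matrix.of_apply]
  rw [variance_fun_sum fun i => (hf.memLp_two (hX i)).const_mul (v i)]
  refine Finset.sum_congr rfl fun i _ => ?_
  rw [Finset.mul_sum]
  refine Finset.sum_congr rfl fun j _ => ?_
  rw [covariance_const_mul_left, covariance_const_mul_right, hf.covariance _ (hX i) _ (hX j)]
  ring

lemma IsCenteredGP.isPosKernel (hf : IsCenteredGP P D K f) : IsPosKernel D K where
  symm x hx x' hx' := by
    rw [← hf.covariance x hx x' hx', ← hf.covariance x' hx' x hx, covariance_comm]
  nonneg N X hX v := by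
    rw [← hf.variance_dotProduct hX]; exact variance_nonneg _ _

lemma IsCenteredGP.integral_exp_dotProduct (hf : IsCenteredGP P D K f) (hX : ∀ i, X i ∈ D)
    (v : Fin N → ℝ) :
    ∫ ω, Real.exp (v ⬝ᵥ fun i => f ω (X i)) ∂P
      = Real.exp ((v ⬝ᵥ (gram K X).mulVec v) / 2) := by
  have h := (hf.hasGaussianLaw_dotProduct hX v).map_eq_gaussianReal
  have hm : ∫ ω, (v ⬝ᵥ fun i => f ω (X i)) ∂P = 0 := by
    simp only [dotProduct]
    rw [integral_finsetSum _ fun i _ =>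
      ((hf.memLp_two (hX i)).integrable one_le_two).const_mul (v i)]
    exact Finset.sum_eq_zero fun i _ => by rw [integral_const_mul, hf.mean_zero _ (hX i), mul_zero]
  have h2 := mgf_gaussianReal h 1
  rw [hm, hf.variance_dotProduct hX, Real.coe_toNNReal _ (hf.isPosKernel.nonneg N X hX v)] at h2
  simpa [mgf] using h2

/-- The likelihood of the observations `y` when the noiseless values are `g`. -/
def likelihood (σε : ℝ) (y g : Fin N → ℝ) : ENNReal :=
  ∏ i, gaussianPDF (g i) (Real.toNNReal (σε ^ 2)) (y i)

lemma measurable_likelihood (σε : ℝ) (y : Fin N → ℝ) : Measurable (likelihood σε y) := by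
  unfold likelihood
  refine Finset.measurable_prod _ fun i _ => ?_
  change Measurable ((fun p : ℝ × NNReal × ℝ => gaussianPDF p.1 p.2.1 p.2.2) ∘
    fun g : Fin N → ℝ => (g i, Real.toNNReal (σε ^ 2), y i))
  exact measurable_uncurry_gaussianPDF.comp
    ((measurable_pi_apply i).prodMk (measurable_const.prodMk measurable_const))

lemma likelihood_eq (hσε : 0 < σε) (y g : Fin N → ℝ) :
    likelihood σε y g = ENNReal.ofReal ((√(2 * Real.pi * σε ^ 2))⁻¹ ^ N
      * Real.exp (-((y - g) ⬝ᵥ (y - g)) / (2 * σε ^ 2))) := by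
  rw [likelihood]
  simp only [gaussianPDF, gaussianPDFReal_def]
  rw [← ENNReal.ofReal_prod_of_nonneg fun i _ => by positivity, Finset.prod_mul_distrib,
    ← Real.exp_sum, Finset.prod_const, Finset.card_univ, Fintype.card_fin,
    Real.coe_toNNReal _ (sq_nonneg σε), ← Finset.sum_div, Finset.sum_neg_distrib]
  simp [dotProduct, sq]

lemma likelihood_add_smul (hσε : 0 < σε) (y g u : Fin N → ℝ) (s : ℝ) :
    ENNReal.ofReal (Real.exp (u ⬝ᵥ (g + (s * σε ^ 2) • u) * s))
        * likelihood σε y (g + (s * σε ^ 2) • u)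
      = ENNReal.ofReal (Real.exp (s * (u ⬝ᵥ y) + s ^ 2 * σε ^ 2 * (u ⬝ᵥ u) / 2))
        * likelihood σε y g := by
  rw [likelihood_eq hσε, likelihood_eq hσε, ← ENNReal.ofReal_mul (Real.exp_pos _).le,
    ← ENNReal.ofReal_mul (Real.exp_pos _).le, mul_left_comm, mul_left_comm (Real.exp _),
    ← Real.exp_add, ← Real.exp_add]
  congr 3
  have h1 : y - (g + (s * σε ^ 2) • u) = (y - g) - (s * σε ^ 2) • u := by abel
  have h2 : u ⬝ᵥ (y - g) = u ⬝ᵥ y - u ⬝ᵥ g := dotProduct_sub _ _ _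
  rw [h1, sub_dotProduct, dotProduct_sub (y - g), dotProduct_sub _ (y - g), smul_dotProduct,
    smul_dotProduct, dotProduct_smul, dotProduct_smul, dotProduct_add, dotProduct_smul,
    dotProduct_comm (y - g) u, h2]
  simp only [smul_eq_mul]
  field_simp
  ring

/-- Under the posterior given the data `(X, y)`, the moment generating function of `f z` is that of
`N(postMean, postVar)`. -/
lemma IsCenteredGP.lintegral_likelihood_mul_exp (hf : IsCenteredGP P D K f) (hσε : 0 < σε)
    (hX : ∀ i, X i ∈ D) (hz : z ∈ D) (y : Fin N → ℝ) (s : ℝ) :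
    ∫⁻ ω, likelihood σε y (fun i => f ω (X i)) * ENNReal.ofReal (Real.exp (s * f ω z)) ∂P
      = ENNReal.ofReal (Real.exp (s * postMean K σε X y z + s ^ 2 * postVar K σε X z / 2))
        * ∫⁻ ω, likelihood σε y (fun i => f ω (X i)) ∂P := by
  have hK := hf.isPosKernel
  set u := gainVec K σε X z with hu
  have hGm : Measurable fun ω i => f ω (X i) := measurable_pi_lambda _ fun i =>
    hf.measurable _ (hX i)
  have hzm := hf.measurable z hz
  have hum : Measurable fun g : Fin N → ℝ => u ⬝ᵥ g := by unfold dotProduct; fun_prop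
  have hshift := lintegral_exp_mul_eq_shift (P := P) (G := fun ω i => f ω (X i))
    (V := fun ω => s * (f ω z - u ⬝ᵥ fun i => f ω (X i))) hGm
    (by have := hum.comp hGm; exact (hzm.sub this).const_mul s)
    (b := (s * σε ^ 2) • u) (v := s ^ 2 * (postVar K σε X z - σε ^ 2 * (u ⬝ᵥ u)))
    (q := fun w => w ⬝ᵥ (gram K X).mulVec w)
    (fun w => hf.integral_exp_dotProduct hX w) ?_
    (H := fun g => ENNReal.ofReal (Real.exp (u ⬝ᵥ g * s)) * likelihood σε y g)
    (by have := measurable_likelihood σε y; fun_prop)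
  · simp only [likelihood_add_smul hσε] at hshift
    rw [lintegral_const_mul (f := fun ω => likelihood σε y fun i => f ω (X i)) _
      ((measurable_likelihood σε y).comp hGm), ← mul_assoc,
      ← ENNReal.ofReal_mul (Real.exp_pos _).le, ← Real.exp_add] at hshift
    rw [hK.postMean_eq hX]
    convert hshift using 2
    · funext ω
      rw [← mul_assoc, ← ENNReal.ofReal_mul (Real.exp_pos _).le, ← Real.exp_add, mul_comm]
      ring_nf
    · congr 2; ring
  · intro w
    have h := hf.integral_exp_dotProduct (X := (Fin.cons z X : Fin (N + 1) → Pt d))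
      (by intro i; refine Fin.cases ?_ (fun j => ?_) i <;> simp [hz, hX])
      (Fin.cons s (w - s • u))
    rw [hK.quad_cons hX hz] at h
    have hKu := hK.gram_gainVec hσε hX (z := z)
    rw [← hu] at hKu
    have e1 : (w - s • u) ⬝ᵥ (gram K X).mulVec (w - s • u) = w ⬝ᵥ (gram K X).mulVec w
        - 2 * s * (w ⬝ᵥ (gram K X).mulVec u) + s ^ 2 * (u ⬝ᵥ (gram K X).mulVec u) := by
      have := dotProduct_mulVec_symm (hK.gram_isSymm hX) u w
      simp only [Matrix.mulVec_sub, Matrix.mulVec_smul, sub_dotProduct, dotProduct_sub,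
        smul_dotProduct, dotProduct_smul, smul_eq_mul, this]
      ring
    rw [e1, hKu] at h
    convert h using 1
    · refine integral_congr_ae (Filter.Eventually.of_forall fun ω => ?_)
      simp only [dotProduct, Fin.sum_univ_succ, Fin.cons_zero, Fin.cons_succ, Pi.sub_apply,
        Pi.smul_apply, smul_eq_mul, sub_mul, Finset.sum_sub_distrib, mul_sub, Finset.mul_sum]
      congr 1
      simp only [mul_assoc]
      ring
    · congr 1
      simp only [dotProduct_sub, dotProduct_smul, smul_eq_mul, postVar, ← hu,
        dotProduct_comm u (kvec K X z), dotProduct_comm w (kvec K X z)]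
      ring

lemma IsCenteredGP.posterior_tail_upper (hf : IsCenteredGP P D K f) (hσε : 0 < σε)
    (hσf : 0 < σf) (hdiag : ∀ x ∈ D, K x x = σf ^ 2) (hX : ∀ i, X i ∈ D) (hz : z ∈ D)
    (y : Fin N → ℝ) {s : ℝ} (hs : 0 ≤ s) :
    ∫⁻ ω, likelihood σε y (fun i => f ω (X i)) *
        {ω | postMean K σε X y z + s * √(postVar K σε X z) < f ω z}.indicator 1 ω ∂P
      ≤ ENNReal.ofReal (Real.exp (-s ^ 2 / 2))
        * ∫⁻ ω, likelihood σε y (fun i => f ω (X i)) ∂P := by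
  have hpv := hf.isPosKernel.postVar_pos hσε hσf hdiag hX hz
  set m := postMean K σε X y z
  set V := postVar K σε X z
  set c := s / √V with hc
  have hsV : 0 < √V := Real.sqrt_pos.2 hpv
  have hVV : √V * √V = V := Real.mul_self_sqrt hpv.le
  have hc0 : 0 ≤ c := by positivity
  have hGm : Measurable fun ω i => f ω (X i) := measurable_pi_lambda _ fun i =>
    hf.measurable _ (hX i)
  have hlm := (measurable_likelihood σε y).comp hGm
  have hzm := hf.measurable z hz
  calc _ ≤ ∫⁻ ω, ENNReal.ofReal (Real.exp (-(c * (m + s * √V)))) *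
        (likelihood σε y (fun i => f ω (X i)) * ENNReal.ofReal (Real.exp (c * f ω z))) ∂P := by
        refine lintegral_mono fun ω => ?_
        rw [mul_left_comm, ← ENNReal.ofReal_mul (Real.exp_pos _).le, ← Real.exp_add]
        refine mul_le_mul_right ?_ _
        by_cases hω : m + s * √V < f ω z
        swap
        · rw [Set.indicator_of_notMem (by simpa using hω)]; exact bot_le
        rw [Set.indicator_of_mem (by simpa using hω), Pi.one_apply, ← ENNReal.ofReal_one]
        refine ENNReal.ofReal_le_ofReal (Real.one_le_exp ?_)
        have := mul_le_mul_of_nonneg_left (hω.le) hc0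
        linarith
    _ = _ := by
        rw [lintegral_const_mul, hf.lintegral_likelihood_mul_exp hσε hX hz, ← mul_assoc,
          ← ENNReal.ofReal_mul (Real.exp_pos _).le, ← Real.exp_add]
        · congr 3
          change -(c * (m + s * √V)) + (c * m + c ^ 2 * V / 2) = _
          have h1 : c * √V = s := by rw [hc]; field_simp
          have h2 : c ^ 2 * V = s ^ 2 := by rw [← hVV, ← h1]; ring
          rw [h2, mul_add, mul_left_comm, h1]; ring
        · exact hlm.mul (by fun_prop)

lemma likelihood_neg (hσε : 0 < σε) (y g : Fin N → ℝ) :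
    likelihood σε (-y) (-g) = likelihood σε y g := by
  rw [likelihood_eq hσε, likelihood_eq hσε, neg_sub_neg, ← neg_sub, neg_dotProduct_neg]

lemma IsCenteredGP.posterior_tail_lower (hf : IsCenteredGP P D K f) (hσε : 0 < σε)
    (hσf : 0 < σf) (hdiag : ∀ x ∈ D, K x x = σf ^ 2) (hX : ∀ i, X i ∈ D) (hz : z ∈ D)
    (y : Fin N → ℝ) {s : ℝ} (hs : 0 ≤ s) :
    ∫⁻ ω, likelihood σε y (fun i => f ω (X i)) *
        {ω | f ω z < postMean K σε X y z - s * √(postVar K σε X z)}.indicator 1 ω ∂P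
      ≤ ENNReal.ofReal (Real.exp (-s ^ 2 / 2))
        * ∫⁻ ω, likelihood σε y (fun i => f ω (X i)) ∂P := by
  have h := hf.neg.posterior_tail_upper hσε hσf hdiag hX hz (-y) hs
  have h1 : ∀ ω, likelihood σε (-y) (fun i => -f ω (X i))
      = likelihood σε y (fun i => f ω (X i)) := fun ω => likelihood_neg hσε _ _
  have h2 : postMean K σε X (-y) z = -postMean K σε X y z := by
    simp [postMean, Matrix.mulVec_neg]
  have h3 : {ω | f ω z < postMean K σε X y z - s * √(postVar K σε X z)}
      = {ω | -postMean K σε X y z + s * √(postVar K σε X z) < -f ω z} := by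
    ext ω; simp only [Set.mem_ofPred_eq]; constructor <;> intro h <;> linarith
  simp only [h1, h2] at h
  rwa [h3]

lemma IsCenteredGP.posterior_tail (hf : IsCenteredGP P D K f) (hσε : 0 < σε)
    (hσf : 0 < σf) (hdiag : ∀ x ∈ D, K x x = σf ^ 2) (hX : ∀ i, X i ∈ D) (hz : z ∈ D)
    (y : Fin N → ℝ) {s τ : ℝ} (hs : 0 ≤ s) (hτ : τ = 1 ∨ τ = -1) :
    ∫⁻ ω, likelihood σε y (fun i => f ω (X i)) *
        {ω | s * √(postVar K σε X z) < τ * (f ω z - postMean K σε X y z)}.indicator 1 ω ∂P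
      ≤ ENNReal.ofReal (Real.exp (-s ^ 2 / 2))
        * ∫⁻ ω, likelihood σε y (fun i => f ω (X i)) ∂P := by
  rcases hτ with rfl | rfl
  · have e : {ω | s * √(postVar K σε X z) < 1 * (f ω z - postMean K σε X y z)}
        = {ω | postMean K σε X y z + s * √(postVar K σε X z) < f ω z} := by
      ext ω; simp only [Set.mem_ofPred_eq]; constructor <;> intro h <;> linarith
    rw [e]
    exact hf.posterior_tail_upper hσε hσf hdiag hX hz y hs
  · have e : {ω | s * √(postVar K σε X z) < -1 * (f ω z - postMean K σε X y z)}
        = {ω | f ω z < postMean K σε X y z - s * √(postVar K σε X z)} := by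
      ext ω; simp only [Set.mem_ofPred_eq]; constructor <;> intro h <;> linarith
    rw [e]
    exact hf.posterior_tail_lower hσε hσf hdiag hX hz y hs

end FixedDesign

/-! ### Adaptively collected data -/

section Adaptive

variable {d : ℕ} {S Ω : Type*} [MeasurableSpace Ω]

lemma measurable_snoc {α β : Type*} [MeasurableSpace α] [MeasurableSpace β] {n : ℕ}
    {f : β → Fin n → α} {g : β → α} (hf : Measurable f) (hg : Measurable g) :
    Measurable fun b => (Fin.snoc (f b) (g b) : Fin (n + 1) → α) := by
  refine measurable_pi_lambda _ fun i => ?_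
  refine Fin.lastCases ?_ (fun j => ?_) i
  · simpa using hg
  · simpa [Function.comp_def] using (measurable_pi_apply j).comp hf

lemma IndepFun.prodMk_left {α β γ : Type*} [MeasurableSpace α] [MeasurableSpace β]
    [MeasurableSpace γ] {P : Measure Ω} [IsProbabilityMeasure P] {X : Ω → α} {Y : Ω → β}
    {Z : Ω → γ} (hX : Measurable X) (hY : Measurable Y) (hZ : Measurable Z)
    (h : IndepFun X (fun ω => (Y ω, Z ω)) P) (hYZ : IndepFun Y Z P) :
    IndepFun (fun ω => (X ω, Y ω)) Z P := by
  have hXY : IndepFun X Y P := h.comp measurable_id measurable_fst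
  rw [indepFun_iff_map_prod_eq_prod_map_map (by fun_prop) (by fun_prop)] at *
  have := Measure.isProbabilityMeasure_map (μ := P) hX.aemeasurable
  have := Measure.isProbabilityMeasure_map (μ := P) hY.aemeasurable
  have := Measure.isProbabilityMeasure_map (μ := P) hZ.aemeasurable
  rw [hYZ, ← Measure.prodAssoc_prod, ← hXY] at h
  have h2 := congrArg (Measure.map MeasurableEquiv.prodAssoc.symm) h
  rw [Measure.map_map (by fun_prop) (by fun_prop), Measure.map_map (by fun_prop) (by fun_prop)] at h2
  have e : ((MeasurableEquiv.prodAssoc (α := α) (β := β) (γ := γ)).symm ∘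
      MeasurableEquiv.prodAssoc) = id := by ext x <;> rfl
  rw [e, Measure.map_id] at h2
  exact h2

/-- The data collected in `n` rounds when the signal is `s`, the noise is `u`, and the `i`-th query
is chosen by the rule `A i`. -/
def genHist (ev : S → Pt d → ℝ) (A : ∀ n, (Fin n → Pt d × ℝ) → Pt d) (s : S) (u : ℕ → ℝ) :
    ∀ n, Fin n → Pt d × ℝ
  | 0 => Fin.elim0
  | n + 1 => Fin.snoc (genHist ev A s u n)
      (A n (genHist ev A s u n), ev s (A n (genHist ev A s u n)) + u n)

variable {ev : S → Pt d → ℝ} {A : ∀ n, (Fin n → Pt d × ℝ) → Pt d}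

lemma genHist_congr {s : S} {u u' : ℕ → ℝ} (n : ℕ) (h : ∀ i < n, u i = u' i) :
    genHist ev A s u n = genHist ev A s u' n := by
  induction n with
  | zero => rfl
  | succ n ih =>
    simp only [genHist]
    rw [ih fun i hi => h i (hi.trans n.lt_succ_self), h n n.lt_succ_self]

/-- The likelihood of the data `h` when the signal is `s`. -/
def dataLikelihood (ev : S → Pt d → ℝ) (σε : ℝ) {n : ℕ} (s : S) (h : Fin n → Pt d × ℝ) : ENNReal :=
  likelihood σε (fun i => (h i).2) (fun i => ev s (h i).1)

lemma dataLikelihood_snoc (σε : ℝ) {n : ℕ} (s : S) (h : Fin n → Pt d × ℝ) (p : Pt d × ℝ) :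
    dataLikelihood ev σε s (Fin.snoc h p : Fin (n + 1) → Pt d × ℝ)
      = dataLikelihood ev σε s h * gaussianPDF (ev s p.1) (Real.toNNReal (σε ^ 2)) p.2 := by
  simp [dataLikelihood, likelihood, Fin.prod_univ_castSucc]

variable [MeasurableSpace S]

lemma measurable_genHist (hev : Measurable (Function.uncurry ev)) (hA : ∀ n, Measurable (A n))
    (n : ℕ) : Measurable fun p : S × (ℕ → ℝ) => genHist ev A p.1 p.2 n := by
  induction n with
  | zero => exact measurable_const
  | succ n ih =>
    simp only [genHist]
    have h1 := (hA n).comp ih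
    have h2 : Measurable fun p : S × (ℕ → ℝ) => ev p.1 (A n (genHist ev A p.1 p.2 n)) :=
      hev.comp (measurable_fst.prodMk h1)
    have h3 : Measurable fun p : S × (ℕ → ℝ) => p.2 n :=
      (measurable_pi_apply n).comp measurable_snd
    exact measurable_snoc ih (h1.prodMk (h2.add h3))

lemma measurable_dataLikelihood (hev : Measurable (Function.uncurry ev)) (σε : ℝ) (n : ℕ) :
    Measurable fun p : S × (Fin n → Pt d × ℝ) => dataLikelihood ev σε p.1 p.2 := by
  unfold dataLikelihood likelihood
  refine Finset.measurable_prod _ fun i _ => ?_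
  have h1 : Measurable fun p : S × (Fin n → Pt d × ℝ) => ev p.1 (p.2 i).1 :=
    hev.comp (measurable_fst.prodMk (by fun_prop))
  exact measurable_uncurry_gaussianPDF.comp (h1.prodMk (measurable_const.prodMk (by fun_prop)))

variable {P : Measure Ω} [IsProbabilityMeasure P] {φ : Ω → S} {ζ : ℕ → Ω → ℝ} {σε : ℝ}
  {D : Set (Pt d)}

lemma indepFun_genHist (hev : Measurable (Function.uncurry ev)) (hA : ∀ n, Measurable (A n))
    (hφ : Measurable φ) (hζ : ∀ n, Measurable (ζ n)) (hind : iIndepFun ζ P)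
    (hφζ : IndepFun φ (fun ω n => ζ n ω) P) (n : ℕ) :
    IndepFun (fun ω => (φ ω, genHist ev A (φ ω) (fun i => ζ i ω) n)) (ζ n) P := by
  have h1 : IndepFun (fun ω (i : Finset.range n) => ζ i ω) (ζ n) P := by
    have h := hind.indepFun_finset (Finset.range n) {n} (by simp) hζ
    exact h.comp (ψ := fun u : ({n} : Finset ℕ) → ℝ => u ⟨n, by simp⟩) measurable_id (by fun_prop)
  have h2 : IndepFun φ (fun ω => ((fun (i : Finset.range n) => ζ i ω), ζ n ω)) P :=
    hφζ.comp (ψ := fun u : ℕ → ℝ => ((fun (i : Finset.range n) => u i), u n)) measurable_id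
      (by fun_prop)
  have h3 := IndepFun.prodMk_left hφ (by fun_prop) (hζ n) h2 h1
  let ext : (Finset.range n → ℝ) → ℕ → ℝ := fun u i =>
    if h : i ∈ Finset.range n then u ⟨i, h⟩ else 0
  have hext : Measurable ext := measurable_pi_lambda _ fun i => by
    by_cases h : i ∈ Finset.range n
    · simp only [ext, h, dite_true]; fun_prop
    · simp only [ext, h, dite_false]; fun_prop
  have h4 := h3.comp (φ := fun p : S × (Finset.range n → ℝ) =>
    (p.1, genHist ev A p.1 (ext p.2) n)) (ψ := id)
    (measurable_fst.prodMk ((measurable_genHist hev hA n).comp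
      (measurable_fst.prodMk (hext.comp measurable_snd)))) measurable_id
  rw [Function.id_comp] at h4
  convert h4 using 1
  funext ω
  simp only [Function.comp_apply, Prod.mk.injEq, true_and]
  exact genHist_congr n fun i hi => by simp [ext, hi]

lemma measurable_dataLikelihood_mul (hev : Measurable (Function.uncurry ev)) (hφ : Measurable φ)
    {n : ℕ} {Ψ : S × (Fin n → Pt d × ℝ) → ENNReal} (hΨ : Measurable Ψ) :
    Measurable fun p : (Fin n → Pt d × ℝ) × Ω =>
      dataLikelihood ev σε (φ p.2) p.1 * Ψ (φ p.2, p.1) := by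
  have e : Measurable fun p : (Fin n → Pt d × ℝ) × Ω => (φ p.2, p.1) :=
    (hφ.comp measurable_snd).prodMk measurable_fst
  exact ((measurable_dataLikelihood hev σε n).comp e).mul (hΨ.comp e)

lemma measurable_gaussianPDF_mul (hev : Measurable (Function.uncurry ev)) {n : ℕ}
    {B : (Fin n → Pt d × ℝ) → Pt d} (hB : Measurable B) {v : NNReal}
    {g : S × (Fin n → Pt d × ℝ) → ℝ → ENNReal} (hgm : Measurable (Function.uncurry g)) :
    Measurable fun q : (S × (Fin n → Pt d × ℝ)) × ℝ =>
      gaussianPDF (ev q.1.1 (B q.1.2)) v q.2 * g q.1 q.2 := by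
  have hev' : Measurable fun p : S × (Fin n → Pt d × ℝ) => ev p.1 (B p.2) :=
    hev.comp (measurable_fst.prodMk (hB.comp measurable_snd))
  exact (measurable_uncurry_gaussianPDF.comp ((hev'.comp measurable_fst).prodMk
      (measurable_const.prodMk measurable_snd))).mul hgm

lemma measurable_dataLikelihood_mul_gaussianPDF (hev : Measurable (Function.uncurry ev))
    {n : ℕ} {B : (Fin n → Pt d × ℝ) → Pt d} (hB : Measurable B) (hφ : Measurable φ) {v : NNReal}
    {g : S × (Fin n → Pt d × ℝ) → ℝ → ENNReal} (hgm : Measurable (Function.uncurry g)) :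
    Measurable fun q : ((Fin n → Pt d × ℝ) × ℝ) × Ω =>
      dataLikelihood ev σε (φ q.2) q.1.1 *
        (gaussianPDF (ev (φ q.2) (B q.1.1)) v q.1.2 * g (φ q.2, q.1.1) q.1.2) := by
  have hpg := measurable_gaussianPDF_mul (v := v) hev hB hgm
  have e1 : Measurable fun q : ((Fin n → Pt d × ℝ) × ℝ) × Ω => (φ q.2, q.1.1) :=
    (hφ.comp measurable_snd).prodMk (measurable_fst.comp measurable_fst)
  have e2 : Measurable fun q : ((Fin n → Pt d × ℝ) × ℝ) × Ω =>
    ((φ q.2, q.1.1), q.1.2) := e1.prodMk (measurable_snd.comp measurable_fst)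
  have h1 := (measurable_dataLikelihood hev σε n).comp e1
  have h2 := hpg.comp e2
  simp only [Function.comp_def] at h1 h2
  exact h1.mul h2

/-- Integrating out the noise of the last observation. -/
lemma lintegral_genHist_succ (hσε : 0 < σε)
    (hev : Measurable (Function.uncurry ev)) (hA : ∀ n, Measurable (A n))
    (hφ : Measurable φ) (hζ : ∀ n, Measurable (ζ n)) (hind : iIndepFun ζ P)
    (hlaw : ∀ n, P.map (ζ n) = gaussianReal 0 (Real.toNNReal (σε ^ 2)))
    (hφζ : IndepFun φ (fun ω n => ζ n ω) P) (n : ℕ)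
    {g : S × (Fin n → Pt d × ℝ) → ℝ → ENNReal} (hgm : Measurable (Function.uncurry g)) :
    ∫⁻ ω, g (φ ω, genHist ev A (φ ω) (fun i => ζ i ω) n)
        (ev (φ ω) (A n (genHist ev A (φ ω) (fun i => ζ i ω) n)) + ζ n ω) ∂P
      = ∫⁻ ω, (∫⁻ y, gaussianPDF (ev (φ ω) (A n (genHist ev A (φ ω) (fun i => ζ i ω) n)))
          (Real.toNNReal (σε ^ 2)) y *
          g (φ ω, genHist ev A (φ ω) (fun i => ζ i ω) n) y) ∂P := by
  set v := Real.toNNReal (σε ^ 2) with hv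
  have hv0 : v ≠ 0 := by rw [hv]; simpa using hσε.ne'
  have hev' : Measurable fun p : S × (Fin n → Pt d × ℝ) => ev p.1 (A n p.2) :=
    hev.comp (measurable_fst.prodMk ((hA n).comp measurable_snd))
  have hpg := measurable_gaussianPDF_mul (v := v) hev (hA n) hgm
  have hUm : Measurable fun ω => (φ ω, genHist ev A (φ ω) (fun i => ζ i ω) n) :=
    hφ.prodMk ((measurable_genHist hev hA n).comp (hφ.prodMk (measurable_pi_lambda _ hζ)))
  have hI := indepFun_genHist hev hA hφ hζ hind hφζ n
  rw [indepFun_iff_map_prod_eq_prod_map_map hUm.aemeasurable (hζ n).aemeasurable, hlaw n] at hI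
  set U : Ω → S × (Fin n → Pt d × ℝ) :=
    fun ω => (φ ω, genHist ev A (φ ω) (fun i => ζ i ω) n) with hUdef
  have hshift : Measurable fun q : (S × (Fin n → Pt d × ℝ)) × ℝ =>
      g q.1 (ev q.1.1 (A n q.1.2) + q.2) :=
    hgm.comp (measurable_fst.prodMk ((hev'.comp measurable_fst).add measurable_snd))
  calc _ = ∫⁻ ω, g (U ω) (ev (U ω).1 (A n (U ω).2) + ζ n ω) ∂P := by simp only [hUdef]
    _ = ∫⁻ q, g q.1 (ev q.1.1 (A n q.1.2) + q.2) ∂(P.map fun ω => (U ω, ζ n ω)) := by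
        rw [lintegral_map hshift (hUm.prodMk (hζ n))]
    _ = ∫⁻ p, ∫⁻ u, g p (ev p.1 (A n p.2) + u) ∂gaussianReal 0 v ∂(P.map U) := by
        rw [hI, lintegral_prod _ hshift.aemeasurable]
    _ = ∫⁻ p, (∫⁻ y, gaussianPDF (ev p.1 (A n p.2)) v y * g p y) ∂(P.map U) := by
        refine lintegral_congr fun p => ?_
        have hgp : Measurable (g p) := hgm.of_uncurry_left
        rw [← lintegral_map (μ := gaussianReal 0 v) hgp
          (measurable_const_add (ev p.1 (A n p.2))), gaussianReal_map_const_add, zero_add,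
          gaussianReal_of_var_ne_zero _ hv0,
          lintegral_withDensity_eq_lintegral_mul _ (measurable_gaussianPDF _ _) hgp]
        rfl
    _ = _ := by
        rw [lintegral_map (Measurable.lintegral_prod_right' hpg) hUm]

/-- The joint law of the signal and adaptively collected data: the data contribute the likelihood
of a fixed design. -/
lemma exists_lintegral_genHist (hσε : 0 < σε) (hD : MeasurableSet D)
    (hev : Measurable (Function.uncurry ev)) (hA : ∀ n, Measurable (A n)) (hAD : ∀ n h, A n h ∈ D)
    (hφ : Measurable φ) (hζ : ∀ n, Measurable (ζ n)) (hind : iIndepFun ζ P)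
    (hlaw : ∀ n, P.map (ζ n) = gaussianReal 0 (Real.toNNReal (σε ^ 2)))
    (hφζ : IndepFun φ (fun ω n => ζ n ω) P) (n : ℕ) :
    ∃ Λ : Measure (Fin n → Pt d × ℝ), SFinite Λ ∧ (∀ᵐ h ∂Λ, ∀ i, (h i).1 ∈ D) ∧
      ∀ Ψ : S × (Fin n → Pt d × ℝ) → ENNReal, Measurable Ψ →
        ∫⁻ ω, Ψ (φ ω, genHist ev A (φ ω) (fun i => ζ i ω) n) ∂P
          = ∫⁻ h, ∫⁻ ω, dataLikelihood ev σε (φ ω) h * Ψ (φ ω, h) ∂P ∂Λ := by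
  induction n with
  | zero =>
    refine ⟨Measure.dirac Fin.elim0, inferInstance, Filter.Eventually.of_forall
      fun h i => i.elim0, fun Ψ hΨ => ?_⟩
    rw [lintegral_dirac' _
      (measurable_dataLikelihood_mul (σε := σε) hev hφ hΨ).lintegral_prod_right']
    simp [dataLikelihood, likelihood, genHist]
  | succ n ih =>
    obtain ⟨Λ, hΛ, hΛD, hΛΨ⟩ := ih
    set v := Real.toNNReal (σε ^ 2) with hv
    have hv0 : v ≠ 0 := by rw [hv]; simpa using hσε.ne'
    have hsn : Measurable fun p : (Fin n → Pt d × ℝ) × ℝ =>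
        (Fin.snoc p.1 (A n p.1, p.2) : Fin (n + 1) → Pt d × ℝ) :=
      measurable_snoc measurable_fst (((hA n).comp measurable_fst).prodMk measurable_snd)
    refine ⟨(Λ.prod volume).map fun p => Fin.snoc p.1 (A n p.1, p.2), inferInstance, ?_, ?_⟩
    · have hD' : ∀ᵐ p ∂(Λ.prod (volume : Measure ℝ)), ∀ i, (p.1 i).1 ∈ D :=
        Measure.quasiMeasurePreserving_fst.ae hΛD
      have hms : MeasurableSet {h : Fin (n + 1) → Pt d × ℝ | ∀ i, (h i).1 ∈ D} := by
        rw [Set.ofPred_forall]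
        exact MeasurableSet.iInter fun i => hD.preimage (by fun_prop)
      refine (ae_map_iff (p := fun h : Fin (n + 1) → Pt d × ℝ => ∀ i, (h i).1 ∈ D)
        hsn.aemeasurable hms).2 ?_
      filter_upwards [hD'] with p hp i
      refine Fin.lastCases ?_ (fun j => ?_) i
      · simpa using hAD n p.1
      · simpa using hp j
    · intro Ψ hΨ
      set g : S × (Fin n → Pt d × ℝ) → ℝ → ENNReal := fun p y =>
        Ψ (p.1, Fin.snoc p.2 (A n p.2, y)) with hg
      have hgm : Measurable (Function.uncurry g) := hΨ.comp
        ((measurable_fst.comp measurable_fst).prodMk (hsn.comp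
          ((measurable_snd.comp measurable_fst).prodMk measurable_snd)))
      have hpg := measurable_gaussianPDF_mul (v := v) hev (hA n) hgm
      have step1 := lintegral_genHist_succ hσε hev hA hφ hζ hind hlaw hφζ n hgm
      have hm1 : Measurable fun p : S × (Fin n → Pt d × ℝ) =>
          ∫⁻ y, gaussianPDF (ev p.1 (A n p.2)) v y * g p y :=
        Measurable.lintegral_prod_right' hpg
      have step2 := hΛΨ _ hm1
      refine Eq.trans ?_ (step1.trans (step2.trans ?_))
      · rfl
      clear step1 step2 hm1
      have hm2 := measurable_dataLikelihood_mul_gaussianPDF (σε := σε) (v := v) hev (hA n) hφ hgm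
      have hm3 := measurable_dataLikelihood_mul (σε := σε) hev hφ hΨ
      rw [lintegral_map hm3.lintegral_prod_right' hsn]
      simp only [dataLikelihood_snoc, mul_assoc]
      rw [lintegral_prod _ hm2.lintegral_prod_right'.aemeasurable]
      refine lintegral_congr fun h => ?_
      have hm4 := hm2.comp ((measurable_const.prodMk measurable_fst).prodMk measurable_snd :
        Measurable fun q : ℝ × Ω => ((h, q.1), q.2))
      simp only [Function.comp_def] at hm4
      rw [lintegral_lintegral_swap hm4.aemeasurable]
      refine lintegral_congr fun ω => ?_
      have hm5 := hpg.comp (measurable_const.prodMk measurable_id :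
        Measurable fun y : ℝ => ((φ ω, h), y))
      simp only [Function.comp_def] at hm5
      exact (lintegral_const_mul _ hm5).symm

end Adaptive

/-! ### Measurability of the posterior -/

section PosteriorMeasurable

variable {d n : ℕ} {K : Pt d → Pt d → ℝ} {σε : ℝ} {α : Type*} [MeasurableSpace α]

lemma measurable_matrix_inv_apply {ι : Type*} [Fintype ι] [DecidableEq ι]
    {A : α → Matrix ι ι ℝ} (hA : ∀ i j, Measurable fun a => A a i j) (i j : ι) :
    Measurable fun a => (A a)⁻¹ i j := by
  have h : Measurable fun a => (fun i j => A a i j : ι → ι → ℝ) :=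
    measurable_pi_lambda _ fun i => measurable_pi_lambda _ fun j => hA i j
  have hc : Continuous fun M : ι → ι → ℝ => (Matrix.of M) := continuous_id
  have hdet : Measurable fun M : ι → ι → ℝ => (Matrix.of M).det := hc.matrix_det.measurable
  have hadj : Measurable fun M : ι → ι → ℝ => (Matrix.of M).adjugate i j :=
    (hc.matrix_adjugate.matrix_elem i j).measurable
  have e : (fun a => (A a)⁻¹ i j) = fun a => ((Matrix.of fun i j => A a i j).det)⁻¹ *
      (Matrix.of fun i j => A a i j).adjugate i j := by
    funext a
    rw [Matrix.inv_def, Ring.inverse_eq_inv']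
    rfl
  rw [e]
  exact ((hdet.comp h).inv).mul (hadj.comp h)

variable {X : α → Fin n → Pt d} {y : α → Fin n → ℝ} {z : α → Pt d}

lemma measurable_noisyGram_inv_apply (hK : Measurable (Function.uncurry K)) (hX : Measurable X)
    (i j : Fin n) : Measurable fun a => (noisyGram K σε (X a))⁻¹ i j := by
  refine measurable_matrix_inv_apply (fun i j => ?_) i j
  have h : Measurable fun a => K (X a i) (X a j) :=
    hK.comp (((measurable_pi_apply i).comp hX).prodMk ((measurable_pi_apply j).comp hX))
  exact h.add measurable_const

lemma measurable_kvec_apply (hK : Measurable (Function.uncurry K)) (hX : Measurable X)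
    (hz : Measurable z) (i : Fin n) : Measurable fun a => kvec K (X a) (z a) i :=
  hK.comp (hz.prodMk ((measurable_pi_apply i).comp hX))

lemma measurable_postMean (hK : Measurable (Function.uncurry K)) (hX : Measurable X)
    (hy : Measurable y) (hz : Measurable z) :
    Measurable fun a => postMean K σε (X a) (y a) (z a) := by
  simp only [postMean, Matrix.mulVec, dotProduct]
  refine Finset.measurable_sum _ fun i _ => (measurable_kvec_apply hK hX hz i).mul ?_
  exact Finset.measurable_sum _ fun j _ => (measurable_noisyGram_inv_apply hK hX i j).mul
    ((measurable_pi_apply j).comp hy)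

lemma measurable_postVar (hK : Measurable (Function.uncurry K)) (hX : Measurable X)
    (hz : Measurable z) :
    Measurable fun a => postVar K σε (X a) (z a) := by
  simp only [postVar, gainVec, Matrix.mulVec, dotProduct]
  have h0 : Measurable fun a => K (z a) (z a) := hK.comp (hz.prodMk hz)
  refine h0.sub (Finset.measurable_sum _ fun i _ => (measurable_kvec_apply hK hX hz i).mul ?_)
  exact Finset.measurable_sum _ fun j _ => (measurable_noisyGram_inv_apply hK hX i j).mul
    (measurable_kvec_apply hK hX hz j)

variable {D : Set (Pt d)} {K' : Pt d → Pt d → ℝ}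

lemma kvec_congr (h : ∀ x ∈ D, ∀ x' ∈ D, K x x' = K' x x') {X : Fin n → Pt d}
    (hX : ∀ i, X i ∈ D) {z : Pt d} (hz : z ∈ D) : kvec K X z = kvec K' X z :=
  funext fun i => h _ hz _ (hX i)

lemma noisyGram_congr (h : ∀ x ∈ D, ∀ x' ∈ D, K x x' = K' x x') {X : Fin n → Pt d}
    (hX : ∀ i, X i ∈ D) : noisyGram K σε X = noisyGram K' σε X := by
  have : gram K X = gram K' X := by ext i j; exact h _ (hX i) _ (hX j)
  rw [noisyGram, this, noisyGram]

lemma postMean_congr (h : ∀ x ∈ D, ∀ x' ∈ D, K x x' = K' x x') {X : Fin n → Pt d}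
    (hX : ∀ i, X i ∈ D) {z : Pt d} (hz : z ∈ D) (y : Fin n → ℝ) :
    postMean K σε X y z = postMean K' σε X y z := by
  rw [postMean, kvec_congr h hX hz, noisyGram_congr h hX, postMean]

lemma postVar_congr (h : ∀ x ∈ D, ∀ x' ∈ D, K x x' = K' x x') {X : Fin n → Pt d}
    (hX : ∀ i, X i ∈ D) {z : Pt d} (hz : z ∈ D) :
    postVar K σε X z = postVar K' σε X z := by
  rw [postVar, gainVec, kvec_congr h hX hz, noisyGram_congr h hX, h z hz z hz, postVar, gainVec]

end PosteriorMeasurable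

/-! ### Concentration around the posterior mean for adaptively collected data -/

section AdaptiveTail

variable {d : ℕ} {S Ω : Type*}
  {ev : S → Pt d → ℝ} {A : ∀ n, (Fin n → Pt d × ℝ) → Pt d} {D : Set (Pt d)}

lemma genHist_mem (hAD : ∀ n h, A n h ∈ D) (s : S) (u : ℕ → ℝ) (n : ℕ) (i : Fin n) :
    (genHist ev A s u n i).1 ∈ D := by
  induction n with
  | zero => exact i.elim0
  | succ n ih =>
    refine Fin.lastCases ?_ (fun j => ?_) i
    · simpa [genHist] using hAD n _
    · simpa [genHist] using ih j

variable [MeasurableSpace Ω] [MeasurableSpace S] {P : Measure Ω} [IsProbabilityMeasure P] {φ : Ω → S} {ζ : ℕ → Ω → ℝ} {σε σf : ℝ}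
  {K : Pt d → Pt d → ℝ} {f : Ω → Pt d → ℝ}

lemma measure_genHist_le (hσε : 0 < σε) (hD : MeasurableSet D)
    (hev : Measurable (Function.uncurry ev)) (hA : ∀ n, Measurable (A n))
    (hAD : ∀ n h, A n h ∈ D)
    (hφ : Measurable φ) (hζ : ∀ n, Measurable (ζ n)) (hind : iIndepFun ζ P)
    (hlaw : ∀ n, P.map (ζ n) = gaussianReal 0 (Real.toNNReal (σε ^ 2)))
    (hφζ : IndepFun φ (fun ω n => ζ n ω) P) (n : ℕ) {W : Set (S × (Fin n → Pt d × ℝ))}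
    (hW : MeasurableSet W) {c : ENNReal}
    (h : ∀ h : Fin n → Pt d × ℝ, (∀ i, (h i).1 ∈ D) →
      ∫⁻ ω, dataLikelihood ev σε (φ ω) h * W.indicator 1 (φ ω, h) ∂P
        ≤ c * ∫⁻ ω, dataLikelihood ev σε (φ ω) h ∂P) :
    P {ω | (φ ω, genHist ev A (φ ω) (fun i => ζ i ω) n) ∈ W} ≤ c := by
  obtain ⟨Λ, -, hΛD, hΛ⟩ :=
    exists_lintegral_genHist hσε hD hev hA hAD hφ hζ hind hlaw hφζ n
  have hUm : Measurable fun ω => (φ ω, genHist ev A (φ ω) (fun i => ζ i ω) n) :=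
    hφ.prodMk ((measurable_genHist hev hA n).comp (hφ.prodMk (measurable_pi_lambda _ hζ)))
  have h1 := hΛ (W.indicator 1) (measurable_one.indicator hW)
  have h2 := hΛ 1 measurable_one
  have h3 : Measurable fun h : Fin n → Pt d × ℝ => ∫⁻ ω, dataLikelihood ev σε (φ ω) h ∂P := by
    have := measurable_dataLikelihood_mul (σε := σε) hev hφ (n := n) measurable_one
    simp only [Pi.one_apply, mul_one] at this
    exact this.lintegral_prod_right'
  simp only [Pi.one_apply, mul_one, lintegral_one, measure_univ] at h2
  calc P {ω | (φ ω, genHist ev A (φ ω) (fun i => ζ i ω) n) ∈ W}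
      = ∫⁻ ω, W.indicator 1 (φ ω, genHist ev A (φ ω) (fun i => ζ i ω) n) ∂P := by
        have e := lintegral_indicator_one (μ := P) (hUm hW)
        rw [show {ω | (φ ω, genHist ev A (φ ω) (fun i => ζ i ω) n) ∈ W} =
          (fun ω => (φ ω, genHist ev A (φ ω) (fun i => ζ i ω) n)) ⁻¹' W from rfl, ← e]
        rfl
    _ ≤ ∫⁻ h, c * ∫⁻ ω, dataLikelihood ev σε (φ ω) h ∂P ∂Λ := by
        rw [h1]
        refine lintegral_mono_ae ?_
        filter_upwards [hΛD] with g hg using h g hg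
    _ = c := by rw [lintegral_const_mul _ h3, ← h2, mul_one]

lemma exists_measurable_kernel (hev : Measurable (Function.uncurry ev)) (hφ : Measurable φ)
    (hf : IsCenteredGP P D K f) (hevf : ∀ᵐ ω ∂P, ∀ x ∈ D, ev (φ ω) x = f ω x) :
    ∃ K' : Pt d → Pt d → ℝ, Measurable (Function.uncurry K') ∧
      ∀ x ∈ D, ∀ x' ∈ D, K x x' = K' x x' := by
  refine ⟨fun x x' => ∫ ω, ev (φ ω) x * ev (φ ω) x' ∂P, ?_, fun x hx x' hx' => ?_⟩
  · have h1 : Measurable fun q : (Pt d × Pt d) × Ω => ev (φ q.2) q.1.1 :=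
      hev.comp ((hφ.comp measurable_snd).prodMk (measurable_fst.comp measurable_fst))
    have h2 : Measurable fun q : (Pt d × Pt d) × Ω => ev (φ q.2) q.1.2 :=
      hev.comp ((hφ.comp measurable_snd).prodMk (measurable_snd.comp measurable_fst))
    exact (StronglyMeasurable.integral_prod_right (ν := P)
      (f := fun (p : Pt d × Pt d) ω => ev (φ ω) p.1 * ev (φ ω) p.2)
      (h1.mul h2).stronglyMeasurable).measurable
  · rw [← hf.covariance x hx x' hx', covariance, hf.mean_zero x hx, hf.mean_zero x' hx']
    refine integral_congr_ae ?_
    filter_upwards [hevf] with ω hω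
    rw [hω x hx, hω x' hx', sub_zero, sub_zero]

lemma genHist_tail (hσε : 0 < σε) (hσf : 0 < σf) (hD : MeasurableSet D)
    (hev : Measurable (Function.uncurry ev)) (hA : ∀ n, Measurable (A n))
    (hAD : ∀ n h, A n h ∈ D)
    (hφ : Measurable φ) (hζ : ∀ n, Measurable (ζ n)) (hind : iIndepFun ζ P)
    (hlaw : ∀ n, P.map (ζ n) = gaussianReal 0 (Real.toNNReal (σε ^ 2)))
    (hφζ : IndepFun φ (fun ω n => ζ n ω) P)
    (hf : IsCenteredGP P D K f) (hdiag : ∀ x ∈ D, K x x = σf ^ 2)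
    (hevf : ∀ᵐ ω ∂P, ∀ x ∈ D, ev (φ ω) x = f ω x) (n : ℕ)
    {B : (Fin n → Pt d × ℝ) → Pt d} (hB : Measurable B) (hBD : ∀ h, B h ∈ D) {s τ : ℝ}
    (hs : 0 ≤ s) (hτ : τ = 1 ∨ τ = -1) :
    P {ω | let h := genHist ev A (φ ω) (fun i => ζ i ω) n
      s * √(postVar K σε (fun i => (h i).1) (B h))
        < τ * (ev (φ ω) (B h) - postMean K σε (fun i => (h i).1) (fun i => (h i).2) (B h))}
      ≤ ENNReal.ofReal (Real.exp (-s ^ 2 / 2)) := by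
  obtain ⟨K', hK', hKK⟩ := exists_measurable_kernel hev hφ hf hevf
  have hX : Measurable fun (q : S × (Fin n → Pt d × ℝ)) (i : Fin n) => (q.2 i).1 := by fun_prop
  have hy : Measurable fun (q : S × (Fin n → Pt d × ℝ)) (i : Fin n) => (q.2 i).2 := by fun_prop
  have hz : Measurable fun q : S × (Fin n → Pt d × ℝ) => B q.2 := hB.comp measurable_snd
  set W : Set (S × (Fin n → Pt d × ℝ)) := {q |
    s * √(postVar K' σε (fun i => (q.2 i).1) (B q.2)) < τ * (ev q.1 (B q.2)
      - postMean K' σε (fun i => (q.2 i).1) (fun i => (q.2 i).2) (B q.2))} with hWdef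
  have hW : MeasurableSet W := measurableSet_lt
    ((measurable_postVar hK' hX hz).sqrt.const_mul s)
    (((hev.comp (measurable_fst.prodMk hz)).sub (measurable_postMean hK' hX hy hz)).const_mul τ)
  refine le_trans (le_of_eq ?_) (measure_genHist_le hσε hD hev hA hAD hφ hζ hind hlaw hφζ n hW
    (c := ENNReal.ofReal (Real.exp (-s ^ 2 / 2))) fun h hh => ?_)
  · congr 1
    ext ω
    simp only [hWdef, Set.mem_ofPred_eq]
    rw [postMean_congr hKK (fun i => genHist_mem hAD _ _ n i) (hBD _),
      postVar_congr hKK (fun i => genHist_mem hAD _ _ n i) (hBD _)]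
  · have h1 := hf.posterior_tail hσε hσf hdiag hh (hBD h) (fun i => (h i).2) hs hτ
    convert h1 using 1
    · refine lintegral_congr_ae ?_
      filter_upwards [hevf] with ω hω
      have e1 : dataLikelihood ev σε (φ ω) h
          = likelihood σε (fun i => (h i).2) (fun i => f ω (h i).1) := by
        simp only [dataLikelihood, hω _ (hh _)]
      rw [e1]
      congr 1
      simp only [Set.indicator, hWdef, Set.mem_ofPred_eq, hω _ (hBD h), Pi.one_apply,
        postMean_congr hKK hh (hBD h), postVar_congr hKK hh (hBD h)]
    · congr 1
      refine lintegral_congr_ae ?_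
      filter_upwards [hevf] with ω hω
      simp only [dataLikelihood, hω _ (hh _)]

end AdaptiveTail

/-! ### Jointly measurable evaluation of sample paths -/

section Evaluation

variable {d : ℕ} {D : Set (Pt d)} {p₀ : Pt d}

/-- The evaluation of `e` at `x`, through points of a countable dense subset of `D`. -/
def evalLim (D : Set (Pt d)) (p₀ : Pt d) (hp : p₀ ∈ D) (e : D → ℝ) (x : Pt d) : ℝ :=
  Filter.limsup (fun n => e ⟨SimpleFunc.approxOn id measurable_id D p₀ hp n x,
    SimpleFunc.approxOn_mem measurable_id hp n x⟩) Filter.atTop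

lemma measurable_evalLim (hp : p₀ ∈ D) : Measurable (Function.uncurry (evalLim D p₀ hp)) := by
  classical
  refine Measurable.limsup fun n => ?_
  let g : Pt d → (D → ℝ) × Pt d → ℝ := fun b q => if h : b ∈ D then q.1 ⟨b, h⟩ else 0
  have hg : ∀ b, Measurable (g b) := fun b => by
    by_cases h : b ∈ D
    · simp only [g, h, dite_true]; exact (measurable_pi_apply _).comp measurable_fst
    · simp only [g, h, dite_false]; exact measurable_const
  have := SimpleFunc.measurable_bind
    ((SimpleFunc.approxOn id measurable_id D p₀ hp n).comp (Prod.snd : (D → ℝ) × Pt d → Pt d)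
      measurable_snd) g hg
  convert this using 1
  funext q
  have h := SimpleFunc.approxOn_mem measurable_id hp n q.2
  have e : ((SimpleFunc.approxOn id measurable_id D p₀ hp n).comp
      (Prod.snd : (D → ℝ) × Pt d → Pt d) measurable_snd) q
      = SimpleFunc.approxOn id measurable_id D p₀ hp n q.2 := rfl
  simp only [g, e, dif_pos h]

lemma evalLim_eq (hp : p₀ ∈ D) {f : Pt d → ℝ} (hf : ContinuousOn f D) {x : Pt d} (hx : x ∈ D) :
    evalLim D p₀ hp (fun x : D => f x) x = f x := by
  refine Filter.Tendsto.limsup_eq ?_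
  have h := SimpleFunc.tendsto_approxOn measurable_id hp (x := x) (subset_closure hx)
  exact (hf x hx).tendsto.comp (tendsto_nhdsWithin_iff.2
    ⟨h, Filter.Eventually.of_forall fun n => SimpleFunc.approxOn_mem measurable_id hp n x⟩)

end Evaluation

/-! ### Concentration along a run -/

section Run

variable {d : ℕ} {Ω : Type*} {x : ℕ → Ω → Pt d} {y : ℕ → Ω → ℝ}

lemma history_succ (n : ℕ) (ω : Ω) :
    history x y (n + 1 + 1) ω = Fin.snoc (history x y (n + 1) ω) (x (n + 1) ω, y (n + 1) ω) := by
  funext i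
  refine Fin.lastCases ?_ (fun j => ?_) i
  · rw [Fin.snoc_last]; rfl
  · rw [Fin.snoc_castSucc]; rfl

variable [MeasurableSpace Ω] {P : Measure Ω} [IsProbabilityMeasure P]
  {D : Set (Pt d)} {K : Pt d → Pt d → ℝ} {f : Ω → Pt d → ℝ} {σε σf : ℝ} {k : ℝ → ℝ} {l : ℝ}
  {M : ℕ → ℕ} {R : ℕ → ℕ → ℝ} {β : ℕ → ℝ} {ξ : ℕ → Ω → ℝ}

lemma measure_le_of_ae_imp {Ω : Type*} [MeasurableSpace Ω] {P : Measure Ω} {s t : Set Ω}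
    (h : ∀ᵐ ω ∂P, ω ∈ s → ω ∈ t) : P s ≤ P t := measure_mono_ae h

/-- Confidence bounds hold at every point that is selected by a measurable rule from the data. -/
lemma IsRun.exists_rule (hrun : IsRun P D k l σε M R β f ξ x y) (hσε : 0 < σε) (hσf : 0 < σf)
    (hD : IsCompact D) (hf : IsCenteredGP P D K f) (hdiag : ∀ x ∈ D, K x x = σf ^ 2)
    (hcont : ∀ᵐ ω ∂P, ContinuousOn (f ω) D) (hξ : IsNoise P D σε f ξ) :
    ∃ A : ∀ n, (Fin n → Pt d × ℝ) → Pt d, (∀ n, Measurable (A n)) ∧ (∀ n h, A n h ∈ D) ∧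
      (∀ᵐ ω ∂P, ∀ n, x (n + 1) ω = A n (history x y (n + 1) ω)) ∧
      ∀ (n : ℕ) (B : (Fin n → Pt d × ℝ) → Pt d), Measurable B → (∀ h, B h ∈ D) →
        ∀ s τ : ℝ, 0 ≤ s → (τ = 1 ∨ τ = -1) →
        P {ω | let h : Fin n → Pt d × ℝ := history x y (n + 1) ω
          s * √(postVar K σε (fun i => (h i).1) (B h))
            < τ * (f ω (B h) - postMean K σε (fun i => (h i).1) (fun i => (h i).2) (B h))}
          ≤ ENNReal.ofReal (Real.exp (-s ^ 2 / 2)) := by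
  classical
  have hxD : ∀ᵐ ω ∂P, ∀ n, x (n + 1) ω ∈ D := by
    filter_upwards [hrun.optimal] with ω hω n
    obtain ⟨z, hz, hzx⟩ := hω (n + 1) (by omega)
    exact hzx ▸ hz.1.point_mem
  obtain ⟨ω₀, hω₀⟩ := hxD.exists
  set p₀ := x (0 + 1) ω₀
  have hp : p₀ ∈ D := hω₀ 0
  choose A₀ hA₀m hA₀ using fun n => hrun.rule (n + 1) (by omega)
  let A : ∀ n, (Fin n → Pt d × ℝ) → Pt d := fun n h => if A₀ n h ∈ D then A₀ n h else p₀
  have hAm : ∀ n, Measurable (A n) := fun n =>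
    Measurable.ite (hA₀m n hD.measurableSet) (hA₀m n) measurable_const
  have hAD : ∀ n h, A n h ∈ D := fun n h => by
    by_cases h0 : A₀ n h ∈ D
    · simp [A, h0]
    · simp [A, h0, hp]
  have hxA : ∀ᵐ ω ∂P, ∀ n, x (n + 1) ω = A n (history x y (n + 1) ω) := by
    filter_upwards [hxD] with ω hω n
    have h1 := hω n
    rw [hA₀ n ω] at h1 ⊢
    exact (if_pos h1).symm
  refine ⟨A, hAm, hAD, hxA, fun n B hB hBD s τ hs hτ => ?_⟩
  let φ : Ω → D → ℝ := fun ω x => f ω x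
  have hφ : Measurable φ := measurable_pi_lambda _ fun x => hf.measurable x x.2
  have hevf : ∀ᵐ ω ∂P, ∀ x ∈ D, evalLim D p₀ hp (φ ω) x = f ω x := by
    filter_upwards [hcont] with ω hω x hx using evalLim_eq hp hω hx
  have hhist : ∀ᵐ ω ∂P, ∀ n, history x y (n + 1) ω
      = genHist (evalLim D p₀ hp) A (φ ω) (fun i => ξ (i + 1) ω) n := by
    filter_upwards [hxD, hxA, hevf] with ω h1 h2 h3 n
    induction n with
    | zero => funext i; exact i.elim0
    | succ n ih =>
      rw [history_succ, genHist, ← ih, ← h2 n, h3 _ (h1 n), hrun.obs (n + 1) (by omega)]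
  have hind : iIndepFun (fun n => ξ (n + 1)) P :=
    hξ.indep.precomp (g := fun n : ℕ => n + 1) (add_left_injective 1)
  have hφξ : IndepFun φ (fun ω n => ξ (n + 1) ω) P :=
    hξ.indep_fun.comp (ψ := fun (u : ℕ → ℝ) n => u (n + 1)) measurable_id (by fun_prop)
  have key := genHist_tail hσε hσf hD.measurableSet (measurable_evalLim hp) hAm hAD hφ
    (fun n => hξ.measurable (n + 1)) hind (fun n => hξ.law (n + 1)) hφξ hf hdiag hevf n hB hBD
    hs hτ
  refine le_trans (measure_le_of_ae_imp ?_) key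
  filter_upwards [hevf, hhist] with ω h1 h2 h3
  simp only [← h2 n] at h3 ⊢
  rwa [h1 _ (hBD _)]

lemma IsRun.tail_query (hrun : IsRun P D k l σε M R β f ξ x y) (hσε : 0 < σε) (hσf : 0 < σf)
    (hD : IsCompact D) (hf : IsCenteredGP P D K f) (hdiag : ∀ x ∈ D, K x x = σf ^ 2)
    (hcont : ∀ᵐ ω ∂P, ContinuousOn (f ω) D) (hξ : IsNoise P D σε f ξ) (n : ℕ) {s : ℝ}
    (hs : 0 ≤ s) :
    P {ω | postMean K σε (fun i : Fin n => x (i + 1) ω) (fun i => y (i + 1) ω) (x (n + 1) ω)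
        + s * √(postVar K σε (fun i : Fin n => x (i + 1) ω) (x (n + 1) ω)) < f ω (x (n + 1) ω)}
      ≤ ENNReal.ofReal (Real.exp (-s ^ 2 / 2)) := by
  obtain ⟨A, hAm, hAD, hxA, h⟩ := hrun.exists_rule hσε hσf hD hf hdiag hcont hξ
  refine le_trans (measure_le_of_ae_imp ?_) (h n (A n) (hAm n) (hAD n) s 1 hs (Or.inl rfl))
  filter_upwards [hxA] with ω hω h1
  change s * √(postVar K σε (fun i : Fin n => x (i + 1) ω) (A n (history x y (n + 1) ω))) <
    1 * (f ω (A n (history x y (n + 1) ω)) - postMean K σε (fun i : Fin n => x (i + 1) ω)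
      (fun i => y (i + 1) ω) (A n (history x y (n + 1) ω)))
  rw [← hω n]
  linarith

lemma IsRun.tail_point (hrun : IsRun P D k l σε M R β f ξ x y) (hσε : 0 < σε) (hσf : 0 < σf)
    (hD : IsCompact D) (hf : IsCenteredGP P D K f) (hdiag : ∀ x ∈ D, K x x = σf ^ 2)
    (hcont : ∀ᵐ ω ∂P, ContinuousOn (f ω) D) (hξ : IsNoise P D σε f ξ) (n : ℕ) {s : ℝ}
    (hs : 0 ≤ s) {g : Pt d} (hg : g ∈ D) :
    P {ω | f ω g < postMean K σε (fun i : Fin n => x (i + 1) ω) (fun i => y (i + 1) ω) g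
        - s * √(postVar K σε (fun i : Fin n => x (i + 1) ω) g)}
      ≤ ENNReal.ofReal (Real.exp (-s ^ 2 / 2)) := by
  obtain ⟨A, hAm, hAD, hxA, h⟩ := hrun.exists_rule hσε hσf hD hf hdiag hcont hξ
  refine le_trans (measure_mono fun ω h1 => ?_) (h n (fun _ => g) measurable_const (fun _ => hg)
    s (-1) hs (Or.inr rfl))
  rw [Set.mem_ofPred_eq] at h1
  change s * √(postVar K σε (fun i : Fin n => x (i + 1) ω) g) <
    -1 * (f ω g - postMean K σε (fun i : Fin n => x (i + 1) ω) (fun i => y (i + 1) ω) g)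
  linarith

end Run

/-! ### The mixed-integer program -/

section Program

variable {k : ℝ → ℝ} {M : ℕ} {R : ℕ → ℝ} {ρ κ : ℝ}

lemma breakpoint_mono (hR : ∀ j < M, R j < R (j + 1)) {i j : ℕ} (hij : i ≤ j) (hj : j ≤ M) :
    R i ≤ R j := by
  induction j, hij using Nat.le_induction with
  | base => exact le_rfl
  | succ n _ ih => exact (ih (by omega)).trans (hR n (by omega)).le

lemma pwl_succ (k : ℝ → ℝ) (M : ℕ) (R : ℕ → ℝ) (ρ : ℝ) :
    pwl k (M + 1) R ρ = pwl k M R ρ +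
      (k (R (M + 1)) - k (R M)) * max 0 (min 1 ((ρ - R M) / (R (M + 1) - R M))) := by
  rw [pwl, pwl, Finset.sum_range_succ, add_assoc]

lemma pwl_eq_last (hR : ∀ j < M, R j < R (j + 1)) (hρ : R M ≤ ρ) : pwl k M R ρ = k (R M) := by
  induction M with
  | zero => simp [pwl]
  | succ M ih =>
    have hM := hR M (by omega)
    rw [pwl_succ, ih (fun j hj => hR j (by omega)) (hM.le.trans hρ)]
    have : 1 ≤ (ρ - R M) / (R (M + 1) - R M) := by
      rw [le_div_iff₀ (by linarith)]; linarith
    rw [min_eq_left this, max_eq_right zero_le_one]; ring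

/-- On each segment `pwl` is the linear interpolant. -/
lemma pwl_segment (hR : ∀ j < M, R j < R (j + 1)) {j : ℕ} (hj : j < M) (h1 : R j ≤ ρ)
    (h2 : ρ ≤ R (j + 1)) :
    pwl k M R ρ = k (R j) + (k (R (j + 1)) - k (R j)) * ((ρ - R j) / (R (j + 1) - R j)) := by
  induction M with
  | zero => omega
  | succ M ih =>
    have hM := hR M (by omega)
    rw [pwl_succ]
    rcases Nat.lt_succ_iff_lt_or_eq.1 hj with h | rfl
    · rw [ih (fun j hj => hR j (by omega)) h]
      have h3 : R (j + 1) ≤ R M := breakpoint_mono hR (by omega) (by omega)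
      have : (ρ - R M) / (R (M + 1) - R M) ≤ 0 :=
        div_nonpos_of_nonpos_of_nonneg (by linarith) (by linarith)
      rw [max_eq_left ((min_le_right _ _).trans this), mul_zero, add_zero]
    · rw [pwl_eq_last (fun i hi => hR i (by omega)) h1]
      have h3 : 0 ≤ (ρ - R j) / (R (j + 1) - R j) := div_nonneg (by linarith) (by linarith)
      have h4 : (ρ - R j) / (R (j + 1) - R j) ≤ 1 := by
        rw [div_le_one (by linarith)]; linarith
      rw [min_eq_right h4, max_eq_right h3]

lemma exists_segment (hM : 1 ≤ M) (h0 : R 0 ≤ ρ) (h1 : ρ ≤ R M) :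
    ∃ j < M, R j ≤ ρ ∧ ρ ≤ R (j + 1) := by
  induction M, hM using Nat.le_induction with
  | base => exact ⟨0, by omega, h0, h1⟩
  | succ n _ ih =>
    rcases le_total ρ (R n) with h | h
    · obtain ⟨j, hj, h2⟩ := ih h
      exact ⟨j, by omega, h2⟩
    · exact ⟨n, by omega, h, h1⟩

lemma PLEncoding.exists_selected {w lam : ℕ → ℝ} (h : PLEncoding k M R ρ κ w lam) :
    ∃ j < M, ∀ i ≤ M, i ≠ j → i ≠ j + 1 → w i = 0 := by
  have hex : ∃ j ∈ Finset.Icc 1 M, lam j = 1 := by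
    by_contra hc
    push Not at hc
    have : ∑ j ∈ Finset.Icc 1 M, lam j = 0 := Finset.sum_eq_zero fun j hj =>
      (h.sel_binary j hj).resolve_right (hc j hj)
    rw [h.sel_sum] at this
    exact one_ne_zero this
  obtain ⟨m, hm, hm1⟩ := hex
  have hnn : ∀ i ∈ Finset.Icc 1 M, 0 ≤ lam i := fun i hi => by
    rcases h.sel_binary i hi with h | h <;> rw [h]
    exact zero_le_one
  have hother : ∀ i ∈ Finset.Icc 1 M, i ≠ m → lam i = 0 := fun i hi him => by
    have h1 := Finset.sum_erase_add _ lam hm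
    rw [h.sel_sum, hm1] at h1
    have h2 : ∑ i ∈ (Finset.Icc 1 M).erase m, lam i = 0 := by linarith
    exact (Finset.sum_eq_zero_iff_of_nonneg fun i hi => hnn i (Finset.mem_of_mem_erase hi)).1 h2 i
      (Finset.mem_erase.2 ⟨him, hi⟩)
  rw [Finset.mem_Icc] at hm
  refine ⟨m - 1, by omega, fun i hi h1 h2 => le_antisymm ?_ (h.weight_nonneg i hi)⟩
  rcases Nat.eq_zero_or_pos i with rfl | hi0
  · rw [← hother 1 (by simp; omega) (by omega)]
    exact h.weight_first
  rcases hi.eq_or_lt with rfl | hiM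
  · rw [← hother i (by simp; omega) (by omega)]
    exact h.weight_last
  · have := h.weight_mid i hi0 hiM
    rw [hother i (by simp; omega) (by omega), hother (i + 1) (by simp; omega) (by omega)] at this
    simpa using this

lemma sum_eq_two {w : ℕ → ℝ} {j : ℕ} (hj : j < M)
    (h : ∀ i ≤ M, i ≠ j → i ≠ j + 1 → w i = 0) (a : ℕ → ℝ) :
    ∑ i ∈ Finset.range (M + 1), w i * a i = w j * a j + w (j + 1) * a (j + 1) := by
  rw [← Finset.sum_pair (f := fun i => w i * a i) (by omega : j ≠ j + 1)]
  symm
  apply Finset.sum_subset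
  · intro i hi; simp at hi ⊢; omega
  · intro i hi hi2
    simp only [Finset.mem_range, Finset.mem_insert, Finset.mem_singleton, not_or] at hi hi2
    rw [h i (by omega) hi2.1 hi2.2, zero_mul]

/-- The encoding computes the value of the piecewise linear interpolant. -/
lemma PLEncoding.eq_pwl {w lam : ℕ → ℝ} (h : PLEncoding k M R ρ κ w lam)
    (hR : ∀ j < M, R j < R (j + 1)) : R 0 ≤ ρ ∧ κ = pwl k M R ρ := by
  obtain ⟨j, hj, hw⟩ := h.exists_selected
  have hs := h.weight_sum
  have hρ := h.arg_eq
  have hκ := h.val_eq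
  have hs' := sum_eq_two hj hw (fun _ => 1)
  simp only [mul_one] at hs'
  rw [hs'] at hs
  rw [sum_eq_two hj hw] at hρ hκ
  have h1 := h.weight_nonneg j hj.le
  have h2 := h.weight_nonneg (j + 1) hj
  have hlt := hR j hj
  have e : w j = 1 - w (j + 1) := by linarith
  have eρ : ρ - R j = w (j + 1) * (R (j + 1) - R j) := by rw [hρ, e]; ring
  have l1 : R j ≤ ρ := by nlinarith
  have l2 : ρ ≤ R (j + 1) := by nlinarith
  refine ⟨(breakpoint_mono hR (Nat.zero_le j) hj.le).trans l1, ?_⟩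
  rw [pwl_segment hR hj l1 l2, eρ, mul_div_assoc, div_self (by linarith), mul_one, hκ, e]
  ring

lemma exists_plEncoding (hM : 1 ≤ M) (hR : ∀ j < M, R j < R (j + 1)) (h0 : R 0 ≤ ρ)
    (h1 : ρ ≤ R M) : ∃ w lam, PLEncoding k M R ρ (pwl k M R ρ) w lam := by
  obtain ⟨j, hj, h2, h3⟩ := exists_segment hM h0 h1
  have hlt := hR j hj
  set θ := (ρ - R j) / (R (j + 1) - R j) with hθ
  have hθ0 : 0 ≤ θ := div_nonneg (by linarith) (by linarith)
  have hθ1 : θ ≤ 1 := by rw [hθ, div_le_one (by linarith)]; linarith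
  have hθR : θ * (R (j + 1) - R j) = ρ - R j := div_mul_cancel₀ _ (by linarith)
  let w : ℕ → ℝ := fun i => if i = j then 1 - θ else if i = j + 1 then θ else 0
  let lam : ℕ → ℝ := fun i => if i = j + 1 then 1 else 0
  have hw : ∀ i ≤ M, i ≠ j → i ≠ j + 1 → w i = 0 := fun i _ h1 h2 => by simp [w, h1, h2]
  have wj : w j = 1 - θ := by simp [w]
  have wj1 : w (j + 1) = θ := by simp [w]
  have hwl : ∀ i, w i ≤ lam i + lam (i + 1) := fun i => by
    simp only [w, lam]
    split_ifs <;> first | omega | linarith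
  refine ⟨w, lam, ?_, ?_, ?_, ?_, ?_, ?_, ?_, ?_, ?_⟩
  · rw [sum_eq_two hj hw, wj, wj1]; linarith
  · rw [sum_eq_two hj hw, wj, wj1, pwl_segment hR hj h2 h3]; ring
  · have := sum_eq_two hj hw (fun _ => 1)
    simp only [mul_one] at this
    rw [this, wj, wj1]; ring
  · intro i _
    simp only [w]
    split_ifs <;> linarith
  · simp only [lam]
    rw [Finset.sum_ite_eq' _ _ _, if_pos (by simp; omega)]
  · intro i _
    simp only [lam]
    split_ifs <;> simp
  · have := hwl 0
    simpa [lam] using this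
  · exact fun i _ _ => hwl i
  · have := hwl M
    simpa [lam, hj.ne'] using this

variable {d N : ℕ} {D : Set (Pt d)} {l σε β : ℝ} {data : Fin N → Pt d × ℝ} {z : Vars d N}

lemma isoKernel_self (k : ℝ → ℝ) (l : ℝ) (x : Pt d) : isoKernel k l x x = k 0 := by
  simp [isoKernel]

lemma isoKernel_symm (k : ℝ → ℝ) (l : ℝ) (x x' : Pt d) :
    isoKernel k l x x' = isoKernel k l x' x := by
  rw [isoKernel, norm_sub_rev, isoKernel]

lemma IsFeasible.ker_eq_kvec (hz : IsFeasible D k l σε M R data z) (hl : 0 < l)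
    (hR : IsBreakpoints D l M R) :
    z.ker = kvec (isoKernel (pwl k M R) l) (fun i => (data i).1) z.point := by
  funext i
  obtain ⟨h0, h1⟩ := (hz.ker_eq i).eq_pwl hR.lt
  rw [hR.zero] at h0
  have : z.dist i = ‖z.point - (data i).1‖ / l := by
    have h2 := hz.dist_eq i
    rw [← div_pow] at h2
    exact (sq_eq_sq₀ h0 (by positivity)).1 h2
  rw [h1, this]; rfl

/-- The objective value of a feasible point is at least the approximated lower confidence bound. -/
lemma IsFeasible.le_objective (hz : IsFeasible D k l σε M R data z) (hl : 0 < l)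
    (hR : IsBreakpoints D l M R) :
    postMean (isoKernel (pwl k M R) l) σε (fun i => (data i).1) (fun i => (data i).2) z.point
      - √β * √(postVar (isoKernel (pwl k M R) l) σε (fun i => (data i).1) z.point)
      ≤ objective β z := by
  have hk := hz.ker_eq_kvec hl hR
  have hm := hz.mean_eq
  have hv := hz.var_le
  rw [hk] at hm hv
  have hv' : z.sd ^ 2 ≤ postVar (isoKernel (pwl k M R) l) σε (fun i => (data i).1) z.point := by
    rw [postVar, isoKernel_self]; exact hv
  have h1 : z.sd ≤ √(postVar (isoKernel (pwl k M R) l) σε (fun i => (data i).1) z.point) :=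
    Real.le_sqrt_of_sq_le hv'
  have h2 := mul_le_mul_of_nonneg_left h1 (Real.sqrt_nonneg β)
  have hm' : z.mean = postMean (isoKernel (pwl k M R) l) σε (fun i => (data i).1)
    (fun i => (data i).2) z.point := hm
  rw [objective, hm']
  linarith

lemma exists_feasible (hl : 0 < l) (hR : IsBreakpoints D l M R) (hdata : ∀ i, (data i).1 ∈ D)
    {g : Pt d} (hg : g ∈ D)
    (hpv : 0 ≤ postVar (isoKernel (pwl k M R) l) σε (fun i => (data i).1) g) :
    ∃ z : Vars d N, IsFeasible D k l σε M R data z ∧ objective β z =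
      postMean (isoKernel (pwl k M R) l) σε (fun i => (data i).1) (fun i => (data i).2) g
      - √β * √(postVar (isoKernel (pwl k M R) l) σε (fun i => (data i).1) g) := by
  have hex : ∀ i, ∃ w lam, PLEncoding k M R (‖g - (data i).1‖ / l)
      (pwl k M R (‖g - (data i).1‖ / l)) w lam := fun i =>
    exists_plEncoding hR.one_le hR.lt (by rw [hR.zero]; positivity)
      (hR.cover g hg _ (hdata i))
  choose w lam hwl using hex
  refine ⟨⟨g, postMean (isoKernel (pwl k M R) l) σε (fun i => (data i).1) (fun i => (data i).2) g,
    √(postVar (isoKernel (pwl k M R) l) σε (fun i => (data i).1) g),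
    fun i => ‖g - (data i).1‖ / l, kvec (isoKernel (pwl k M R) l) (fun i => (data i).1) g,
    w, lam⟩, ⟨hg, rfl, ?_, fun i => div_pow _ _ _, hwl⟩, rfl⟩
  simp only [Real.sq_sqrt hpv]
  rw [postVar, isoKernel_self]
  exact le_rfl

lemma IsOptimal.le (hz : IsOptimal D k l σε M R β data z) (hl : 0 < l)
    (hR : IsBreakpoints D l M R) (hdata : ∀ i, (data i).1 ∈ D) {g : Pt d} (hg : g ∈ D)
    (hpv : 0 ≤ postVar (isoKernel (pwl k M R) l) σε (fun i => (data i).1) g) :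
    postMean (isoKernel (pwl k M R) l) σε (fun i => (data i).1) (fun i => (data i).2) z.point
      - √β * √(postVar (isoKernel (pwl k M R) l) σε (fun i => (data i).1) z.point) ≤
    postMean (isoKernel (pwl k M R) l) σε (fun i => (data i).1) (fun i => (data i).2) g
      - √β * √(postVar (isoKernel (pwl k M R) l) σε (fun i => (data i).1) g) := by
  obtain ⟨z', hz', hobj⟩ := exists_feasible (β := β) hl hR hdata hg hpv
  rw [← hobj]
  exact (hz.1.le_objective hl hR).trans (hz.2 z' hz')

end Program

/-! ### Lipschitz bounds and finite nets -/

section Lipschitz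

variable {d : ℕ} {D : Set (Pt d)}

lemma sum_abs_le_sqrt_mul_norm (v : Pt d) : ∑ j, |v j| ≤ √d * ‖v‖ := by
  have h := Finset.sum_mul_sq_le_sq_mul_sq Finset.univ (fun _ : Fin d => (1 : ℝ)) (fun j => |v j|)
  rw [EuclideanSpace.norm_eq, ← Real.sqrt_mul (Nat.cast_nonneg d)]
  refine Real.le_sqrt_of_sq_le ?_
  simpa using h

lemma abs_sub_le_of_partial_le {g : Pt d → ℝ} (hD : Convex ℝ D) (hg : DifferentiableOn ℝ g D)
    {L : ℝ} (hL : ∀ j, ∀ x ∈ D, |fderivWithin ℝ g D x (EuclideanSpace.single j 1)| ≤ L)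
    (hL0 : 0 ≤ L) {x x' : Pt d} (hx : x ∈ D) (hx' : x' ∈ D) :
    |g x - g x'| ≤ L * √d * ‖x - x'‖ := by
  refine hD.norm_image_sub_le_of_norm_fderivWithin_le hg (fun z hz => ?_) hx' hx
  refine ContinuousLinearMap.opNorm_le_bound _ (by positivity) fun v => ?_
  have e : v = ∑ j, v j • EuclideanSpace.single j (1 : ℝ) := by
    ext i
    simp [Pi.single_apply]
  calc ‖fderivWithin ℝ g D z v‖
      = |∑ j, v j * fderivWithin ℝ g D z (EuclideanSpace.single j 1)| := by
        conv_lhs => rw [e]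
        simp only [map_sum, map_smul, smul_eq_mul, Real.norm_eq_abs]
    _ ≤ ∑ j, |v j * fderivWithin ℝ g D z (EuclideanSpace.single j 1)| :=
        Finset.abs_sum_le_sum_abs _ _
    _ ≤ ∑ j, |v j| * L := Finset.sum_le_sum fun j _ => by
        rw [abs_mul]; exact mul_le_mul_of_nonneg_left (hL j z hz) (abs_nonneg _)
    _ = L * ∑ j, |v j| := by rw [← Finset.sum_mul, mul_comm]
    _ ≤ L * (√d * ‖v‖) := mul_le_mul_of_nonneg_left (sum_abs_le_sqrt_mul_norm v) hL0
    _ = _ := by ring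

lemma exists_nonexpansive_proj (hDc : IsCompact D) (hD : Convex ℝ D) (hne : D.Nonempty)
    (g : Pt d) : ∃ p ∈ D, ∀ x ∈ D, ‖x - p‖ ≤ ‖x - g‖ := by
  obtain ⟨p, hp, hpg⟩ := exists_norm_eq_iInf_of_complete_convex hne hDc.isComplete hD g
  refine ⟨p, hp, fun x hx => ?_⟩
  have h := (norm_eq_iInf_iff_real_inner_le_zero hD hp).1 hpg x hx
  have e : x - g = (x - p) - (g - p) := by abel
  refine le_of_sq_le_sq ?_ (norm_nonneg _)
  have h2 := norm_sub_sq_real (x - p) (g - p)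
  rw [real_inner_comm] at h2
  rw [e, h2]
  nlinarith [sq_nonneg ‖g - p‖]

lemma exists_grid_near {r : ℝ} (hr : 0 < r) {n : ℕ} (hn : 1 ≤ n) {t : ℝ} (h0 : 0 ≤ t)
    (h1 : t ≤ r) : ∃ i : Fin n, |t - (2 * (i : ℝ) + 1) * (r / (2 * n))| ≤ r / (2 * n) := by
  have hn0 : (0 : ℝ) < n := by exact_mod_cast hn
  set q := r / (2 * n) with hq
  have hq0 : 0 < q := by positivity
  have hr2 : r = 2 * n * q := by rw [hq]; field_simp
  rcases h1.eq_or_lt with rfl | h1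
  · refine ⟨⟨n - 1, by omega⟩, ?_⟩
    have : ((n - 1 : ℕ) : ℝ) = n - 1 := by push_cast [hn]; ring
    simp only [this]
    rw [abs_le]
    constructor <;> nlinarith
  · have hfl : 0 ≤ t / (2 * q) := by positivity
    have hlt : ⌊t / (2 * q)⌋₊ < n := by
      rw [Nat.floor_lt hfl, div_lt_iff₀ (by positivity)]
      nlinarith
    refine ⟨⟨⌊t / (2 * q)⌋₊, hlt⟩, ?_⟩
    have a1 := Nat.floor_le hfl
    have a2 := Nat.lt_floor_add_one (t / (2 * q))
    rw [le_div_iff₀ (by positivity)] at a1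
    rw [div_lt_iff₀ (by positivity)] at a2
    rw [abs_le]
    constructor <;> nlinarith

/-- A net of `n ^ d` points of `D`. -/
lemma exists_net (hDc : IsCompact D) (hD : Convex ℝ D) (hne : D.Nonempty) {r : ℝ} (hr : 0 < r)
    (hDr : ∀ x ∈ D, ∀ j, 0 ≤ x j ∧ x j ≤ r) {n : ℕ} (hn : 1 ≤ n) :
    ∃ S : (Fin d → Fin n) → Pt d, (∀ i, S i ∈ D) ∧
      ∀ x ∈ D, ∃ i, ‖x - S i‖ ≤ √d * (r / (2 * n)) := by
  let c : (Fin d → Fin n) → Pt d := fun i =>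
    WithLp.toLp 2 fun j => (2 * ((i j : ℕ) : ℝ) + 1) * (r / (2 * n))
  choose p hp hpx using exists_nonexpansive_proj hDc hD hne
  refine ⟨fun i => p (c i), fun i => hp _, fun x hx => ?_⟩
  choose i hi using fun j => exists_grid_near hr hn (hDr x hx j).1 (hDr x hx j).2
  refine ⟨i, (hpx (c i) x hx).trans ?_⟩
  have hn0 : (0 : ℝ) < n := by exact_mod_cast hn
  have hq : 0 ≤ r / (2 * n) := by positivity
  rw [EuclideanSpace.norm_eq, ← Real.sqrt_sq hq, ← Real.sqrt_mul (Nat.cast_nonneg d)]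
  refine Real.sqrt_le_sqrt ?_
  calc ∑ j, ‖(x - c i) j‖ ^ 2 ≤ ∑ _j : Fin d, (r / (2 * n)) ^ 2 :=
        Finset.sum_le_sum fun j _ => pow_le_pow_left₀ (norm_nonneg _) (hi j) 2
    _ = _ := by simp

end Lipschitz

section DerivTail

variable {d : ℕ} {Ω : Type*} [MeasurableSpace Ω] {P : Measure Ω} {D : Set (Pt d)} {a b : ℝ}
  {f : Ω → Pt d → ℝ}

lemma HasDerivTail.tail_of_nonneg (h : HasDerivTail P D a b f) (ha : 0 < a) (j : Fin d) {L : ℝ}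
    (hL : 0 ≤ L) :
    P {ω | ∃ x ∈ D, L < |fderivWithin ℝ (f ω) D x (EuclideanSpace.single j 1)|}
      ≤ ENNReal.ofReal (a * Real.exp (-(L / b) ^ 2)) := by
  rcases hL.eq_or_lt with rfl | hL
  swap
  · exact h.tail j L hL
  set s : ℕ → Set Ω := fun n =>
    {ω | ∃ x ∈ D, 1 / ((n : ℝ) + 1) < |fderivWithin ℝ (f ω) D x (EuclideanSpace.single j 1)|}
  have hs : Monotone s := fun m n hmn ω ⟨x, hx, hlt⟩ =>
    ⟨x, hx, lt_of_le_of_lt (one_div_le_one_div_of_le (by positivity)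
      (by have : (m : ℝ) ≤ n := by exact_mod_cast hmn
          linarith)) hlt⟩
  have e : {ω | ∃ x ∈ D, 0 < |fderivWithin ℝ (f ω) D x (EuclideanSpace.single j 1)|}
      = ⋃ n, s n := by
    ext ω
    simp only [Set.mem_ofPred_eq, Set.mem_iUnion, s]
    constructor
    · rintro ⟨x, hx, hlt⟩
      obtain ⟨n, hn⟩ := exists_nat_one_div_lt hlt
      exact ⟨n, x, hx, hn⟩
    · rintro ⟨n, x, hx, hlt⟩
      exact ⟨x, hx, lt_trans (by positivity) hlt⟩
  rw [e, hs.measure_iUnion]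
  refine iSup_le fun n => (h.tail j _ (by positivity)).trans (ENNReal.ofReal_le_ofReal ?_)
  refine mul_le_mul_of_nonneg_left (Real.exp_le_exp.2 ?_) ha.le
  simp only [zero_div]
  nlinarith [sq_nonneg (1 / ((n : ℝ) + 1) / b)]

/-- The bound on the partial derivatives that holds with probability `1 - δ / 4`. -/
def lipConst (d : ℕ) (a b δ : ℝ) : ℝ := b * √(Real.log (4 * d * a / δ))

lemma HasDerivTail.measure_lipConst_le (h : HasDerivTail P D a b f) (ha : 0 < a) (hb : 0 < b)
    {δ : ℝ} (hδ : 0 < δ) (hd : 1 ≤ d) :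
    P {ω | ∃ j, ∃ x ∈ D, lipConst d a b δ
      < |fderivWithin ℝ (f ω) D x (EuclideanSpace.single j 1)|} ≤ ENNReal.ofReal (δ / 4) := by
  have hL : 0 ≤ lipConst d a b δ := mul_nonneg hb.le (Real.sqrt_nonneg _)
  have hd0 : (0 : ℝ) < d := by exact_mod_cast hd
  have e : {ω | ∃ j, ∃ x ∈ D, lipConst d a b δ
      < |fderivWithin ℝ (f ω) D x (EuclideanSpace.single j 1)|} =
      ⋃ j : Fin d, {ω | ∃ x ∈ D, lipConst d a b δ
      < |fderivWithin ℝ (f ω) D x (EuclideanSpace.single j 1)|} := by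
    ext ω; simp
  rw [e]
  refine (measure_iUnion_fintype_le P _).trans ?_
  refine (Finset.sum_le_sum fun j _ => h.tail_of_nonneg ha j hL).trans ?_
  rw [← ENNReal.ofReal_sum_of_nonneg fun _ _ => by positivity]
  refine ENNReal.ofReal_le_ofReal ?_
  simp only [Finset.sum_const, Finset.card_univ, Fintype.card_fin, nsmul_eq_mul]
  have e2 : lipConst d a b δ / b = √(Real.log (4 * d * a / δ)) := by
    rw [lipConst]; field_simp
  have hpos : 0 < 4 * d * a / δ := by positivity
  rw [e2]
  rcases le_total 0 (Real.log (4 * d * a / δ)) with h0 | h0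
  · rw [Real.sq_sqrt h0, Real.exp_neg, Real.exp_log hpos]
    apply le_of_eq
    field_simp
  · rw [Real.sqrt_eq_zero_of_nonpos h0]
    have h1 := (Real.log_nonpos_iff hpos.le).1 h0
    rw [div_le_one hδ] at h1
    simp
    linarith

end DerivTail

/-! ### The error of the approximated posterior -/

section Approximation

/-- The constant in the error of the approximated posterior mean. -/
def meanErrConst (σf σε : ℝ) : ℝ := 2 / σε ^ 2 * (1 + σf / σε)

/-- The constant in the error of the approximated posterior variance. -/
def varErrConst (σf σε : ℝ) : ℝ :=
  (1 + 2 * (σf / σε)) + σf / σε + σf / σε * (1 + 2 * (σf / σε))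

/-- If `t² ε_t` is at most this threshold, then the approximated program is well posed. -/
def errThreshold (σf σε : ℝ) : ℝ :=
  min (σε ^ 2 / 2) (min (σf ^ 2 / (2 * varErrConst σf σε)) (σε ^ 2 / (4 * varErrConst σf σε)))

variable {σf σε : ℝ}

lemma meanErrConst_pos (hσf : 0 < σf) (hσε : 0 < σε) : 0 < meanErrConst σf σε := by
  unfold meanErrConst; positivity

lemma varErrConst_pos (hσf : 0 < σf) (hσε : 0 < σε) : 0 < varErrConst σf σε := by
  unfold varErrConst; positivity

lemma errThreshold_pos (hσf : 0 < σf) (hσε : 0 < σε) : 0 < errThreshold σf σε := by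
  have := varErrConst_pos hσf hσε
  unfold errThreshold
  refine lt_min (by positivity) (lt_min (by positivity) (by positivity))

variable {d N : ℕ} {D : Set (Pt d)} {K K' : Pt d → Pt d → ℝ} {X : Fin N → Pt d} {z : Pt d} {ε : ℝ}

lemma noisyGram_isSymm_of_symm (hK' : ∀ x x', K' x x' = K' x' x) :
    (noisyGram K' σε X).IsSymm := by
  refine Matrix.IsSymm.add ?_ (by simp [Matrix.IsSymm])
  ext i j; exact hK' _ _

lemma IsPosKernel.posterior_perturbation (hK : IsPosKernel D K) (hσf : 0 < σf) (hσε : 0 < σε)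
    (hdiag : ∀ x ∈ D, K x x = σf ^ 2) (hX : ∀ i, X i ∈ D) (hz : z ∈ D)
    (hK's : ∀ x x', K' x x' = K' x' x) (hε : 0 ≤ ε)
    (hKK : ∀ x ∈ D, ∀ x' ∈ D, |K' x x' - K x x'| ≤ ε) (hKz : K' z z = K z z)
    (hsmall : N * ε ≤ σε ^ 2 / 2) (y : Fin N → ℝ) :
    |postMean K' σε X y z - postMean K σε X y z| ≤ meanErrConst σf σε * (N * ε) * l2norm y ∧
    |postVar K' σε X z - postVar K σε X z| ≤ varErrConst σf σε * (N * ε) := by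
  obtain ⟨-, h1, h2⟩ := perturbation (A := noisyGram K σε X) (A' := noisyGram K' σε X)
    (k := kvec K X z) (k' := kvec K' X z) (m := σε ^ 2) (s := σf / σε) (by positivity) hε
    (hK.noisyGram_isSymm hX) (hK.coercive hX)
    (fun i j => by
      simp only [noisyGram, gram, Matrix.add_apply, Matrix.of_apply]
      rw [add_sub_add_right_eq_sub]
      exact hKK _ (hX i) _ (hX j))
    (fun i => hKK _ hz _ (hX i)) (by simpa using hsmall)
    (hK.l2norm_gainVec_le hσε hσf hdiag hX hz) (by positivity)
  rw [Fintype.card_fin] at h1 h2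
  constructor
  · have e1 : postMean K' σε X y z = gainVec K' σε X z ⬝ᵥ y := by
      rw [postMean, dotProduct_mulVec_symm (isSymm_inv (noisyGram_isSymm_of_symm hK's)),
        dotProduct_comm, gainVec]
    rw [e1, hK.postMean_eq hX, ← sub_dotProduct]
    exact (abs_dotProduct_le _ _).trans (mul_le_mul_of_nonneg_right h1 (l2norm_nonneg y))
  · rw [postVar, postVar, hKz, sub_sub_sub_cancel_left, abs_sub_comm]
    exact h2

lemma sqrt_le_sqrt_add_sqrt {a b c : ℝ} (hb : 0 ≤ b) (hc : 0 ≤ c) (h : a ≤ b + c) :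
    √a ≤ √b + √c := by
  refine Real.sqrt_le_iff.2 ⟨by positivity, ?_⟩
  have := mul_nonneg (Real.sqrt_nonneg b) (Real.sqrt_nonneg c)
  nlinarith [Real.sq_sqrt hb, Real.sq_sqrt hc]

/-- If `ε` is small, then the approximated posterior variance is nonnegative. -/
lemma IsPosKernel.varErr_le_postVar (hK : IsPosKernel D K) (hσf : 0 < σf) (hσε : 0 < σε)
    (hdiag : ∀ x ∈ D, K x x = σf ^ 2) (hX : ∀ i, X i ∈ D) (hz : z ∈ D) (hε : 0 ≤ ε)
    (hgood : ((N : ℝ) + 1) ^ 2 * ε ≤ errThreshold σf σε) :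
    varErrConst σf σε * (N * ε) ≤ postVar K σε X z := by
  have hV := varErrConst_pos hσf hσε
  have hN : (0 : ℝ) ≤ N := Nat.cast_nonneg N
  have h1 : ((N : ℝ) + 1) ^ 2 * ε ≤ σf ^ 2 / (2 * varErrConst σf σε) :=
    hgood.trans ((min_le_right _ _).trans (min_le_left _ _))
  have h2 : ((N : ℝ) + 1) ^ 2 * ε ≤ σε ^ 2 / (4 * varErrConst σf σε) :=
    hgood.trans ((min_le_right _ _).trans (min_le_right _ _))
  rw [le_div_iff₀ (by positivity)] at h1 h2
  have hNε : 0 ≤ N * ε := mul_nonneg hN hε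
  have a1 : (N : ℝ) * ε ≤ ((N : ℝ) + 1) ^ 2 * ε :=
    mul_le_mul_of_nonneg_right (by nlinarith) hε
  have a2 : (N : ℝ) * (N * ε) ≤ ((N : ℝ) + 1) ^ 2 * ε := by
    rw [← mul_assoc]; exact mul_le_mul_of_nonneg_right (by nlinarith) hε
  rcases hK.postVar_lower hσε hdiag hX hz with h | h
  · have := mul_le_mul_of_nonneg_left a1 hV.le
    linarith
  · rcases Nat.eq_zero_or_pos N with rfl | hN0
    · simpa using hK.postVar_nonneg hσε hX hz
    · have hN1 : (0 : ℝ) < N := by exact_mod_cast hN0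
      have := mul_le_mul_of_nonneg_left a2 hV.le
      have h3 : N * (varErrConst σf σε * (N * ε)) ≤ N * postVar K σε X z := by nlinarith
      exact le_of_mul_le_mul_left h3 hN1

end Approximation

/-! ### The regret of one round -/

section Round

variable {σf σε : ℝ} {d N : ℕ} {D : Set (Pt d)} {k : ℝ → ℝ} {l : ℝ} {M : ℕ} {R : ℕ → ℝ} {ε : ℝ}
  {data : Fin N → Pt d × ℝ} {z : Vars d N} {β : ℝ}

lemma isoKernel_pwl_sub_le (hl : 0 < l) (hR : IsBreakpoints D l M R)
    (hε : ∀ ρ ∈ Set.Icc 0 (R M), |k ρ - pwl k M R ρ| ≤ ε) {x x' : Pt d} (hx : x ∈ D)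
    (hx' : x' ∈ D) : |isoKernel (pwl k M R) l x x' - isoKernel k l x x'| ≤ ε := by
  rw [abs_sub_comm]
  exact hε _ ⟨by positivity, hR.cover x hx x' hx'⟩

lemma pwl_zero (hR : IsBreakpoints D l M R) : pwl k M R 0 = k 0 := by
  have h := pwl_segment (k := k) (ρ := 0) hR.lt hR.one_le hR.zero.le
    (by have := hR.lt 0 hR.one_le; rw [hR.zero] at this; exact this.le)
  rw [h, hR.zero]; simp

/-- The regret of a round in which the approximation is accurate, given confidence bounds at the
query and at a point `g` that competes with it. -/
lemma IsOptimal.regret_le (hz : IsOptimal D k l σε M R β data z) (hσf : 0 < σf) (hσε : 0 < σε)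
    (hl : 0 < l) (hK : IsPosKernel D (isoKernel k l)) (hk0 : k 0 = σf ^ 2)
    (hR : IsBreakpoints D l M R)
    (hε : ∀ ρ ∈ Set.Icc 0 (R M), |k ρ - pwl k M R ρ| ≤ ε) (hε0 : 0 ≤ ε)
    (hgood : ((N : ℝ) + 1) ^ 2 * ε ≤ errThreshold σf σε) (hdata : ∀ i, (data i).1 ∈ D)
    {g : Pt d} (hg : g ∈ D) {φ : Pt d → ℝ}
    (hup : φ z.point ≤ postMean (isoKernel k l) σε (fun i => (data i).1) (fun i => (data i).2)
      z.point + √β * √(postVar (isoKernel k l) σε (fun i => (data i).1) z.point))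
    (hlow : postMean (isoKernel k l) σε (fun i => (data i).1) (fun i => (data i).2) g
      - √β * √(postVar (isoKernel k l) σε (fun i => (data i).1) g) ≤ φ g) :
    φ z.point - φ g ≤ 2 * √β * √(postVar (isoKernel k l) σε (fun i => (data i).1) z.point)
      + 2 * (meanErrConst σf σε * (N * ε) * l2norm fun i => (data i).2)
      + 2 * (√β * √(varErrConst σf σε * (N * ε))) := by
  set K := isoKernel k l with hKdef
  set K' := isoKernel (pwl k M R) l with hK'def
  set X : Fin N → Pt d := fun i => (data i).1
  set y : Fin N → ℝ := fun i => (data i).2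
  have hN : (0 : ℝ) ≤ N := Nat.cast_nonneg N
  have hdiag : ∀ x ∈ D, K x x = σf ^ 2 := fun x _ => by rw [hKdef, isoKernel_self, hk0]
  have hsmall : N * ε ≤ σε ^ 2 / 2 :=
    (mul_le_mul_of_nonneg_right (by nlinarith) hε0).trans (hgood.trans (min_le_left _ _))
  have hKK : ∀ x ∈ D, ∀ x' ∈ D, |K' x x' - K x x'| ≤ ε := fun x hx x' hx' =>
    isoKernel_pwl_sub_le hl hR hε hx hx'
  have hKz : ∀ p, K' p p = K p p := fun p => by
    rw [hKdef, hK'def, isoKernel_self, isoKernel_self, pwl_zero hR]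
  have hpt := hz.1.point_mem
  obtain ⟨m1, v1⟩ := hK.posterior_perturbation hσf hσε hdiag hdata hpt
    (isoKernel_symm _ _) hε0 hKK (hKz _) hsmall y
  obtain ⟨m2, v2⟩ := hK.posterior_perturbation hσf hσε hdiag hdata hg
    (isoKernel_symm _ _) hε0 hKK (hKz _) hsmall y
  have hVe : 0 ≤ varErrConst σf σε * (N * ε) :=
    mul_nonneg (varErrConst_pos hσf hσε).le (mul_nonneg hN hε0)
  have hpv := hK.varErr_le_postVar hσf hσε hdiag hdata hg hε0 hgood
  have hpv' : 0 ≤ postVar K' σε X g := by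
    have := (abs_le.1 v2).1
    have h4 : varErrConst σf σε * (N * ε) ≤ postVar K σε X g := hpv
    linarith
  have hopt := hz.le hl hR hdata hg hpv'
  have s1 : √(postVar K' σε X z.point)
      ≤ √(postVar K σε X z.point) + √(varErrConst σf σε * (N * ε)) :=
    sqrt_le_sqrt_add_sqrt (hK.postVar_nonneg hσε hdata hpt) hVe
      (by have := (abs_le.1 v1).2; linarith)
  have s2 : √(postVar K σε X g) ≤ √(postVar K' σε X g) + √(varErrConst σf σε * (N * ε)) :=
    sqrt_le_sqrt_add_sqrt hpv' hVe (by have := (abs_le.1 v2).1; linarith)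
  have b1 := mul_le_mul_of_nonneg_left s1 (Real.sqrt_nonneg β)
  have b2 := mul_le_mul_of_nonneg_left s2 (Real.sqrt_nonneg β)
  have m1' := (abs_le.1 m1).1
  have m2' := (abs_le.1 m2).2
  have hopt' : postMean K' σε X y z.point - √β * √(postVar K' σε X z.point)
    ≤ postMean K' σε X y g - √β * √(postVar K' σε X g) := hopt
  nlinarith

end Round

/-! ### Information gain -/

section InfoGain

variable {σf σε : ℝ} {d : ℕ} {D : Set (Pt d)} {K : Pt d → Pt d → ℝ}

/-- The posterior variance at the next point of a sequence. -/
def seqVar (K : Pt d → Pt d → ℝ) (σε : ℝ) (X : ℕ → Pt d) (n : ℕ) : ℝ :=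
  postVar K σε (fun i : Fin n => X i) (X n)

lemma IsPosKernel.seqVar_nonneg (hK : IsPosKernel D K) (hσε : 0 < σε) {X : ℕ → Pt d}
    (hX : ∀ n, X n ∈ D) (n : ℕ) : 0 ≤ seqVar K σε X n :=
  hK.postVar_nonneg hσε (fun i => hX i) (hX n)

lemma IsPosKernel.seqVar_le (hK : IsPosKernel D K) (hσε : 0 < σε)
    (hdiag : ∀ x ∈ D, K x x = σf ^ 2) {X : ℕ → Pt d} (hX : ∀ n, X n ∈ D) (n : ℕ) :
    seqVar K σε X n ≤ σf ^ 2 :=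
  (hK.postVar_le hσε fun i => hX i).trans (hdiag _ (hX n)).le

lemma det_noisyGram_eq (hσε : 0 < σε) {N : ℕ} (X : Fin N → Pt d) :
    (noisyGram K σε X).det = (σε ^ 2) ^ N * (1 + (σε ^ 2)⁻¹ • gram K X).det := by
  have e : noisyGram K σε X = σε ^ 2 • (1 + (σε ^ 2)⁻¹ • gram K X) := by
    rw [smul_add, smul_smul, mul_inv_cancel₀ (by positivity), one_smul, add_comm, noisyGram]
  rw [e, Matrix.det_smul, Fintype.card_fin]

lemma IsPosKernel.det_one_add (hK : IsPosKernel D K) (hσε : 0 < σε) {X : ℕ → Pt d}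
    (hX : ∀ n, X n ∈ D) (T : ℕ) :
    (1 + (σε ^ 2)⁻¹ • gram K fun i : Fin T => X i).det
      = ∏ n ∈ Finset.range T, (1 + seqVar K σε X n / σε ^ 2) := by
  induction T with
  | zero => simp
  | succ T ih =>
    have h := hK.det_noisyGram_snoc hσε (X := fun i : Fin T => X i) (z := X T) (fun i => hX i)
      (hX T)
    have e : (Fin.snoc (fun i : Fin T => X i) (X T) : Fin (T + 1) → Pt d)
        = fun i : Fin (T + 1) => X i := by
      funext i
      refine Fin.lastCases ?_ (fun i => ?_) i
      · simp
      · simp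
    have hc : (0 : ℝ) < (σε ^ 2) ^ (T + 1) := by positivity
    rw [e, det_noisyGram_eq hσε, det_noisyGram_eq hσε, ih] at h
    rw [Finset.prod_range_succ]
    refine mul_left_cancel₀ hc.ne' (h.trans ?_)
    change (σε ^ 2) ^ T * _ * (σε ^ 2 + seqVar K σε X T) = _
    generalize seqVar K σε X T = v
    generalize ∏ n ∈ Finset.range T, (1 + seqVar K σε X n / σε ^ 2) = p
    field_simp
    ring

lemma IsPosKernel.infoGain_eq (hK : IsPosKernel D K) (hσε : 0 < σε) {X : ℕ → Pt d}
    (hX : ∀ n, X n ∈ D) (T : ℕ) :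
    infoGain K σε (fun i : Fin T => X i)
      = 1 / 2 * ∑ n ∈ Finset.range T, Real.log (1 + seqVar K σε X n / σε ^ 2) := by
  rw [infoGain, hK.det_one_add hσε hX, Real.log_prod]
  intro n _
  have := div_nonneg (hK.seqVar_nonneg hσε hX n) (sq_nonneg σε)
  linarith

lemma exists_extension {T : ℕ} {p : Pt d} (hp : p ∈ D) (X : Fin T → D) :
    ∃ X' : ℕ → Pt d, (∀ n, X' n ∈ D) ∧ (fun i => (X i : Pt d)) = fun i : Fin T => X' i := by
  refine ⟨fun n => if h : n < T then X ⟨n, h⟩ else p, fun n => ?_, ?_⟩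
  · dsimp only
    split_ifs
    · exact (X _).2
    · exact hp
  · funext i
    simp

lemma IsPosKernel.infoGain_le_maxInfoGain (hK : IsPosKernel D K) (hσε : 0 < σε)
    (hdiag : ∀ x ∈ D, K x x = σf ^ 2) {X : ℕ → Pt d} (hX : ∀ n, X n ∈ D) (T : ℕ) :
    infoGain K σε (fun i : Fin T => X i) ≤ maxInfoGain D K σε T := by
  have hb : BddAbove (Set.range fun X : Fin T → D => infoGain K σε fun i => (X i : Pt d)) := by
    refine ⟨1 / 2 * ∑ n ∈ Finset.range T, Real.log (1 + σf ^ 2 / σε ^ 2), ?_⟩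
    rintro _ ⟨Y, rfl⟩
    obtain ⟨Y', hY', e⟩ := exists_extension (hX 0) Y
    dsimp only
    rw [e, hK.infoGain_eq hσε hY']
    refine mul_le_mul_of_nonneg_left (Finset.sum_le_sum fun n _ => Real.log_le_log ?_ ?_)
      (by norm_num)
    · have := div_nonneg (hK.seqVar_nonneg hσε hY' n) (sq_nonneg σε)
      linarith
    · have := div_le_div_of_nonneg_right (hK.seqVar_le hσε hdiag hY' n) (sq_nonneg σε)
      linarith
  exact le_ciSup hb fun i => ⟨X i, hX i⟩

lemma log_one_add_pos (hσf : 0 < σf) (hσε : 0 < σε) : 0 < Real.log (1 + σf ^ 2 / σε ^ 2) :=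
  Real.log_pos (by have : 0 < σf ^ 2 / σε ^ 2 := by positivity
                   linarith)

lemma le_log_one_add (hσf : 0 < σf) (hσε : 0 < σε) {v : ℝ} (h0 : 0 ≤ v) (h1 : v ≤ σf ^ 2) :
    v ≤ σf ^ 2 / Real.log (1 + σf ^ 2 / σε ^ 2) * Real.log (1 + v / σε ^ 2) := by
  have hu : 0 < σf ^ 2 / σε ^ 2 := by positivity
  have hs : 0 ≤ v / σf ^ 2 := by positivity
  have h := Real.log_le_log (Real.rpow_pos_of_pos (by linarith) _)
    (rpow_one_add_le_one_add_mul_self (s := σf ^ 2 / σε ^ 2) (by linarith) hs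
      ((div_le_one (by positivity)).2 h1))
  rw [Real.log_rpow (by linarith)] at h
  have e : v / σf ^ 2 * (σf ^ 2 / σε ^ 2) = v / σε ^ 2 := by field_simp
  rw [e] at h
  have hl := log_one_add_pos hσf hσε
  rw [div_mul_eq_mul_div, le_div_iff₀ hl]
  have h2 := mul_le_mul_of_nonneg_left h (sq_nonneg σf)
  refine le_trans (le_of_eq ?_) h2
  field_simp

lemma IsPosKernel.sum_seqVar_le (hK : IsPosKernel D K) (hσf : 0 < σf) (hσε : 0 < σε)
    (hdiag : ∀ x ∈ D, K x x = σf ^ 2) {X : ℕ → Pt d} (hX : ∀ n, X n ∈ D) (T : ℕ) :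
    4 * ∑ n ∈ Finset.range T, seqVar K σε X n ≤ constC1 σf σε * maxInfoGain D K σε T := by
  have hl := log_one_add_pos hσf hσε
  have h1 := hK.infoGain_le_maxInfoGain hσε hdiag hX T
  rw [hK.infoGain_eq hσε hX] at h1
  have h2 : ∑ n ∈ Finset.range T, seqVar K σε X n ≤ σf ^ 2 / Real.log (1 + σf ^ 2 / σε ^ 2) *
      ∑ n ∈ Finset.range T, Real.log (1 + seqVar K σε X n / σε ^ 2) := by
    rw [Finset.mul_sum]
    exact Finset.sum_le_sum fun n _ =>
      le_log_one_add hσf hσε (hK.seqVar_nonneg hσε hX n) (hK.seqVar_le hσε hdiag hX n)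
  have hc : 0 < σf ^ 2 / Real.log (1 + σf ^ 2 / σε ^ 2) := by positivity
  have h3 := mul_le_mul_of_nonneg_left h1 hc.le
  have e : constC1 σf σε = 8 * (σf ^ 2 / Real.log (1 + σf ^ 2 / σε ^ 2)) := by
    rw [constC1]; ring
  rw [e]
  nlinarith

/-- The maximal information gain is at least that of a single observation. -/
lemma IsPosKernel.le_maxInfoGain (hK : IsPosKernel D K) (hσε : 0 < σε)
    (hdiag : ∀ x ∈ D, K x x = σf ^ 2) {p : Pt d} (hp : p ∈ D) {T : ℕ} (hT : 1 ≤ T) :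
    1 / 2 * Real.log (1 + σf ^ 2 / σε ^ 2) ≤ maxInfoGain D K σε T := by
  refine le_trans ?_ (hK.infoGain_le_maxInfoGain hσε hdiag (X := fun _ => p) (fun _ => hp) T)
  rw [hK.infoGain_eq hσε fun _ => hp]
  refine mul_le_mul_of_nonneg_left ?_ (by norm_num)
  have h := Finset.single_le_sum (s := Finset.range T)
    (f := fun n => Real.log (1 + seqVar K σε (fun _ => p) n / σε ^ 2)) (fun n _ =>
      Real.log_nonneg (by
        have := div_nonneg (hK.seqVar_nonneg hσε (X := fun _ => p) (fun _ => hp) n) (sq_nonneg σε)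
        linarith)) (Finset.mem_range.2 hT)
  refine le_trans (le_of_eq ?_) h
  simp [seqVar, postVar, hdiag p hp]

/-- The sum of the confidence widths. -/
lemma IsPosKernel.sum_sqrt_seqVar_le (hK : IsPosKernel D K) (hσf : 0 < σf) (hσε : 0 < σε)
    (hdiag : ∀ x ∈ D, K x x = σf ^ 2) {X : ℕ → Pt d} (hX : ∀ n, X n ∈ D) (T : ℕ) {β : ℝ} :
    ∑ n ∈ Finset.range T, 2 * √β * √(seqVar K σε X n)
      ≤ √(constC1 σf σε * T * β * maxInfoGain D K σε T) := by
  rcases lt_or_ge β 0 with hβ | hβ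
  · simp [Real.sqrt_eq_zero_of_nonpos hβ.le]
  refine Real.le_sqrt_of_sq_le ?_
  have h := sq_sum_le_card_mul_sum_sq (s := Finset.range T)
    (f := fun n => 2 * √β * √(seqVar K σε X n))
  refine h.trans ?_
  have e : ∑ n ∈ Finset.range T, (2 * √β * √(seqVar K σε X n)) ^ 2
      = β * (4 * ∑ n ∈ Finset.range T, seqVar K σε X n) := by
    rw [Finset.mul_sum, Finset.mul_sum]
    refine Finset.sum_congr rfl fun n _ => ?_
    rw [mul_pow, mul_pow, Real.sq_sqrt hβ, Real.sq_sqrt (hK.seqVar_nonneg hσε hX n)]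
    ring
  rw [e, Finset.card_range]
  have h2 := mul_le_mul_of_nonneg_left (hK.sum_seqVar_le hσf hσε hdiag hX T)
    (mul_nonneg (Nat.cast_nonneg T) hβ)
  nlinarith

end InfoGain

/-! ### The exploration parameter -/

section Beta

variable {d : ℕ} {r a b δ : ℝ}

/-- The number of net points per unit of `1 / t²`, as it occurs in `β_t`. -/
def netScale (d : ℕ) (r a b δ : ℝ) (t : ℕ) : ℝ :=
  (t : ℝ) ^ 2 * d * b * r * √(Real.log (4 * d * a / δ))

lemma netScale_eq (t : ℕ) :
    netScale d r a b δ t = (t : ℝ) ^ 2 * (d * r * lipConst d a b δ) := by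
  rw [netScale, lipConst]; ring

lemma beta_eq (t : ℕ) : beta d r a b δ t =
    2 * Real.log (2 * (t : ℝ) ^ 2 * Real.pi ^ 2 / (3 * δ)) +
      2 * d * Real.log (netScale d r a b δ t) := rfl

lemma lipConst_nonneg (hb : 0 < b) : 0 ≤ lipConst d a b δ := mul_nonneg hb.le (Real.sqrt_nonneg _)

lemma netScale_nonneg (hr : 0 < r) (hb : 0 < b) (t : ℕ) : 0 ≤ netScale d r a b δ t := by
  have := lipConst_nonneg (d := d) (a := a) (δ := δ) hb
  rw [netScale_eq]; positivity

lemma netScale_mono (hr : 0 < r) (hb : 0 < b) {s t : ℕ} (hst : s ≤ t) :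
    netScale d r a b δ s ≤ netScale d r a b δ t := by
  have := lipConst_nonneg (d := d) (a := a) (δ := δ) hb
  rw [netScale_eq, netScale_eq]
  gcongr

lemma one_lt_confidence_arg (hδ : 0 < δ) (hδ1 : δ < 1) {t : ℕ} (ht : 1 ≤ t) :
    1 < 2 * (t : ℝ) ^ 2 * Real.pi ^ 2 / (3 * δ) := by
  have ht' : (1 : ℝ) ≤ t := by exact_mod_cast ht
  have := Real.pi_gt_three
  rw [lt_div_iff₀ (by positivity)]
  have h1 : (1 : ℝ) ≤ (t : ℝ) ^ 2 := by nlinarith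
  nlinarith [mul_le_mul h1 (by nlinarith : (9 : ℝ) ≤ Real.pi ^ 2) (by norm_num) (by positivity)]

lemma beta_nonneg (hδ : 0 < δ) (hδ1 : δ < 1) {t : ℕ} (ht : 1 ≤ t)
    (hτ : 1 < netScale d r a b δ t) : 0 ≤ beta d r a b δ t := by
  have h1 := Real.log_pos (one_lt_confidence_arg hδ hδ1 ht)
  have h2 := Real.log_pos hτ
  rw [beta_eq]; positivity

lemma beta_mono (hr : 0 < r) (hb : 0 < b) (hδ : 0 < δ) {s t : ℕ} (hs : 1 ≤ s) (hst : s ≤ t)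
    (hτ : 1 < netScale d r a b δ s) : beta d r a b δ s ≤ beta d r a b δ t := by
  have hs' : (0 : ℝ) < s := by exact_mod_cast hs
  have hst' : (s : ℝ) ≤ t := by exact_mod_cast hst
  have := Real.pi_pos
  have h2 := Real.log_le_log (by linarith) (netScale_mono (d := d) (a := a) (δ := δ) hr hb hst)
  have h1 : Real.log (2 * (s : ℝ) ^ 2 * Real.pi ^ 2 / (3 * δ))
      ≤ Real.log (2 * (t : ℝ) ^ 2 * Real.pi ^ 2 / (3 * δ)) :=
    Real.log_le_log (by positivity) (by gcongr)
  rw [beta_eq, beta_eq]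
  gcongr

lemma exp_neg_beta (hδ : 0 < δ) (hδ1 : δ < 1) {t : ℕ} (ht : 1 ≤ t)
    (hτ : 1 < netScale d r a b δ t) :
    Real.exp (-√(beta d r a b δ t) ^ 2 / 2) * netScale d r a b δ t ^ d
      = 3 * δ / (2 * Real.pi ^ 2) * (1 / (t : ℝ) ^ 2) := by
  have ht' : (0 : ℝ) < t := by exact_mod_cast ht
  have hp := Real.pi_pos
  have h0 : 0 < netScale d r a b δ t := by linarith
  rw [Real.sq_sqrt (beta_nonneg hδ hδ1 ht hτ), beta_eq]
  have e : -(2 * Real.log (2 * (t : ℝ) ^ 2 * Real.pi ^ 2 / (3 * δ)) +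
      2 * d * Real.log (netScale d r a b δ t)) / 2
      = -Real.log (2 * (t : ℝ) ^ 2 * Real.pi ^ 2 / (3 * δ))
        + -(d * Real.log (netScale d r a b δ t)) := by ring
  rw [e, Real.exp_add, Real.exp_neg, Real.exp_neg, Real.exp_log (by positivity), Real.exp_nat_mul,
    Real.exp_log h0]
  field_simp

/-- The confidence levels are summable with sum `δ / 4`. -/
lemma measure_iUnion_le_of_confidence {Ω : Type*} [MeasurableSpace Ω] {P : Measure Ω}
    (hδ : 0 < δ) {s : ℕ → Set Ω}
    (hs : ∀ n, P (s n)
      ≤ ENNReal.ofReal (3 * δ / (2 * Real.pi ^ 2) * (1 / ((n + 1 : ℕ) : ℝ) ^ 2))) :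
    P (⋃ n, s n) ≤ ENNReal.ofReal (δ / 4) := by
  have hp := Real.pi_pos
  have hz : HasSum (fun n : ℕ => 1 / ((n + 1 : ℕ) : ℝ) ^ 2) (Real.pi ^ 2 / 6) := by
    have := (hasSum_nat_add_iff' 1).2 hasSum_zeta_two
    simpa using this
  have hz2 := hz.mul_left (3 * δ / (2 * Real.pi ^ 2))
  refine (measure_iUnion_le s).trans ((ENNReal.tsum_le_tsum hs).trans ?_)
  rw [← ENNReal.ofReal_tsum_of_nonneg (fun n => by positivity) hz2.summable, hz2.tsum_eq]
  refine ENNReal.ofReal_le_ofReal (le_of_eq ?_)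
  field_simp
  norm_num

lemma exists_net_size {τ : ℝ} (hτ : 1 < τ) : ∃ n : ℕ, 1 ≤ n ∧ (n : ℝ) ≤ τ ∧ τ ≤ 2 * n := by
  rcases le_total τ 2 with h | h
  · exact ⟨1, le_rfl, by simpa using hτ.le, by simpa using h⟩
  · refine ⟨⌊τ⌋₊, Nat.le_floor (by simpa using hτ.le), Nat.floor_le (by linarith), ?_⟩
    have := Nat.lt_floor_add_one τ
    linarith

end Beta

/-! ### The noise -/

section Noise

variable {d : ℕ} {D : Set (Pt d)} {Ω : Type*} [MeasurableSpace Ω] {P : Measure Ω}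
  {σε δ : ℝ} {f : Ω → Pt d → ℝ} {ξ : ℕ → Ω → ℝ}

lemma IsNoise.lintegral_sq (hξ : IsNoise P D σε f ξ) (t : ℕ) :
    ∫⁻ ω, ENNReal.ofReal (ξ t ω ^ 2) ∂P = ENNReal.ofReal (σε ^ 2) := by
  have hm : Measurable fun u : ℝ => ENNReal.ofReal (u ^ 2) := by fun_prop
  rw [← lintegral_map (f := fun u : ℝ => ENNReal.ofReal (u ^ 2)) hm (hξ.measurable t), hξ.law t]
  have h := ofReal_variance (memLp_id_gaussianReal (μ := 0) (v := Real.toNNReal (σε ^ 2)) 2)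
  rw [evariance_eq_lintegral_ofReal, variance_id_gaussianReal] at h
  simp only [id_eq, integral_id_gaussianReal, sub_zero] at h
  rw [← h, Real.coe_toNNReal _ (sq_nonneg σε)]

/-- The constant in the bound on the sum of the squares of the noise. -/
def noiseConst (σε δ : ℝ) : ℝ := 16 * σε ^ 2 * Real.pi ^ 2 / (6 * δ)

lemma noiseConst_pos (hσε : 0 < σε) (hδ : 0 < δ) : 0 < noiseConst σε δ := by
  have := Real.pi_pos
  unfold noiseConst; positivity

lemma IsNoise.measure_sum_sq_le (hξ : IsNoise P D σε f ξ) (hσε : 0 < σε) (hδ : 0 < δ) :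
    P {ω | ∃ N : ℕ, (N : ℝ) ^ 2 * noiseConst σε δ < ∑ i : Fin N, ξ (i + 1) ω ^ 2}
      ≤ ENNReal.ofReal (δ / 16) := by
  have hp := Real.pi_pos
  have hB := noiseConst_pos hσε hδ
  set S : Ω → ENNReal := fun ω =>
    ∑' n : ℕ, ENNReal.ofReal (1 / ((n + 1 : ℕ) : ℝ) ^ 2) * ENNReal.ofReal (ξ (n + 1) ω ^ 2) with hS
  have hm : ∀ n : ℕ, Measurable fun ω => ENNReal.ofReal (ξ (n + 1) ω ^ 2) := fun n =>
    ((hξ.measurable (n + 1)).pow_const 2).ennreal_ofReal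
  have hSm : Measurable S := Measurable.tsum fun n => (hm n).const_mul _
  have hSi : ∫⁻ ω, S ω ∂P = ENNReal.ofReal (δ / 16 * noiseConst σε δ) := by
    rw [hS, lintegral_tsum fun n => ((hm n).const_mul _).aemeasurable]
    have e : ∀ n : ℕ, ∫⁻ ω, ENNReal.ofReal (1 / ((n + 1 : ℕ) : ℝ) ^ 2) *
        ENNReal.ofReal (ξ (n + 1) ω ^ 2) ∂P
        = ENNReal.ofReal (1 / ((n + 1 : ℕ) : ℝ) ^ 2 * σε ^ 2) := fun n => by
      rw [lintegral_const_mul _ (hm n), hξ.lintegral_sq, ← ENNReal.ofReal_mul (by positivity)]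
    rw [tsum_congr e]
    have hz : HasSum (fun n : ℕ => 1 / ((n + 1 : ℕ) : ℝ) ^ 2) (Real.pi ^ 2 / 6) := by
      have := (hasSum_nat_add_iff' 1).2 hasSum_zeta_two
      simpa using this
    have hz2 := hz.mul_right (σε ^ 2)
    rw [← ENNReal.ofReal_tsum_of_nonneg (fun n => by positivity) hz2.summable, hz2.tsum_eq,
      noiseConst]
    congr 1
    field_simp
  have hsub : {ω | ∃ N : ℕ, (N : ℝ) ^ 2 * noiseConst σε δ < ∑ i : Fin N, ξ (i + 1) ω ^ 2}
      ⊆ {ω | ENNReal.ofReal (noiseConst σε δ) ≤ S ω} := by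
    rintro ω ⟨N, hN⟩
    have h1 : ENNReal.ofReal (∑ n ∈ Finset.range N, 1 / ((n + 1 : ℕ) : ℝ) ^ 2 * ξ (n + 1) ω ^ 2)
        ≤ S ω := by
      rw [ENNReal.ofReal_sum_of_nonneg fun _ _ => by positivity]
      refine le_trans (le_of_eq (Finset.sum_congr rfl fun n _ => ?_))
        (ENNReal.sum_le_tsum (Finset.range N))
      rw [ENNReal.ofReal_mul (by positivity)]
    refine le_trans (ENNReal.ofReal_le_ofReal ?_) h1
    rw [← Fin.sum_univ_eq_sum_range (fun n => 1 / ((n + 1 : ℕ) : ℝ) ^ 2 * ξ (n + 1) ω ^ 2)]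
    have hN0 : 0 < N := by
      rcases Nat.eq_zero_or_pos N with rfl | h
      · simp at hN
      · exact h
    have hN1 : (0 : ℝ) < N := by exact_mod_cast hN0
    have h2 : (∑ i : Fin N, ξ (i + 1) ω ^ 2) / (N : ℝ) ^ 2
        ≤ ∑ i : Fin N, 1 / (((i : ℕ) + 1 : ℕ) : ℝ) ^ 2 * ξ (i + 1) ω ^ 2 := by
      rw [Finset.sum_div]
      refine Finset.sum_le_sum fun i _ => ?_
      rw [div_eq_mul_one_div, mul_comm]
      have : (((i : ℕ) + 1 : ℕ) : ℝ) ≤ N := by exact_mod_cast i.2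
      gcongr
    refine le_trans ?_ h2
    rw [le_div_iff₀ (by positivity)]
    linarith
  refine (measure_mono hsub).trans ?_
  have h := mul_meas_ge_le_lintegral hSm (ENNReal.ofReal (noiseConst σε δ)) (μ := P)
  rw [hSi, mul_comm, ENNReal.ofReal_mul (by positivity)] at h
  exact (ENNReal.mul_le_mul_iff_left (by simpa using hB) ENNReal.ofReal_ne_top).1 h

end Noise

/-! ### The event on which the confidence bounds hold -/

section GoodEvent

variable {d : ℕ} {D : Set (Pt d)} {Ω : Type*} [MeasurableSpace Ω] {P : Measure Ω}
  [IsProbabilityMeasure P] {K : Pt d → Pt d → ℝ} {σf σε r a b δ : ℝ} {f : Ω → Pt d → ℝ}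
  {ξ : ℕ → Ω → ℝ} {x : ℕ → Ω → Pt d} {y : ℕ → Ω → ℝ} {xstar : Ω → Pt d} {k : ℝ → ℝ} {l : ℝ}
  {M : ℕ → ℕ} {R : ℕ → ℕ → ℝ}

lemma IsCenteredGP.prior_tail (hf : IsCenteredGP P D K f) (hσε : 0 < σε) (hσf : 0 < σf)
    (hdiag : ∀ x ∈ D, K x x = σf ^ 2) {z : Pt d} (hz : z ∈ D) {s : ℝ} (hs : 0 ≤ s) :
    P {ω | s * σf < |f ω z|} ≤ 2 * ENNReal.ofReal (Real.exp (-s ^ 2 / 2)) := by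
  have hX : ∀ i : Fin 0, (Fin.elim0 i : Pt d) ∈ D := fun i => i.elim0
  have hpv : √(postVar K σε (fun i : Fin 0 => (Fin.elim0 i : Pt d)) z) = σf := by
    simp [postVar, hdiag z hz, Real.sqrt_sq hσf.le]
  have hpm : postMean K σε (fun i : Fin 0 => (Fin.elim0 i : Pt d)) (fun i => Fin.elim0 i) z = 0 := by
    simp [postMean]
  have h1 : P {ω | s * σf < f ω z} ≤ ENNReal.ofReal (Real.exp (-s ^ 2 / 2)) := by
    have h := hf.posterior_tail_upper hσε hσf hdiag hX hz (fun i => Fin.elim0 i) hs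
    rw [hpv, hpm] at h
    simpa [likelihood, lintegral_indicator_one (measurableSet_lt measurable_const
      (hf.measurable z hz))] using h
  have h2 : P {ω | f ω z < -(s * σf)} ≤ ENNReal.ofReal (Real.exp (-s ^ 2 / 2)) := by
    have h := hf.posterior_tail_lower hσε hσf hdiag hX hz (fun i => Fin.elim0 i) hs
    rw [hpv, hpm] at h
    simpa [likelihood, lintegral_indicator_one (measurableSet_lt (hf.measurable z hz)
      measurable_const)] using h
  have hsub : {ω | s * σf < |f ω z|} ⊆ {ω | s * σf < f ω z} ∪ {ω | f ω z < -(s * σf)} := by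
    intro ω hω
    rcases lt_abs.1 (show s * σf < |f ω z| from hω) with h | h
    · exact Or.inl h
    · exact Or.inr (show f ω z < _ by linarith)
  refine (measure_mono hsub).trans ((measure_union_le _ _).trans ?_)
  rw [two_mul]
  exact add_le_add h1 h2

/-- The size per dimension of the net that is used to bound the sample path. -/
def supNetSize (d : ℕ) (r a b δ : ℝ) : ℕ := ⌈netScale d r a b δ 1 / 2⌉₊ + 1

/-- A bound for the sample path that holds with high probability. -/
def supBound (σf : ℝ) (d : ℕ) (r a b δ : ℝ) : ℝ :=
  1 + √(2 * (d * Real.log (supNetSize d r a b δ) + Real.log (32 / δ))) * σf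

lemma supBound_pos (hσf : 0 < σf) : 0 < supBound σf d r a b δ := by
  unfold supBound; positivity

/-- What is needed of an outcome for the regret bound. -/
structure IsGoodOutcome (D : Set (Pt d)) (K : Pt d → Pt d → ℝ) (σf σε r a b δ : ℝ)
    (φ : Pt d → ℝ) (ξ : ℕ → ℝ) (x : ℕ → Pt d) (y : ℕ → ℝ) : Prop where
  lipschitz : ∀ p ∈ D, ∀ q ∈ D, |φ p - φ q| ≤ lipConst d a b δ * √d * ‖p - q‖
  bounded : ∀ p ∈ D, |φ p| ≤ supBound σf d r a b δ
  noise : ∀ N : ℕ, ∑ i : Fin N, ξ (i + 1) ^ 2 ≤ (N : ℝ) ^ 2 * noiseConst σε δ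
  upper : ∀ n : ℕ, 1 < netScale d r a b δ (n + 1) → φ (x (n + 1)) ≤
    postMean K σε (fun i : Fin n => x (i + 1)) (fun i => y (i + 1)) (x (n + 1))
      + √(beta d r a b δ (n + 1)) * √(postVar K σε (fun i : Fin n => x (i + 1)) (x (n + 1)))
  lower : ∀ n : ℕ, 1 < netScale d r a b δ (n + 1) → ∀ p ∈ D, ∃ g ∈ D,
    |φ g - φ p| ≤ 1 / ((n + 1 : ℕ) : ℝ) ^ 2 ∧
    postMean K σε (fun i : Fin n => x (i + 1)) (fun i => y (i + 1)) g
      - √(beta d r a b δ (n + 1)) * √(postVar K σε (fun i : Fin n => x (i + 1)) g) ≤ φ g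

lemma exists_sup_event (hf : IsCenteredGP P D K f) (hσε : 0 < σε) (hσf : 0 < σf)
    (hdiag : ∀ x ∈ D, K x x = σf ^ 2) (hDc : IsCompact D) (hD : Convex ℝ D) (hne : D.Nonempty)
    (hr : 0 < r) (hDr : ∀ x ∈ D, ∀ j, 0 ≤ x j ∧ x j ≤ r) (hb : 0 < b) (hδ : 0 < δ)
    (hδ1 : δ < 1) :
    ∃ s : Set Ω, P s ≤ ENNReal.ofReal (δ / 16) ∧ ∀ ω ∉ s,
      (∀ p ∈ D, ∀ q ∈ D, |f ω p - f ω q| ≤ lipConst d a b δ * √d * ‖p - q‖) →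
      ∀ p ∈ D, |f ω p| ≤ supBound σf d r a b δ := by
  set n := supNetSize d r a b δ with hn
  have hn1 : 1 ≤ n := by rw [hn, supNetSize]; omega
  have hnr : (1 : ℝ) ≤ n := by exact_mod_cast hn1
  have hnτ : netScale d r a b δ 1 ≤ 2 * n := by
    have := Nat.le_ceil (netScale d r a b δ 1 / 2)
    rw [hn, supNetSize]; push_cast; linarith
  obtain ⟨S, hSD, hS⟩ := exists_net hDc hD hne hr hDr hn1
  have hu : 0 ≤ 2 * (d * Real.log n + Real.log (32 / δ)) := by
    have h1 := Real.log_nonneg hnr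
    have h2 : 0 ≤ Real.log (32 / δ) := Real.log_nonneg (by rw [le_div_iff₀ hδ]; linarith)
    positivity
  set u := √(2 * (d * Real.log n + Real.log (32 / δ))) with hudef
  refine ⟨⋃ i, {ω | u * σf < |f ω (S i)|}, ?_, fun ω hω hL p hp => ?_⟩
  · refine (measure_iUnion_fintype_le P _).trans ((Finset.sum_le_sum fun i _ =>
      hf.prior_tail hσε hσf hdiag (hSD i) (Real.sqrt_nonneg _)).trans ?_)
    have e : Real.exp (-u ^ 2 / 2) = ((n : ℝ) ^ d)⁻¹ * (δ / 32) := by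
      rw [hudef, Real.sq_sqrt hu]
      have : -(2 * (d * Real.log n + Real.log (32 / δ))) / 2
        = -(d * Real.log n) + -Real.log (32 / δ) := by ring
      rw [this, Real.exp_add, Real.exp_neg, Real.exp_neg, Real.exp_nat_mul,
        Real.exp_log (by linarith), Real.exp_log (by positivity), inv_div]
    rw [e, Finset.sum_const, Finset.card_univ, Fintype.card_fun, Fintype.card_fin,
      Fintype.card_fin, nsmul_eq_mul]
    rw [← ENNReal.ofReal_natCast, ← ENNReal.ofReal_ofNat, ← ENNReal.ofReal_mul (by positivity),
      ← ENNReal.ofReal_mul (by positivity)]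
    refine ENNReal.ofReal_le_ofReal (le_of_eq ?_)
    push_cast
    field_simp
    norm_num
  · obtain ⟨i, hi⟩ := hS p hp
    simp only [Set.mem_iUnion, Set.mem_ofPred_eq, not_exists, not_lt] at hω
    have h1 := hω i
    have hL0 := lipConst_nonneg (d := d) (a := a) (δ := δ) hb
    have h2 : |f ω p - f ω (S i)| ≤ 1 := by
      refine (hL p hp (S i) (hSD i)).trans ((mul_le_mul_of_nonneg_left hi (by positivity)).trans ?_)
      have e : lipConst d a b δ * √d * (√d * (r / (2 * n)))
          = netScale d r a b δ 1 / (2 * n) := by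
        rw [netScale_eq]
        have := Real.mul_self_sqrt (Nat.cast_nonneg (α := ℝ) d)
        push_cast
        calc _ = lipConst d a b δ * (√d * √d) * (r / (2 * n)) := by ring
          _ = _ := by rw [this]; ring
      rw [e, div_le_one (by positivity)]
      exact hnτ
    have h3 := abs_sub_abs_le_abs_sub (f ω p) (f ω (S i))
    rw [supBound, ← hn, ← hudef]
    linarith

lemma IsRun.exists_lower_event (hrun : IsRun P D k l σε M R (beta d r a b δ) f ξ x y)
    (hσε : 0 < σε) (hσf : 0 < σf) (hDc : IsCompact D) (hD : Convex ℝ D) (hne : D.Nonempty)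
    (hr : 0 < r) (hDr : ∀ x ∈ D, ∀ j, 0 ≤ x j ∧ x j ≤ r) (hb : 0 < b) (hδ : 0 < δ) (hδ1 : δ < 1)
    (hf : IsCenteredGP P D K f) (hdiag : ∀ x ∈ D, K x x = σf ^ 2)
    (hcont : ∀ᵐ ω ∂P, ContinuousOn (f ω) D) (hξ : IsNoise P D σε f ξ) (n : ℕ) :
    ∃ s : Set Ω, P s ≤ ENNReal.ofReal (3 * δ / (2 * Real.pi ^ 2) * (1 / ((n + 1 : ℕ) : ℝ) ^ 2)) ∧
      ∀ ω ∉ s, (∀ p ∈ D, ∀ q ∈ D, |f ω p - f ω q| ≤ lipConst d a b δ * √d * ‖p - q‖) →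
      1 < netScale d r a b δ (n + 1) → ∀ p ∈ D, ∃ g ∈ D,
        |f ω g - f ω p| ≤ 1 / ((n + 1 : ℕ) : ℝ) ^ 2 ∧
        postMean K σε (fun i : Fin n => x (i + 1) ω) (fun i => y (i + 1) ω) g
          - √(beta d r a b δ (n + 1)) * √(postVar K σε (fun i : Fin n => x (i + 1) ω) g)
          ≤ f ω g := by
  by_cases hτ : 1 < netScale d r a b δ (n + 1)
  swap
  · exact ⟨∅, by simp, fun ω _ _ h => absurd h hτ⟩
  obtain ⟨m, hm1, hmτ, hτm⟩ := exists_net_size hτ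
  obtain ⟨S, hSD, hS⟩ := exists_net hDc hD hne hr hDr hm1
  refine ⟨⋃ i, {ω | f ω (S i) <
      postMean K σε (fun i : Fin n => x (i + 1) ω) (fun i => y (i + 1) ω) (S i)
      - √(beta d r a b δ (n + 1)) * √(postVar K σε (fun i : Fin n => x (i + 1) ω) (S i))}, ?_,
    fun ω hω hL _ p hp => ?_⟩
  · refine (measure_iUnion_fintype_le P _).trans ((Finset.sum_le_sum fun i _ =>
      hrun.tail_point hσε hσf hDc hf hdiag hcont hξ n (Real.sqrt_nonneg _) (hSD i)).trans ?_)
    rw [Finset.sum_const, Finset.card_univ, Fintype.card_fun, Fintype.card_fin,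
      Fintype.card_fin, nsmul_eq_mul, ← ENNReal.ofReal_natCast,
      ← ENNReal.ofReal_mul (by positivity), ← exp_neg_beta hδ hδ1 (by omega) hτ, mul_comm]
    refine ENNReal.ofReal_le_ofReal (mul_le_mul_of_nonneg_left ?_ (Real.exp_pos _).le)
    push_cast
    exact pow_le_pow_left₀ (Nat.cast_nonneg m) hmτ d
  · obtain ⟨i, hi⟩ := hS p hp
    simp only [Set.mem_iUnion, Set.mem_ofPred_eq, not_exists, not_lt] at hω
    refine ⟨S i, hSD i, ?_, hω i⟩
    have hm0 : (0 : ℝ) < m := by exact_mod_cast hm1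
    have hn0 : (0 : ℝ) < ((n + 1 : ℕ) : ℝ) := by positivity
    have hL0 := lipConst_nonneg (d := d) (a := a) (δ := δ) hb
    rw [abs_sub_comm]
    refine (hL p hp (S i) (hSD i)).trans ((mul_le_mul_of_nonneg_left hi (by positivity)).trans ?_)
    rw [netScale_eq] at hτm
    have e : lipConst d a b δ * √d * (√d * (r / (2 * m)))
        = d * r * lipConst d a b δ / (2 * m) := by
      have := Real.mul_self_sqrt (Nat.cast_nonneg (α := ℝ) d)
      calc _ = lipConst d a b δ * (√d * √d) * (r / (2 * m)) := by ring
        _ = _ := by rw [this]; ring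
    rw [e, div_le_div_iff₀ (by positivity) (by positivity)]
    linarith

lemma IsRun.exists_upper_event (hrun : IsRun P D k l σε M R (beta d r a b δ) f ξ x y)
    (hσε : 0 < σε) (hσf : 0 < σf) (hDc : IsCompact D) (hδ : 0 < δ) (hδ1 : δ < 1)
    (hf : IsCenteredGP P D K f) (hdiag : ∀ x ∈ D, K x x = σf ^ 2)
    (hcont : ∀ᵐ ω ∂P, ContinuousOn (f ω) D) (hξ : IsNoise P D σε f ξ) (n : ℕ) :
    ∃ s : Set Ω, P s ≤ ENNReal.ofReal (3 * δ / (2 * Real.pi ^ 2) * (1 / ((n + 1 : ℕ) : ℝ) ^ 2)) ∧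
      ∀ ω ∉ s, 1 < netScale d r a b δ (n + 1) → f ω (x (n + 1) ω) ≤
        postMean K σε (fun i : Fin n => x (i + 1) ω) (fun i => y (i + 1) ω) (x (n + 1) ω)
        + √(beta d r a b δ (n + 1))
          * √(postVar K σε (fun i : Fin n => x (i + 1) ω) (x (n + 1) ω)) := by
  by_cases hτ : 1 < netScale d r a b δ (n + 1)
  swap
  · exact ⟨∅, by simp, fun ω _ h => absurd h hτ⟩
  refine ⟨_, (hrun.tail_query hσε hσf hDc hf hdiag hcont hξ n
    (Real.sqrt_nonneg (beta d r a b δ (n + 1)))).trans ?_, fun ω hω _ => not_lt.1 hω⟩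
  rw [← exp_neg_beta hδ hδ1 (by omega) hτ]
  exact ENNReal.ofReal_le_ofReal (le_mul_of_one_le_right (Real.exp_pos _).le
    (one_le_pow₀ hτ.le))

lemma IsRun.exists_good_event (hrun : IsRun P D k l σε M R (beta d r a b δ) f ξ x y)
    (hσε : 0 < σε) (hσf : 0 < σf) (hDc : IsCompact D) (hD : Convex ℝ D) (hd : 1 ≤ d)
    (hr : 0 < r) (hDr : ∀ x ∈ D, ∀ j, 0 ≤ x j ∧ x j ≤ r) (ha : 0 < a) (hb : 0 < b) (hδ : 0 < δ)
    (hδ1 : δ < 1) (hf : IsCenteredGP P D K f) (hdiag : ∀ x ∈ D, K x x = σf ^ 2)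
    (hder : HasDerivTail P D a b f) (hξ : IsNoise P D σε f ξ) {Q : Ω → Prop} (hQ : ∀ᵐ ω ∂P, Q ω) :
    ∃ G : Set Ω, MeasurableSet G ∧ ENNReal.ofReal (1 - δ) ≤ P G ∧ ∀ ω ∈ G, Q ω ∧
      IsGoodOutcome D K σf σε r a b δ (f ω) (fun n => ξ n ω) (fun n => x n ω) fun n => y n ω := by
  have hne : D.Nonempty := by
    obtain ⟨ω, hω⟩ := hrun.optimal.exists
    obtain ⟨z, hz, -⟩ := hω 1 le_rfl
    exact ⟨_, hz.1.point_mem⟩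
  have hcont : ∀ᵐ ω ∂P, ContinuousOn (f ω) D := by
    filter_upwards [hder.differentiable] with ω hω using hω.continuousOn
  obtain ⟨s₁, hs₁, h₁⟩ := exists_sup_event (a := a) hf hσε hσf hdiag hDc hD hne hr hDr hb hδ hδ1
  choose s₂ hs₂ h₂ using
    hrun.exists_lower_event hσε hσf hDc hD hne hr hDr hb hδ hδ1 hf hdiag hcont hξ
  choose s₃ hs₃ h₃ using hrun.exists_upper_event hσε hσf hDc hδ hδ1 hf hdiag hcont hξ
  have hs₂' := measure_iUnion_le_of_confidence hδ hs₂
  have hs₃' := measure_iUnion_le_of_confidence hδ hs₃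
  have hs₄ := hder.measure_lipConst_le ha hb hδ hd
  have hs₅ := hξ.measure_sum_sq_le hσε hδ
  set s₄ := {ω | ∃ j, ∃ x ∈ D, lipConst d a b δ
    < |fderivWithin ℝ (f ω) D x (EuclideanSpace.single j 1)|} with hs₄def
  set s₅ := {ω | ∃ N : ℕ, (N : ℝ) ^ 2 * noiseConst σε δ < ∑ i : Fin N, ξ (i + 1) ω ^ 2} with hs₅def
  set s₆ := {ω | ¬ (Q ω ∧ DifferentiableOn ℝ (f ω) D)} with hs₆def
  have hs₆ : P s₆ = 0 := by
    have : ∀ᵐ ω ∂P, Q ω ∧ DifferentiableOn ℝ (f ω) D := hQ.and hder.differentiable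
    exact ae_iff.1 this
  set B := s₁ ∪ (⋃ n, s₂ n) ∪ (⋃ n, s₃ n) ∪ s₄ ∪ s₅ ∪ s₆ with hB
  have hPB : P B ≤ ENNReal.ofReal δ := by
    have h : P B ≤ ENNReal.ofReal (δ / 16) + ENNReal.ofReal (δ / 4) + ENNReal.ofReal (δ / 4)
        + ENNReal.ofReal (δ / 4) + ENNReal.ofReal (δ / 16) + 0 :=
      (measure_union_le _ _).trans (add_le_add ((measure_union_le _ _).trans (add_le_add
        ((measure_union_le _ _).trans (add_le_add ((measure_union_le _ _).trans (add_le_add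
          ((measure_union_le _ _).trans (add_le_add hs₁ hs₂')) hs₃')) hs₄)) hs₅)) hs₆.le)
    refine h.trans ?_
    rw [add_zero, ← ENNReal.ofReal_add (by positivity) (by positivity),
      ← ENNReal.ofReal_add (by positivity) (by positivity),
      ← ENNReal.ofReal_add (by positivity) (by positivity),
      ← ENNReal.ofReal_add (by positivity) (by positivity)]
    exact ENNReal.ofReal_le_ofReal (by linarith)
  refine ⟨(toMeasurable P B)ᶜ, (measurableSet_toMeasurable P B).compl, ?_, fun ω hω => ?_⟩
  · rw [prob_compl_eq_one_sub (measurableSet_toMeasurable P B), measure_toMeasurable,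
      ENNReal.ofReal_sub _ hδ.le, ENNReal.ofReal_one]
    exact tsub_le_tsub_left hPB 1
  · have hωB : ω ∉ B := fun h => hω (subset_toMeasurable P B h)
    simp only [hB, Set.mem_union, Set.mem_iUnion, not_or, not_exists] at hωB
    obtain ⟨⟨⟨⟨⟨n₁, n₂⟩, n₃⟩, n₄⟩, n₅⟩, n₆⟩ := hωB
    simp only [hs₄def, hs₅def, hs₆def, Set.mem_ofPred_eq, not_exists, not_lt] at n₄ n₅ n₆
    replace n₆ := not_not.1 n₆
    have hL : ∀ p ∈ D, ∀ q ∈ D, |f ω p - f ω q| ≤ lipConst d a b δ * √d * ‖p - q‖ :=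
      fun p hp q hq => abs_sub_le_of_partial_le hD n₆.2
        (fun j x hx => not_lt.1 fun hlt => n₄ j x ⟨hx, hlt⟩) (lipConst_nonneg hb) hp hq
    exact ⟨n₆.1, hL, h₁ ω n₁ hL, n₅, fun n => h₃ n ω (n₃ n), fun n => h₂ n ω (n₂ n) hL⟩

end GoodEvent

/-! ### The regret bound on a good outcome -/

section Regret

variable {d : ℕ} {D : Set (Pt d)} {σf σε r a b δ : ℝ} {k : ℝ → ℝ} {l : ℝ}

/-- The constant `C_σ`. -/
def constCσ (σf σε : ℝ) : ℝ := √(varErrConst σf σε)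

/-- The constant `C_μ`. -/
def constCμ (σf σε : ℝ) (d : ℕ) (r a b δ : ℝ) : ℝ :=
  meanErrConst σf σε * (supBound σf d r a b δ + √(noiseConst σε δ))
    + supBound σf d r a b δ / errThreshold σf σε

lemma constCσ_pos (hσf : 0 < σf) (hσε : 0 < σε) : 0 < constCσ σf σε :=
  Real.sqrt_pos.2 (varErrConst_pos hσf hσε)

lemma constCμ_pos (hσf : 0 < σf) (hσε : 0 < σε) : 0 < constCμ σf σε d r a b δ := by
  have h1 := supBound_pos (d := d) (r := r) (a := a) (b := b) (δ := δ) hσf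
  have h2 := meanErrConst_pos hσf hσε
  have h3 := errThreshold_pos hσf hσε
  unfold constCμ; positivity

lemma norm_sub_le_of_mem_cube (hr : 0 < r) (hDr : ∀ x ∈ D, ∀ j, 0 ≤ x j ∧ x j ≤ r) {p q : Pt d}
    (hp : p ∈ D) (hq : q ∈ D) : ‖p - q‖ ≤ √d * r := by
  rw [EuclideanSpace.norm_eq, ← Real.sqrt_sq hr.le, ← Real.sqrt_mul (Nat.cast_nonneg d)]
  refine Real.sqrt_le_sqrt ?_
  calc ∑ j, ‖(p - q) j‖ ^ 2 ≤ ∑ _j : Fin d, r ^ 2 :=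
        Finset.sum_le_sum fun j _ => pow_le_pow_left₀ (norm_nonneg _) (by
          rw [Real.norm_eq_abs, abs_le, PiLp.sub_apply]
          have h1 := hDr p hp j
          have h2 := hDr q hq j
          constructor <;> linarith) 2
    _ = _ := by simp

lemma sqrt_natCast_le (n : ℕ) : √(n : ℝ) ≤ n := by
  refine Real.sqrt_le_iff.2 ⟨Nat.cast_nonneg n, ?_⟩
  exact_mod_cast Nat.le_self_pow two_ne_zero n

variable {φ : Pt d → ℝ} {ξ : ℕ → ℝ} {x : ℕ → Pt d} {y : ℕ → ℝ} {K : Pt d → Pt d → ℝ}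

lemma IsGoodOutcome.l2norm_obs_le (h : IsGoodOutcome D K σf σε r a b δ φ ξ x y) (hσf : 0 < σf)
    (hx : ∀ n, x (n + 1) ∈ D) (hy : ∀ n, y (n + 1) = φ (x (n + 1)) + ξ (n + 1)) (n : ℕ) :
    (l2norm fun i : Fin n => y (i + 1)) ≤ n * (supBound σf d r a b δ + √(noiseConst σε δ)) := by
  have hF := supBound_pos (d := d) (r := r) (a := a) (b := b) (δ := δ) hσf
  have e : (fun i : Fin n => y (i + 1))
      = (fun i : Fin n => φ (x (i + 1))) + fun i : Fin n => ξ (i + 1) := by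
    funext i; exact hy i
  rw [e]
  refine (l2norm_add_le _ _).trans ?_
  have h1 := l2norm_le_of_abs_le (v := fun i : Fin n => φ (x (i + 1))) hF.le
    fun i => h.bounded _ (hx i)
  rw [Fintype.card_fin] at h1
  have h2 : (l2norm fun i : Fin n => ξ (i + 1)) ≤ n * √(noiseConst σε δ) := by
    rw [← Real.sqrt_sq (Nat.cast_nonneg (α := ℝ) n), ← Real.sqrt_mul (sq_nonneg _)]
    refine Real.sqrt_le_sqrt (le_trans (le_of_eq ?_) (h.noise n))
    simp [dotProduct, sq]
  have h3 := mul_le_mul_of_nonneg_right (sqrt_natCast_le n) hF.le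
  linarith

/-- The regret in round `n + 1`. -/
lemma IsGoodOutcome.regret_le (h : IsGoodOutcome D (isoKernel k l) σf σε r a b δ φ ξ x y)
    (hσf : 0 < σf) (hσε : 0 < σε) (hr : 0 < r) (hb : 0 < b)
    (hDr : ∀ x ∈ D, ∀ j, 0 ≤ x j ∧ x j ≤ r) (hl : 0 < l)
    (hK : IsPosKernel D (isoKernel k l)) (hk0 : k 0 = σf ^ 2)
    (hx : ∀ n, x (n + 1) ∈ D) (hy : ∀ n, y (n + 1) = φ (x (n + 1)) + ξ (n + 1)) {p : Pt d}
    (hp : p ∈ D) (n : ℕ) {M : ℕ} {R : ℕ → ℝ} {ε : ℝ} (hR : IsBreakpoints D l M R)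
    (hε : ∀ ρ ∈ Set.Icc 0 (R M), |k ρ - pwl k M R ρ| ≤ ε) (hε0 : 0 ≤ ε) {z : Vars d n}
    (hz : IsOptimal D k l σε M R (beta d r a b δ (n + 1))
      (fun i : Fin n => (x (i + 1), y (i + 1))) z) (hzx : z.point = x (n + 1)) :
    φ (x (n + 1)) - φ p
      ≤ (if 1 < netScale d r a b δ (n + 1) then
          2 * √(beta d r a b δ (n + 1)) * √(seqVar (isoKernel k l) σε (fun n => x (n + 1)) n)
          else 0)
        + (1 / ((n + 1 : ℕ) : ℝ) ^ 2
          + 2 * constCμ σf σε d r a b δ * ((n + 1 : ℕ) : ℝ) ^ 2 * ε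
          + 4 * constCσ σf σε * √(beta d r a b δ (n + 1)) * ((n + 1 : ℕ) : ℝ) * √ε) := by
  have hF := supBound_pos (d := d) (r := r) (a := a) (b := b) (δ := δ) hσf
  have hCσ := constCσ_pos hσf hσε
  have hCμ := constCμ_pos (d := d) (r := r) (a := a) (b := b) (δ := δ) hσf hσε
  have hC0 := meanErrConst_pos hσf hσε
  have hκ := errThreshold_pos hσf hσε
  have hV := varErrConst_pos hσf hσε
  have hn0 : (0 : ℝ) ≤ n := Nat.cast_nonneg n
  have ht : ((n + 1 : ℕ) : ℝ) = n + 1 := by push_cast; ring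
  have ht0 : (0 : ℝ) < ((n + 1 : ℕ) : ℝ) := by positivity
  have hL0 := lipConst_nonneg (d := d) (a := a) (δ := δ) hb
  set t : ℝ := ((n + 1 : ℕ) : ℝ) with htdef
  set β := beta d r a b δ (n + 1)
  have q1 : 0 ≤ 1 / t ^ 2 := by positivity
  have q2 : 0 ≤ 2 * constCμ σf σε d r a b δ * t ^ 2 * ε := by positivity
  have q3 : 0 ≤ 4 * constCσ σf σε * √β * t * √ε := by positivity
  by_cases hτ : 1 < netScale d r a b δ (n + 1)
  swap
  · rw [if_neg hτ]
    rw [not_lt, netScale_eq, ← htdef] at hτ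
    have h1 := (le_abs_self _).trans (h.lipschitz _ (hx n) p hp)
    have h2 := mul_le_mul_of_nonneg_left (norm_sub_le_of_mem_cube hr hDr (hx n) hp)
      (by positivity : 0 ≤ lipConst d a b δ * √d)
    have h3 : lipConst d a b δ * √d * (√d * r) ≤ 1 / t ^ 2 := by
      rw [le_div_iff₀ (by positivity)]
      have := Real.mul_self_sqrt (Nat.cast_nonneg (α := ℝ) d)
      calc _ = t ^ 2 * ((√d * √d) * r * lipConst d a b δ) := by ring
        _ ≤ 1 := by rw [this]; exact hτ
    linarith
  rw [if_pos hτ]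
  have q0 : 0 ≤ 2 * √β * √(seqVar (isoKernel k l) σε (fun n => x (n + 1)) n) := by positivity
  by_cases hgood : ((n : ℝ) + 1) ^ 2 * ε ≤ errThreshold σf σε
  swap
  · rw [← ht, not_le] at hgood
    have h1 := (abs_le.1 (h.bounded _ (hx n))).2
    have h2 := (abs_le.1 (h.bounded _ hp)).1
    have h3 : supBound σf d r a b δ
        ≤ supBound σf d r a b δ / errThreshold σf σε * (t ^ 2 * ε) := by
      rw [div_mul_eq_mul_div, le_div_iff₀ hκ]
      exact mul_le_mul_of_nonneg_left hgood.le hF.le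
    have h4 : supBound σf d r a b δ / errThreshold σf σε * (t ^ 2 * ε)
        ≤ constCμ σf σε d r a b δ * (t ^ 2 * ε) := by
      refine mul_le_mul_of_nonneg_right ?_ (by positivity)
      rw [constCμ]
      exact le_add_of_nonneg_left (by positivity)
    linarith
  obtain ⟨g, hg, hgp, hlow⟩ := h.lower n hτ p hp
  have hup := h.upper n hτ
  rw [← hzx] at hup
  have key := hz.regret_le hσf hσε hl hK hk0 hR hε hε0 hgood (fun i => hx i) hg hup hlow
  rw [hzx] at key
  have hgp' := (abs_le.1 hgp).2
  have hobs := h.l2norm_obs_le hσf hx hy n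
  have hnt : (n : ℝ) ≤ t := by linarith
  have m1 : meanErrConst σf σε * (n * ε) * (l2norm fun i : Fin n => y (i + 1))
      ≤ constCμ σf σε d r a b δ * t ^ 2 * ε := by
    have e1 : meanErrConst σf σε * (n * ε) * (l2norm fun i : Fin n => y (i + 1))
        ≤ meanErrConst σf σε * (t * ε) *
          (t * (supBound σf d r a b δ + √(noiseConst σε δ))) := by
      have := l2norm_nonneg fun i : Fin n => y (i + 1)
      have h5 : (l2norm fun i : Fin n => y (i + 1))
          ≤ t * (supBound σf d r a b δ + √(noiseConst σε δ)) :=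
        hobs.trans (mul_le_mul_of_nonneg_right hnt (by positivity))
      gcongr
    refine e1.trans ?_
    have e2 : meanErrConst σf σε * (supBound σf d r a b δ + √(noiseConst σε δ))
        ≤ constCμ σf σε d r a b δ := by
      rw [constCμ]
      exact le_add_of_nonneg_right (by positivity)
    have := mul_le_mul_of_nonneg_right e2 (by positivity : 0 ≤ t ^ 2 * ε)
    linarith
  have m2 : √β * √(varErrConst σf σε * (n * ε)) ≤ constCσ σf σε * √β * t * √ε := by
    rw [Real.sqrt_mul hV.le, Real.sqrt_mul hn0, constCσ]
    have h6 : √(n : ℝ) ≤ t := (sqrt_natCast_le n).trans hnt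
    calc √β * (√(varErrConst σf σε) * (√n * √ε))
        ≤ √β * (√(varErrConst σf σε) * (t * √ε)) := by gcongr
      _ = _ := by ring
  change _ ≤ 2 * √β * √(seqVar (isoKernel k l) σε (fun n => x (n + 1)) n) + _ + _ at key
  linarith

lemma sum_Icc_one_eq (g : ℕ → ℝ) (T : ℕ) :
    ∑ t ∈ Finset.Icc 1 T, g t = ∑ n ∈ Finset.range T, g (n + 1) := by
  induction T with
  | zero => simp
  | succ T ih => rw [Finset.sum_Icc_succ_top (by omega), Finset.sum_range_succ, ih]

/-- The first regret bound. -/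
lemma IsGoodOutcome.cumRegret_le (h : IsGoodOutcome D (isoKernel k l) σf σε r a b δ φ ξ x y)
    (hσf : 0 < σf) (hσε : 0 < σε) (hr : 0 < r) (hb : 0 < b) (hδ : 0 < δ)
    (hDr : ∀ x ∈ D, ∀ j, 0 ≤ x j ∧ x j ≤ r) (hl : 0 < l)
    (hK : IsPosKernel D (isoKernel k l)) (hk0 : k 0 = σf ^ 2)
    (hx : ∀ n, x (n + 1) ∈ D) (hy : ∀ n, y (n + 1) = φ (x (n + 1)) + ξ (n + 1)) {p : Pt d}
    (hp : p ∈ D) {M : ℕ → ℕ} {R : ℕ → ℕ → ℝ} {eps : ℕ → ℝ}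
    (hR : ∀ t ≥ 1, IsBreakpoints D l (M t) (R t))
    (hε : ∀ t ≥ 1, ∀ ρ ∈ Set.Icc 0 (R t (M t)), |k ρ - pwl k (M t) (R t) ρ| ≤ eps t)
    (hε0 : ∀ t ≥ 1, 0 ≤ eps t)
    (hz : ∀ n, ∃ z : Vars d n, IsOptimal D k l σε (M (n + 1)) (R (n + 1))
      (beta d r a b δ (n + 1)) (fun i : Fin n => (x (i + 1), y (i + 1))) z ∧
      z.point = x (n + 1)) (T : ℕ) :
    ∑ t ∈ Finset.Icc 1 T, (φ (x t) - φ p)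
      ≤ √(constC1 σf σε * T * beta d r a b δ T * maxInfoGain D (isoKernel k l) σε T)
        + constC2 (constCμ σf σε d r a b δ) (constCσ σf σε) (beta d r a b δ) eps T := by
  have hdiag : ∀ x ∈ D, isoKernel k l x x = σf ^ 2 := fun x _ => by rw [isoKernel_self, hk0]
  have hsum := hK.sum_sqrt_seqVar_le hσf hσε hdiag (X := fun n => x (n + 1)) hx T
    (β := beta d r a b δ T)
  rw [constC2, sum_Icc_one_eq, sum_Icc_one_eq]
  refine le_trans (Finset.sum_le_sum fun n hn => ?_) ((Finset.sum_add_distrib).le.trans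
    (add_le_add_left hsum _))
  obtain ⟨z, hz, hzx⟩ := hz n
  refine (h.regret_le hσf hσε hr hb hDr hl hK hk0 hx hy hp n (hR (n + 1) (by omega))
    (hε (n + 1) (by omega)) (hε0 (n + 1) (by omega)) hz hzx).trans (add_le_add_left ?_ _)
  split_ifs with hτ
  · have := beta_mono hr hb hδ (by omega) (Nat.succ_le_of_lt (Finset.mem_range.1 hn)) hτ
    gcongr
  · positivity

end Regret

/-! ### The growth of the regret bound -/

section Growth

variable {σf σε r a b δ c : ℝ} {d T t : ℕ}

/-- The logarithmic factor `1 + log (d T)`. -/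
def logFactor (d T : ℕ) : ℝ := 1 + Real.log (d * T)

lemma log_mul_le_logFactor (hd : 1 ≤ d) (ht : 1 ≤ t) (htT : t ≤ T) :
    Real.log d + Real.log t ≤ logFactor d T - 1 := by
  have hd0 : (0 : ℝ) < d := by exact_mod_cast hd
  have ht0 : (0 : ℝ) < t := by exact_mod_cast ht
  have htT' : (t : ℝ) ≤ T := by exact_mod_cast htT
  rw [← Real.log_mul hd0.ne' ht0.ne', logFactor, add_sub_cancel_left]
  exact Real.log_le_log (by positivity) (by gcongr)

lemma one_le_logFactor (hd : 1 ≤ d) (hT : 1 ≤ T) : 1 ≤ logFactor d T := by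
  have hd0 : (1 : ℝ) ≤ d := by exact_mod_cast hd
  have hT0 : (1 : ℝ) ≤ T := by exact_mod_cast hT
  have := Real.log_nonneg hd0
  have := Real.log_nonneg hT0
  have := log_mul_le_logFactor hd hT le_rfl
  linarith

/-- The part of the net size that does not depend on `d` and `t`. -/
def netConst (r a b δ : ℝ) : ℝ := b * r * (1 + 4 * a / δ)

lemma netConst_pos (hr : 0 < r) (ha : 0 < a) (hb : 0 < b) (hδ : 0 < δ) : 0 < netConst r a b δ := by
  unfold netConst; positivity

lemma netScale_le (hr : 0 < r) (ha : 0 < a) (hb : 0 < b) (hδ : 0 < δ) (hd : 1 ≤ d) (t : ℕ) :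
    netScale d r a b δ t ≤ ((d : ℝ) * t) ^ 2 * netConst r a b δ := by
  have hd0 : (1 : ℝ) ≤ d := by exact_mod_cast hd
  set v := 4 * d * a / δ with hv
  have hv0 : 0 < v := by positivity
  have h1 : √(Real.log v) ≤ 1 + v := by
    refine Real.sqrt_le_iff.2 ⟨by positivity, ?_⟩
    have := Real.log_le_sub_one_of_pos hv0
    nlinarith
  have h2 : 1 + v ≤ d * (1 + 4 * a / δ) := by
    have e : v = d * (4 * a / δ) := by rw [hv]; ring
    rw [e]; nlinarith
  rw [netScale, netConst]
  calc (t : ℝ) ^ 2 * d * b * r * √(Real.log v)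
      ≤ (t : ℝ) ^ 2 * d * b * r * (d * (1 + 4 * a / δ)) := by
        have := h1.trans h2
        gcongr
    _ = _ := by ring

/-- The constant in the growth of `β_t`. -/
def betaConst (r a b δ : ℝ) : ℝ :=
  2 * |Real.log (2 * Real.pi ^ 2 / (3 * δ))| + 8 + 2 * |Real.log (netConst r a b δ)|

lemma betaConst_pos : 0 < betaConst r a b δ := by
  unfold betaConst; positivity

lemma beta_le (hr : 0 < r) (ha : 0 < a) (hb : 0 < b) (hδ : 0 < δ) (hd : 1 ≤ d) (ht : 1 ≤ t)
    (htT : t ≤ T) : beta d r a b δ t ≤ betaConst r a b δ * (d * logFactor d T) := by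
  have hd1 : (1 : ℝ) ≤ d := by exact_mod_cast hd
  have ht1 : (1 : ℝ) ≤ t := by exact_mod_cast ht
  have hp := Real.pi_pos
  have hB := netConst_pos hr ha hb hδ
  have hΛ := one_le_logFactor hd (ht.trans htT)
  have hlog := log_mul_le_logFactor hd ht htT
  have hld := Real.log_nonneg hd1
  have hlt := Real.log_nonneg ht1
  set Λ := logFactor d T
  have e1 : Real.log (2 * (t : ℝ) ^ 2 * Real.pi ^ 2 / (3 * δ))
      = Real.log (2 * Real.pi ^ 2 / (3 * δ)) + 2 * Real.log t := by
    have : 2 * (t : ℝ) ^ 2 * Real.pi ^ 2 / (3 * δ)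
      = 2 * Real.pi ^ 2 / (3 * δ) * (t : ℝ) ^ 2 := by ring
    rw [this, Real.log_mul (by positivity) (by positivity), Real.log_pow]
    push_cast; ring
  have e2 : Real.log (netScale d r a b δ t) ≤ (2 + |Real.log (netConst r a b δ)|) * Λ := by
    have h0 := abs_nonneg (Real.log (netConst r a b δ))
    rcases (netScale_nonneg (d := d) (a := a) (δ := δ) hr hb t).eq_or_lt with h | h
    · rw [← h, Real.log_zero]; positivity
    · refine (Real.log_le_log h (netScale_le hr ha hb hδ hd t)).trans ?_
      rw [Real.log_mul (by positivity) hB.ne', Real.log_pow,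
        Real.log_mul (by positivity) (by positivity)]
      have := le_abs_self (Real.log (netConst r a b δ))
      have := mul_le_mul_of_nonneg_left hΛ h0
      push_cast
      nlinarith
  rw [beta_eq, e1, betaConst]
  have h3 := mul_le_mul_of_nonneg_left e2 (by positivity : (0 : ℝ) ≤ 2 * d)
  have h4 := le_abs_self (Real.log (2 * Real.pi ^ 2 / (3 * δ)))
  have h5 := abs_nonneg (Real.log (2 * Real.pi ^ 2 / (3 * δ)))
  have hdΛ : 1 ≤ d * Λ := one_le_mul_of_one_le_of_one_le hd1 hΛ
  have h6 : Λ ≤ d * Λ := le_mul_of_one_le_left (by linarith) hd1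
  have h7 := mul_le_mul_of_nonneg_left hdΛ h5
  nlinarith

lemma sqrt_mul_le (hd : 1 ≤ d) (hT : 1 ≤ T) {C u : ℝ} (hC : 0 ≤ C)
    (h : u ≤ C * (d * logFactor d T)) : √u ≤ √C * (√d * logFactor d T) := by
  have hΛ := one_le_logFactor hd hT
  refine (Real.sqrt_le_sqrt h).trans ?_
  rw [Real.sqrt_mul hC, Real.sqrt_mul (Nat.cast_nonneg d)]
  have : √(logFactor d T) ≤ logFactor d T :=
    Real.sqrt_le_iff.2 ⟨by linarith, by nlinarith⟩
  gcongr

/-- The constant in the growth of the bound for the sample path. -/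
def supConst (σf r a b δ : ℝ) : ℝ :=
  1 + √(2 * (2 + Real.log (netConst r a b δ + 2) + Real.log (32 / δ))) * σf

lemma supBound_le (hσf : 0 < σf) (hr : 0 < r) (ha : 0 < a) (hb : 0 < b) (hδ : 0 < δ) (hδ1 : δ < 1)
    (hd : 1 ≤ d) (hT : 1 ≤ T) :
    supBound σf d r a b δ ≤ supConst σf r a b δ * (√d * logFactor d T) := by
  have hd1 : (1 : ℝ) ≤ d := by exact_mod_cast hd
  have hB := netConst_pos hr ha hb hδ
  have hΛ := one_le_logFactor hd hT
  have hld := Real.log_nonneg hd1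
  have hlog := log_mul_le_logFactor hd hT le_rfl
  have hlT := Real.log_nonneg (show (1 : ℝ) ≤ T by exact_mod_cast hT)
  have hτ := netScale_nonneg (d := d) (a := a) (δ := δ) hr hb 1
  set Λ := logFactor d T with hΛdef
  have hsize : (supNetSize d r a b δ : ℝ) ≤ (d : ℝ) ^ 2 * (netConst r a b δ + 2) := by
    have h1 := Nat.ceil_lt_add_one (div_nonneg hτ (by norm_num : (0 : ℝ) ≤ 2))
    have h2 := netScale_le hr ha hb hδ hd 1
    rw [supNetSize]
    push_cast at h2 ⊢
    nlinarith [one_le_pow₀ hd1 (n := 2), netConst_pos hr ha hb hδ]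
  have hpos : (0 : ℝ) < supNetSize d r a b δ := by
    rw [supNetSize]; positivity
  have h1 : Real.log (supNetSize d r a b δ) ≤ (2 + Real.log (netConst r a b δ + 2)) * Λ := by
    refine (Real.log_le_log hpos hsize).trans ?_
    rw [Real.log_mul (by positivity) (by positivity), Real.log_pow]
    have h3 := Real.log_nonneg (show (1 : ℝ) ≤ netConst r a b δ + 2 by linarith)
    have := mul_le_mul_of_nonneg_left hΛ h3
    push_cast
    nlinarith
  have h2 : 0 ≤ Real.log (32 / δ) := Real.log_nonneg (by rw [le_div_iff₀ hδ]; linarith)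
  have h3 := Real.log_nonneg (show (1 : ℝ) ≤ netConst r a b δ + 2 by linarith)
  have hdΛ : 1 ≤ d * Λ := one_le_mul_of_one_le_of_one_le hd1 hΛ
  have hs : 2 * (d * Real.log (supNetSize d r a b δ) + Real.log (32 / δ))
      ≤ 2 * (2 + Real.log (netConst r a b δ + 2) + Real.log (32 / δ)) * (d * Λ) := by
    have := mul_le_mul_of_nonneg_left h1 (by positivity : (0 : ℝ) ≤ d)
    have := mul_le_mul_of_nonneg_left hdΛ h2
    nlinarith
  have h4 := mul_le_mul_of_nonneg_right (sqrt_mul_le hd hT (by positivity) hs) hσf.le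
  have h5 : 1 ≤ √d * Λ := one_le_mul_of_one_le_of_one_le (Real.one_le_sqrt.2 hd1) hΛ
  rw [supBound, supConst]
  nlinarith

/-- The constant in the growth of `C_μ`. -/
def muConst (σf σε r a b δ : ℝ) : ℝ :=
  meanErrConst σf σε * (supConst σf r a b δ + √(noiseConst σε δ))
    + supConst σf r a b δ / errThreshold σf σε

lemma supConst_pos (hσf : 0 < σf) : 0 < supConst σf r a b δ := by
  unfold supConst; positivity

lemma muConst_pos (hσf : 0 < σf) (hσε : 0 < σε) : 0 < muConst σf σε r a b δ := by
  have h1 := supConst_pos (r := r) (a := a) (b := b) (δ := δ) hσf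
  have h2 := meanErrConst_pos hσf hσε
  have h3 := errThreshold_pos hσf hσε
  unfold muConst; positivity

lemma constCμ_le (hσf : 0 < σf) (hσε : 0 < σε) (hr : 0 < r) (ha : 0 < a) (hb : 0 < b) (hδ : 0 < δ)
    (hδ1 : δ < 1) (hd : 1 ≤ d) (hT : 1 ≤ T) :
    constCμ σf σε d r a b δ ≤ muConst σf σε r a b δ * (√d * logFactor d T) := by
  have hd1 : (1 : ℝ) ≤ d := by exact_mod_cast hd
  have h := supBound_le hσf hr ha hb hδ hδ1 hd hT
  have h5 : 1 ≤ √d * logFactor d T :=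
    one_le_mul_of_one_le_of_one_le (Real.one_le_sqrt.2 hd1) (one_le_logFactor hd hT)
  have h2 := meanErrConst_pos hσf hσε
  have h3 := errThreshold_pos hσf hσε
  have hB := Real.sqrt_nonneg (noiseConst σε δ)
  set u := √d * logFactor d T
  rw [constCμ, muConst]
  calc _ ≤ meanErrConst σf σε * (supConst σf r a b δ * u + √(noiseConst σε δ) * u)
        + supConst σf r a b δ * u / errThreshold σf σε := by
        have := le_mul_of_one_le_right hB h5
        gcongr
    _ = _ := by ring

lemma sum_one_div_le (hd : 1 ≤ d) (hT : 1 ≤ T) :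
    ∑ t ∈ Finset.Icc 1 T, 1 / (t : ℝ) ≤ logFactor d T := by
  have h := harmonic_le_one_add_log T
  rw [harmonic_eq_sum_Icc] at h
  have hlog := log_mul_le_logFactor hd hT le_rfl
  have hld := Real.log_nonneg (show (1 : ℝ) ≤ d by exact_mod_cast hd)
  push_cast at h
  simp only [one_div]
  linarith

/-- The constant in the growth of `C₂`. -/
def secondConst (σf σε r a b δ c : ℝ) : ℝ :=
  1 + 2 * muConst σf σε r a b δ * c + 4 * constCσ σf σε * √(betaConst r a b δ) * √c

lemma constC2_le (hσf : 0 < σf) (hσε : 0 < σε) (hr : 0 < r) (ha : 0 < a) (hb : 0 < b) (hδ : 0 < δ)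
    (hδ1 : δ < 1) (hc : 0 < c) (hd : 1 ≤ d) (hT : 1 ≤ T) {eps : ℕ → ℝ}
    (hε0 : ∀ t ≥ 1, 0 ≤ eps t) (hε : ∀ t ≥ 1, eps t ≤ c / (t : ℝ) ^ 4) :
    constC2 (constCμ σf σε d r a b δ) (constCσ σf σε) (beta d r a b δ) eps T
      ≤ secondConst σf σε r a b δ c * (√d * logFactor d T ^ 2) := by
  have hd1 : (1 : ℝ) ≤ d := by exact_mod_cast hd
  have hΛ := one_le_logFactor hd hT
  have h5 : 1 ≤ √d * logFactor d T :=
    one_le_mul_of_one_le_of_one_le (Real.one_le_sqrt.2 hd1) hΛ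
  have hμ := constCμ_le hσf hσε hr ha hb hδ hδ1 hd hT
  have hμ0 := constCμ_pos (d := d) (r := r) (a := a) (b := b) (δ := δ) hσf hσε
  have hm0 := muConst_pos (r := r) (a := a) (b := b) (δ := δ) hσf hσε
  have hσ0 := constCσ_pos hσf hσε
  have hsum := sum_one_div_le hd hT
  have hterm : ∀ t ∈ Finset.Icc 1 T, 1 / (t : ℝ) ^ 2
      + 2 * constCμ σf σε d r a b δ * (t : ℝ) ^ 2 * eps t
      + 4 * constCσ σf σε * √(beta d r a b δ t) * t * √(eps t)
      ≤ secondConst σf σε r a b δ c * (√d * logFactor d T) * (1 / (t : ℝ)) := by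
    intro t ht
    obtain ⟨ht1, htT⟩ := Finset.mem_Icc.1 ht
    have ht1' : (1 : ℝ) ≤ t := by exact_mod_cast ht1
    have ht0 : (0 : ℝ) < t := by linarith
    have hβ := sqrt_mul_le hd hT betaConst_pos.le (beta_le hr ha hb hδ hd ht1 htT)
    have e0 := hε0 t ht1
    have e1 := hε t ht1
    have hsq : 1 / (t : ℝ) ^ 2 ≤ 1 / (t : ℝ) :=
      one_div_le_one_div_of_le ht0 (by nlinarith)
    have h1 : (t : ℝ) ^ 2 * eps t ≤ c * (1 / (t : ℝ)) := by
      calc (t : ℝ) ^ 2 * eps t ≤ (t : ℝ) ^ 2 * (c / (t : ℝ) ^ 4) := by gcongr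
        _ = c * (1 / (t : ℝ) ^ 2) := by field_simp
        _ ≤ _ := by gcongr
    have h2 : (t : ℝ) * √(eps t) ≤ √c * (1 / (t : ℝ)) := by
      have : √(eps t) ≤ √c / (t : ℝ) ^ 2 := by
        refine (Real.sqrt_le_sqrt e1).trans (le_of_eq ?_)
        rw [Real.sqrt_div hc.le, show (t : ℝ) ^ 4 = ((t : ℝ) ^ 2) ^ 2 by ring,
          Real.sqrt_sq (by positivity)]
      calc (t : ℝ) * √(eps t) ≤ t * (√c / (t : ℝ) ^ 2) := by gcongr
        _ = _ := by field_simp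
    set u := √d * logFactor d T
    have g1 : 1 / (t : ℝ) ^ 2 ≤ u * (1 / (t : ℝ)) :=
      hsq.trans (le_mul_of_one_le_left (by positivity) h5)
    have g2 : 2 * constCμ σf σε d r a b δ * (t : ℝ) ^ 2 * eps t
        ≤ 2 * (muConst σf σε r a b δ * u) * (c * (1 / (t : ℝ))) := by
      rw [mul_assoc (2 * constCμ σf σε d r a b δ)]
      gcongr
    have g3 : 4 * constCσ σf σε * √(beta d r a b δ t) * t * √(eps t)
        ≤ 4 * constCσ σf σε * (√(betaConst r a b δ) * u) * (√c * (1 / (t : ℝ))) := by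
      rw [mul_assoc (4 * constCσ σf σε * √(beta d r a b δ t))]
      gcongr
    refine (add_le_add (add_le_add g1 g2) g3).trans (le_of_eq ?_)
    rw [secondConst]; ring
  rw [constC2]
  refine (Finset.sum_le_sum hterm).trans ?_
  rw [← Finset.mul_sum]
  have hs0 : 0 ≤ secondConst σf σε r a b δ c := by
    unfold secondConst; positivity
  calc _ ≤ secondConst σf σε r a b δ c * (√d * logFactor d T) * logFactor d T := by gcongr
    _ = _ := by ring

/-- The constant of the asymptotic regret bound. -/
def regretConst (σf σε r a b δ c : ℝ) : ℝ :=
  √(constC1 σf σε * betaConst r a b δ)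
    + secondConst σf σε r a b δ c / √(1 / 2 * Real.log (1 + σf ^ 2 / σε ^ 2))

lemma regretConst_pos (hσf : 0 < σf) (hσε : 0 < σε) (hc : 0 < c) :
    0 < regretConst σf σε r a b δ c := by
  have h1 := log_one_add_pos hσf hσε
  have h2 := muConst_pos (r := r) (a := a) (b := b) (δ := δ) hσf hσε
  have h3 := constCσ_pos hσf hσε
  unfold regretConst secondConst
  positivity

lemma regret_bound_le (hσf : 0 < σf) (hσε : 0 < σε) (hr : 0 < r) (ha : 0 < a) (hb : 0 < b)
    (hδ : 0 < δ) (hδ1 : δ < 1) (hc : 0 < c) (hd : 1 ≤ d) (hT : 1 ≤ T) {eps : ℕ → ℝ}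
    (hε0 : ∀ t ≥ 1, 0 ≤ eps t) (hε : ∀ t ≥ 1, eps t ≤ c / (t : ℝ) ^ 4) {γ : ℝ}
    (hγ : 1 / 2 * Real.log (1 + σf ^ 2 / σε ^ 2) ≤ γ) :
    √(constC1 σf σε * T * beta d r a b δ T * γ)
        + constC2 (constCμ σf σε d r a b δ) (constCσ σf σε) (beta d r a b δ) eps T
      ≤ regretConst σf σε r a b δ c * √(d * T * γ) * (1 + Real.log (d * T)) ^ 2 := by
  have hl := log_one_add_pos hσf hσε
  have hγ0 : 0 < 1 / 2 * Real.log (1 + σf ^ 2 / σε ^ 2) := by positivity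
  have hγ1 : 0 ≤ γ := hγ0.le.trans hγ
  have hT1 : (1 : ℝ) ≤ T := by exact_mod_cast hT
  have hΛ := one_le_logFactor hd hT
  have hC1 : 0 ≤ constC1 σf σε := by unfold constC1; positivity
  have hC2 := constC2_le hσf hσε hr ha hb hδ hδ1 hc hd hT hε0 hε
  have hs0 : 0 ≤ secondConst σf σε r a b δ c := by
    have h2 := muConst_pos (r := r) (a := a) (b := b) (δ := δ) hσf hσε
    have h3 := constCσ_pos hσf hσε
    unfold secondConst; positivity
  change _ ≤ regretConst σf σε r a b δ c * √(d * T * γ) * logFactor d T ^ 2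
  set Λ := logFactor d T
  have h1 : √(constC1 σf σε * T * beta d r a b δ T * γ)
      ≤ √(constC1 σf σε * betaConst r a b δ) * √(d * T * γ) * Λ ^ 2 := by
    have e : constC1 σf σε * T * beta d r a b δ T * γ
        ≤ (constC1 σf σε * betaConst r a b δ) * (d * T * γ) * Λ := by
      have := mul_le_mul_of_nonneg_left (beta_le hr ha hb hδ hd hT le_rfl)
        (by positivity : 0 ≤ constC1 σf σε * T * γ)
      calc _ = constC1 σf σε * T * γ * beta d r a b δ T := by ring
        _ ≤ _ := this
        _ = _ := by ring
    have hb0 := (betaConst_pos (r := r) (a := a) (b := b) (δ := δ)).le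
    refine (Real.sqrt_le_sqrt e).trans ?_
    rw [Real.sqrt_mul (by positivity), Real.sqrt_mul (by positivity)]
    have : √Λ ≤ Λ ^ 2 := Real.sqrt_le_iff.2 ⟨by positivity, by
      nlinarith [one_le_pow₀ hΛ (n := 3)]⟩
    gcongr
  have h2 : √(d : ℝ) ≤ √(d * T * γ) / √(1 / 2 * Real.log (1 + σf ^ 2 / σε ^ 2)) := by
    rw [le_div_iff₀ (Real.sqrt_pos.2 hγ0), ← Real.sqrt_mul (Nat.cast_nonneg d)]
    refine Real.sqrt_le_sqrt ?_
    have : (d : ℝ) ≤ d * T := le_mul_of_one_le_right (Nat.cast_nonneg d) hT1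
    gcongr
  have h3 : secondConst σf σε r a b δ c * (√d * Λ ^ 2)
      ≤ secondConst σf σε r a b δ c *
        (√(d * T * γ) / √(1 / 2 * Real.log (1 + σf ^ 2 / σε ^ 2)) * Λ ^ 2) := by
    gcongr
  refine (add_le_add h1 (hC2.trans h3)).trans (le_of_eq ?_)
  rw [regretConst]; ring

end Growth

end PKMIQP

end

theorem lemma4p6 (σf σε : ℝ) (hσf : 0 < σf) (hσε : 0 < σε) :
    ∃ Cσ : ℝ, 0 < Cσ ∧
      ∀ r a b δ c η : ℝ, 0 < r → 0 < a → 0 < b → 0 < δ → δ < 1 → 0 < c → 0 < η →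
      ∃ (C : ℝ) (q : ℕ), 0 < C ∧
        ∀ d : ℕ, 1 ≤ d →
        ∃ Cμ : ℝ, 0 < Cμ ∧
          ∀ (D : Set (PKMIQP.Pt d)), IsCompact D → Convex ℝ D →
            (∀ x ∈ D, ∀ j, 0 ≤ x j ∧ x j ≤ r) →
          ∀ (k : ℝ → ℝ) (l : ℝ), 0 < l → k 0 = σf ^ 2 →
          -- the piecewise linear approximations and their errors
          ∀ (M : ℕ → ℕ) (R : ℕ → ℕ → ℝ) (eps : ℕ → ℝ),
            (∀ t ≥ 1, PKMIQP.IsBreakpoints D l (M t) (R t)) →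
            (∀ t ≥ 1, ∀ ρ ∈ Set.Icc 0 (R t (M t)),
              |k ρ - PKMIQP.pwl k (M t) (R t) ρ| ≤ eps t) →
            (∀ t ≥ 1, eps t ≤ c / (t : ℝ) ^ (4 + η)) →
          -- the sample path, the noise, and the run of the algorithm
          ∀ (Ω : Type*) [MeasurableSpace Ω] (P : MeasureTheory.Measure Ω)
            [MeasureTheory.IsProbabilityMeasure P]
            (f : Ω → PKMIQP.Pt d → ℝ) (ξ : ℕ → Ω → ℝ)
            (x : ℕ → Ω → PKMIQP.Pt d) (y : ℕ → Ω → ℝ) (xstar : Ω → PKMIQP.Pt d),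
            PKMIQP.IsCenteredGP P D (PKMIQP.isoKernel k l) f →
            PKMIQP.HasDerivTail P D a b f →
            PKMIQP.IsNoise P D σε f ξ →
            PKMIQP.IsRun P D k l σε M R (PKMIQP.beta d r a b δ) f ξ x y →
            (∀ᵐ ω ∂P, xstar ω ∈ D ∧ IsMinOn (f ω) D (xstar ω)) →
          ∃ G : Set Ω, MeasurableSet G ∧ ENNReal.ofReal (1 - δ) ≤ P G ∧
            ∀ ω ∈ G, ∀ T : ℕ, 1 ≤ T →
              PKMIQP.cumRegret f x xstar T ω ≤
                √(PKMIQP.constC1 σf σε * T * PKMIQP.beta d r a b δ T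
                    * PKMIQP.maxInfoGain D (PKMIQP.isoKernel k l) σε T)
                  + PKMIQP.constC2 Cμ Cσ (PKMIQP.beta d r a b δ) eps T ∧
              PKMIQP.cumRegret f x xstar T ω ≤
                C * √(d * T * PKMIQP.maxInfoGain D (PKMIQP.isoKernel k l) σε T)
                  * (1 + Real.log (d * T)) ^ q := by
  refine ⟨PKMIQP.constCσ σf σε, PKMIQP.constCσ_pos hσf hσε,
    fun r a b δ c η hr ha hb hδ hδ1 hc hη =>
    ⟨PKMIQP.regretConst σf σε r a b δ c, 2, PKMIQP.regretConst_pos hσf hσε hc, fun d hd =>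
    ⟨PKMIQP.constCμ σf σε d r a b δ, PKMIQP.constCμ_pos hσf hσε, ?_⟩⟩⟩
  intro D hDc hD hDr k l hl hk0 M R eps hR hε hεη Ω _ P _ f ξ x y xstar hf hder hξ hrun hxstar
  have hK := hf.isPosKernel
  have hdiag : ∀ x ∈ D, PKMIQP.isoKernel k l x x = σf ^ 2 := fun x _ => by
    rw [PKMIQP.isoKernel_self, hk0]
  have hε0 : ∀ t ≥ 1, 0 ≤ eps t := fun t ht => by
    refine (abs_nonneg _).trans (hε t ht (R t (M t)) ⟨?_, le_rfl⟩)
    rw [← (hR t ht).zero]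
    exact PKMIQP.breakpoint_mono (hR t ht).lt (Nat.zero_le _) le_rfl
  have hε4 : ∀ t ≥ 1, eps t ≤ c / (t : ℝ) ^ 4 := fun t ht => by
    have ht1 : (1 : ℝ) ≤ t := by exact_mod_cast ht
    refine (hεη t ht).trans (div_le_div_of_nonneg_left hc.le (by positivity) ?_)
    rw [← Real.rpow_natCast]
    exact Real.rpow_le_rpow_of_exponent_le ht1 (by push_cast; linarith)
  obtain ⟨G, hGm, hGP, hG⟩ := hrun.exists_good_event hσε hσf hDc hD hd hr hDr ha hb hδ hδ1 hf
    hdiag hder hξ (hrun.optimal.and hxstar)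
  refine ⟨G, hGm, hGP, fun ω hω T hT => ?_⟩
  obtain ⟨⟨hopt, hmem, -⟩, hgood⟩ := hG ω hω
  have hopt' : ∀ n, ∃ z : PKMIQP.Vars d n, PKMIQP.IsOptimal D k l σε (M (n + 1)) (R (n + 1))
      (PKMIQP.beta d r a b δ (n + 1)) (fun i : Fin n => (x (i + 1) ω, y (i + 1) ω)) z ∧
      z.point = x (n + 1) ω := fun n => hopt (n + 1) (by omega)
  have hx : ∀ n, x (n + 1) ω ∈ D := fun n => by
    obtain ⟨z, hz, hzx⟩ := hopt' n
    exact hzx ▸ hz.1.point_mem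
  have first := hgood.cumRegret_le hσf hσε hr hb hδ hDr hl hK hk0 hx
    (fun n => hrun.obs (n + 1) (by omega) ω) hmem hR hε hε0 hopt' T
  exact ⟨first, first.trans (PKMIQP.regret_bound_le hσf hσε hr ha hb hδ hδ1 hc hd hT hε0 hε4
    (hK.le_maxInfoGain hσε hdiag hmem hT))⟩
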